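/- **Conventions.** A graph with $c$ colours is a finite simple graph $G$ together with $c$ unary relations $P_0,\dots,P_{c-1}$ on $V(G)$; first-order (FO) formulas are over the vocabulary $\{E,P_0,\dots,P_{c-1}\}$ with equality. $\mathrm{qr}(\varphi)$ is the quantifier rank and $|\varphi|$ the number of symbols of $\varphi$ in prefix notation. FO-MC is the problem of deciding, given a coloured graph $G$ and an FO-sentence $\varphi$, whether $G\models\varphi$. Let $L,Q:\mathbb N^3\to\mathbb N$ be computable with $L(\ell,k,q)\ge \ell$ and $Q(q,k,\ell)\ge q$. An instance of FO-Learn$[L,Q]$ consists of a non-empty coloured graph $G$, numbers $k,\ell,q\in\mathbb N$ and disjoint sets $\Lambda^+,\Lambda^-\subseteq V(G)^k$. The training error of a formula $\varphi(\bar x;\bar y)$ with parameters $\bar w$ is the fraction of the examples $\bar v\in\Lambda^+\cup\Lambda^-$ that are misclassified, that is, $\bar v\in\Lambda^+$ and $G\not\models\varphi(\bar v;\bar w)$, or $\bar v\in\Lambda^-$ and $G\models\varphi(\bar v;\bar w)$ (it is $0$ if there are no examples). The task is to return an FO-formula $\varphi(\bar x;\bar y)$ with $\mathrm{qr}(\varphi)\le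 Q(q,k,\ell)$ and a tuple $\bar w\in V(G)^{L(\ell,k,q)}$ with training error $0$. An algorithm may reject if there are no formula $\varphi^*$ with $\mathrm{qr}(\varphi^*)\le q$ and tuple $\bar w^*\in V(G)^{\ell}$ with training error $0$. An FO-Learn$[L,Q]$ oracle is a function that gives an admissible answer to every instance. Algorithms are programs for a random access machine over the natural numbers with a fixed finite number of memory arrays, with addition and truncated subtraction, and with unit cost per step. A call to the oracle costs one step: the machine keeps an instance (header, adjacency matrix, colours, lists of examples) in designated arrays, and the oracle writes its answer into designated arrays. **Theorem.** For all $L,Q$ as above there are a program with access to an FO-Learn$[L,Q]$ oracle and a computable function $g:\mathbb N^2\to\mathbb N$ such that, with every FO-Learn$[L,Q]$ oracle, the program solves FO-MC: on every $n$-vertex graph $G$ with $c$ colours and every FO-sentence $\varphi$ of quantifier rank $q$, it halts with the correct answer to "$G\models\varphi$?" after at most $$g(q,c)\cdot\bigl(n^2+|\varphi|\bigr)$$ steps. Moreover, each graph in an oracle call has at most $g(q,c)\cdot n$ vertices, and $k'+\ell'+q'+c'\le g(q,c)$ for the numbers $k',\ell',q'$ and the number $c'$ of colours in that call. In particular, for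 a fixed vocabulary and for sentences whose length is bounded in terms of $q$, the running time is $O(g'(q)\,n^2)$ for some function $g'$. -/

import Mathlib

namespace FOLearning

open FirstOrder

/-! ### Coloured graphs and first-order logic over them -/

/-- Relation symbols of the vocabulary `{E, P_0, …, P_{c-1}}`: `E` is binary, the `P_i` unary. -/
inductive GraphRel (c : ℕ) : ℕ → Type
  | edge : GraphRel c 2
  | color (i : Fin c) : GraphRel c 1

/-- The vocabulary of graphs with `c` colours. -/
abbrev graphLang (c : ℕ) : Language := ⟨fun _ => Empty, GraphRel c⟩

/-- A graph with `c` colours on the vertex set `{0, …, n-1}` (undirected, loop-free). -/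
@[ext]
structure ColoredGraph (c n : ℕ) where
  graph : SimpleGraph (Fin n)
  color : Fin c → Set (Fin n)

/-- The coloured graph as a relational structure. -/
@[reducible]
def ColoredGraph.toStructure {c n : ℕ} (G : ColoredGraph c n) :
    (graphLang c).Structure (Fin n) where
  funMap := fun f _ => f.elim
  RelMap := fun R x =>
    match R, x with
    | .edge, x => G.graph.Adj (x 0) (x 1)
    | .color i, x => x 0 ∈ G.color i

/-- `G ⊨ φ(v)`. -/
def ColoredGraph.Models {c n : ℕ} (G : ColoredGraph c n) {α : Type}
    (φ : (graphLang c).Formula α) (v : α → Fin n) : Prop :=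
  letI := G.toStructure
  φ.Realize v

/-- Quantifier rank. -/
def quantRank {c : ℕ} {α : Type} : {m : ℕ} → (graphLang c).BoundedFormula α m → ℕ
  | _, .falsum => 0
  | _, .equal _ _ => 0
  | _, .rel _ _ => 0
  | _, .imp φ ψ => max (quantRank φ) (quantRank ψ)
  | _, .all φ => quantRank φ + 1

/-! ### Formulas as words

A formula is written in Polish prefix notation, one number per symbol. The free variables are
numbered by `ν : α → ℕ`, and the bound variable of level `i` gets the number `f + i`, where `f` is
the number of free variables. -/

def termCode {c : ℕ} {α : Type} (ν : α → ℕ) (f : ℕ) {m : ℕ} :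
    (graphLang c).Term (α ⊕ Fin m) → ℕ
  | .var (.inl a) => ν a
  | .var (.inr i) => f + i
  | .func F _ => F.elim

def relCode {c : ℕ} : {l : ℕ} → GraphRel c l → (Fin l → ℕ) → List ℕ
  | _, .edge, x => [2, x 0, x 1]
  | _, .color i, x => [3, i, x 0]

def formulaCode {c : ℕ} {α : Type} (ν : α → ℕ) (f : ℕ) :
    {m : ℕ} → (graphLang c).BoundedFormula α m → List ℕ
  | _, .falsum => [0]
  | _, .equal t₁ t₂ => [1, termCode ν f t₁, termCode ν f t₂]
  | _, .rel R ts => relCode R (fun i => termCode ν f (ts i))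
  | _, .imp φ ψ => 4 :: (formulaCode ν f φ ++ formulaCode ν f ψ)
  | _, .all φ => 5 :: formulaCode ν f φ

/-- The word that represents a sentence. -/
def sentenceCode {c : ℕ} (φ : (graphLang c).Sentence) : List ℕ :=
  formulaCode Empty.elim 0 φ

/-! ### The learning problem -/

/-- An instance of FO-Learn: a coloured graph, the numbers `k`, `ℓ`, `q`, and the positive and
negative examples. -/
structure LearnInput where
  /-- number of colours -/
  c : ℕ
  /-- number of vertices -/
  n : ℕ
  /-- arity of the examples -/
  k : ℕ
  /-- number of parameters -/
  ℓ : ℕ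
  /-- quantifier rank -/
  q : ℕ
  G : ColoredGraph c n
  pos : Finset (Fin k → Fin n)
  neg : Finset (Fin k → Fin n)

/-- A hypothesis with `r` parameters: a formula `φ(x₁, …, x_k ; y₁, …, y_r)` and a tuple of `r`
vertices. -/
structure Hypothesis (I : LearnInput) (r : ℕ) where
  formula : (graphLang I.c).Formula (Fin I.k ⊕ Fin r)
  params : Fin r → Fin I.n

/-- `G ⊨ φ(v ; w)`. -/
def Hypothesis.Accepts {I : LearnInput} {r : ℕ} (H : Hypothesis I r) (v : Fin I.k → Fin I.n) :
    Prop :=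
  I.G.Models H.formula (Sum.elim v H.params)

open Classical in
/-- The training error. -/
noncomputable def Hypothesis.err {I : LearnInput} {r : ℕ} (H : Hypothesis I r) : ℚ :=
  ((I.pos.filter (fun v => ¬ H.Accepts v) ∪ I.neg.filter (fun v => H.Accepts v)).card : ℚ) /
    (I.pos.card + I.neg.card : ℕ)

/-- A map from instances to answers, the answers being hypotheses with `L(ℓ,k,q)` parameters or a
rejection (`none`). -/
abbrev LearnOracle (L : ℕ → ℕ → ℕ → ℕ) : Type :=
  (I : LearnInput) → Option (Hypothesis I (L I.ℓ I.k I.q))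

/-- `O` solves FO-Learn[L,Q]: on every instance with a non-empty graph and no example that is both
positive and negative, `O` returns a hypothesis of quantifier rank at most `Q(q,k,ℓ)` with training
error `0`, or it rejects, and it may reject only if no formula of quantifier rank at most `q` with
`ℓ` parameters has training error `0`. -/
def SolvesFOLearn {L : ℕ → ℕ → ℕ → ℕ} (Q : ℕ → ℕ → ℕ → ℕ) (O : LearnOracle L) : Prop :=
  ∀ I : LearnInput, 0 < I.n → Disjoint I.pos I.neg →
    match O I with
    | some H => quantRank H.formula ≤ Q I.q I.k I.ℓ ∧ H.err = 0
    | none => ¬ ∃ H : Hypothesis I I.ℓ, quantRank H.formula ≤ I.q ∧ H.err = 0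

/-! ### Random access machines with a learning oracle

A machine has registers and finitely many one-dimensional memory arrays (those named in its
program), all holding natural numbers. Its arithmetic is addition and truncated subtraction, and
every elementary step has unit cost. -/

structure State where
  reg : ℕ → ℕ
  arr : ℕ → ℕ → ℕ

def State.setReg (s : State) (x v : ℕ) : State :=
  { s with reg := Function.update s.reg x v }

def State.setCell (s : State) (a i v : ℕ) : State :=
  { s with arr := Function.update s.arr a (Function.update (s.arr a) i v) }

/-- Replace the content of the array `a` by the word `l`, followed by zeros. -/
def State.setArr (s : State) (a : ℕ) (l : List ℕ) : State :=
  { s with arr := Function.update s.arr a (fun i => l.getD i 0) }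

inductive Program where
  | skip
  /-- `x := v` -/
  | const (x v : ℕ)
  /-- `x := y + z` -/
  | add (x y z : ℕ)
  /-- `x := y - z`, truncated at `0` -/
  | sub (x y z : ℕ)
  /-- `x := a[y]` -/
  | load (x a y : ℕ)
  /-- `a[y] := x` -/
  | store (a y x : ℕ)
  /-- call the oracle -/
  | query
  | seq (P₁ P₂ : Program)
  /-- if `x ≠ 0` then `P₁` else `P₂` -/
  | ite (x : ℕ) (P₁ P₂ : Program)
  /-- while `x ≠ 0` do `P` -/
  | loop (x : ℕ) (P : Program)

open Classical in
/-- The graph `G` is stored in the arrays `a` (adjacency matrix, row by row) and `b` (one row of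
length `n` for each colour). -/
def StoresGraph (a b : ℕ → ℕ) {c n : ℕ} (G : ColoredGraph c n) : Prop :=
  (∀ u v : Fin n, a (u * n + v) = if G.graph.Adj u v then 1 else 0) ∧
  (∀ (i : Fin c) (v : Fin n), b (i * n + v) = if v ∈ G.color i then 1 else 0)

/-- The set `S` of `k`-tuples is stored in the array `a` as a list of `m` tuples. -/
def StoresTuples (a : ℕ → ℕ) (m : ℕ) {k n : ℕ} (S : Finset (Fin k → Fin n)) : Prop :=
  (∀ e < m, ∃ x ∈ S, ∀ j : Fin k, a (e * k + j) = x j) ∧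
  (∀ x ∈ S, ∃ e < m, ∀ j : Fin k, a (e * k + j) = x j)

/-- The query arrays 4 to 8 hold the instance `I`: array 4 is the header
`n, c, k, ℓ, q, m⁺, m⁻`, arrays 5 and 6 the graph, arrays 7 and 8 the positive and the negative
examples. -/
def State.StoresQuery (s : State) (I : LearnInput) : Prop :=
  s.arr 4 0 = I.n ∧ s.arr 4 1 = I.c ∧ s.arr 4 2 = I.k ∧ s.arr 4 3 = I.ℓ ∧ s.arr 4 4 = I.q ∧
  StoresGraph (s.arr 5) (s.arr 6) I.G ∧
  StoresTuples (s.arr 7) (s.arr 4 5) I.pos ∧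
  StoresTuples (s.arr 8) (s.arr 4 6) I.neg

/-- Write an answer of the oracle into the answer arrays 9 to 11. Array 9 is the header: `0` for a
rejection, otherwise `1`, the length of the formula and the number of parameters. Array 10 holds
the formula (with `x_i` numbered `i` and `y_j` numbered `k + j`), array 11 the parameters. -/
def State.answer (s : State) {I : LearnInput} {r : ℕ} : Option (Hypothesis I r) → State
  | none => s.setArr 9 [0]
  | some H =>
    let w := formulaCode (Sum.elim (fun i : Fin I.k => (i : ℕ)) (fun j : Fin r => I.k + (j : ℕ)))
      (I.k + r) H.formula
    ((s.setArr 9 [1, w.length, r]).setArr 10 w).setArr 11 (List.ofFn fun j => (H.params j : ℕ))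

/-- `Exec O B P s t s'`: started in state `s` with the oracle `O`, the program `P` halts after `t`
steps in state `s'`, and each instance on which it calls the oracle satisfies `B`. A program that
calls the oracle when the query arrays do not hold an instance, or on an instance that violates
`B`, is stuck. An oracle call costs one step. -/
inductive Exec {L : ℕ → ℕ → ℕ → ℕ} (O : LearnOracle L) (B : LearnInput → Prop) :
    Program → State → ℕ → State → Prop
  | skip (s) : Exec O B .skip s 1 s
  | const (s x v) : Exec O B (.const x v) s 1 (s.setReg x v)
  | add (s x y z) : Exec O B (.add x y z) s 1 (s.setReg x (s.reg y + s.reg z))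
  | sub (s x y z) : Exec O B (.sub x y z) s 1 (s.setReg x (s.reg y - s.reg z))
  | load (s x a y) : Exec O B (.load x a y) s 1 (s.setReg x (s.arr a (s.reg y)))
  | store (s a y x) : Exec O B (.store a y x) s 1 (s.setCell a (s.reg y) (s.reg x))
  | query (s I) (hI : s.StoresQuery I) (hB : B I) : Exec O B .query s 1 (s.answer (O I))
  | seq {P₁ P₂ s₁ s₂ s₃ t₁ t₂} (h₁ : Exec O B P₁ s₁ t₁ s₂) (h₂ : Exec O B P₂ s₂ t₂ s₃) :
      Exec O B (.seq P₁ P₂) s₁ (t₁ + t₂) s₃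
  | ite_true {x P₁ P₂ s s' t} (hx : s.reg x ≠ 0) (h : Exec O B P₁ s t s') :
      Exec O B (.ite x P₁ P₂) s (t + 1) s'
  | ite_false {x P₁ P₂ s s' t} (hx : s.reg x = 0) (h : Exec O B P₂ s t s') :
      Exec O B (.ite x P₁ P₂) s (t + 1) s'
  | loop_done {x P s} (hx : s.reg x = 0) : Exec O B (.loop x P) s 1 s
  | loop_step {x P s₁ s₂ s₃ t₁ t₂} (hx : s₁.reg x ≠ 0) (h₁ : Exec O B P s₁ t₁ s₂)
      (h₂ : Exec O B (.loop x P) s₂ t₂ s₃) : Exec O B (.loop x P) s₁ (t₁ + t₂ + 1) s₃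

/-- The initial states for the model-checking input `(G, φ)`: array 0 is the header `n, c, |φ|`,
arrays 1 and 2 hold the graph, array 3 holds the sentence, and all registers and all other arrays
are zero. -/
def State.IsModelCheckingInput (s : State) {c n : ℕ} (G : ColoredGraph c n)
    (φ : (graphLang c).Sentence) : Prop :=
  s.arr 0 0 = n ∧ s.arr 0 1 = c ∧ s.arr 0 2 = (sentenceCode φ).length ∧
  StoresGraph (s.arr 1) (s.arr 2) G ∧
  (∀ i (h : i < (sentenceCode φ).length), s.arr 3 i = (sentenceCode φ)[i]) ∧
  (∀ x, s.reg x = 0) ∧ (∀ a ≥ 4, ∀ i, s.arr a i = 0)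

/-! ### The machine is deterministic -/

theorem StoresGraph.unique {a b : ℕ → ℕ} {c n : ℕ} {G H : ColoredGraph c n}
    (hG : StoresGraph a b G) (hH : StoresGraph a b H) : G = H := by
  classical
  ext u v
  · have h := (hG.1 u v).symm.trans (hH.1 u v)
    by_cases h1 : G.graph.Adj u v <;> by_cases h2 : H.graph.Adj u v <;> simp_all
  · have h := (hG.2 u v).symm.trans (hH.2 u v)
    by_cases h1 : v ∈ G.color u <;> by_cases h2 : v ∈ H.color u <;> simp_all

theorem StoresTuples.subset {a : ℕ → ℕ} {m k n : ℕ} {S T : Finset (Fin k → Fin n)}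
    (hS : StoresTuples a m S) (hT : StoresTuples a m T) : S ⊆ T := by
  intro x hx
  obtain ⟨e, he, h⟩ := hS.2 x hx
  obtain ⟨y, hy, h'⟩ := hT.1 e he
  have : x = y := funext fun j => Fin.ext ((h j).symm.trans (h' j))
  exact this ▸ hy

theorem State.StoresQuery.unique {s : State} {I J : LearnInput}
    (hI : s.StoresQuery I) (hJ : s.StoresQuery J) : I = J := by
  obtain ⟨c, n, k, ℓ, q, G, pos, neg⟩ := I
  obtain ⟨c', n', k', ℓ', q', G', pos', neg'⟩ := J
  obtain ⟨h1, h2, h3, h4, h5, h6, h7, h8⟩ := hI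
  obtain ⟨g1, g2, g3, g4, g5, g6, g7, g8⟩ := hJ
  dsimp only at *
  obtain rfl := h1.symm.trans g1
  obtain rfl := h2.symm.trans g2
  obtain rfl := h3.symm.trans g3
  obtain rfl := h4.symm.trans g4
  obtain rfl := h5.symm.trans g5
  obtain rfl := h6.unique g6
  obtain rfl := (h7.subset g7).antisymm (g7.subset h7)
  obtain rfl := (h8.subset g8).antisymm (g8.subset h8)
  rfl

theorem Exec.deterministic {L : ℕ → ℕ → ℕ → ℕ} {O : LearnOracle L} {B B' : LearnInput → Prop}
    {P : Program} {s s₁ s₂ : State} {t₁ t₂ : ℕ}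
    (h₁ : Exec O B P s t₁ s₁) (h₂ : Exec O B' P s t₂ s₂) : t₁ = t₂ ∧ s₁ = s₂ := by
  induction h₁ generalizing t₂ s₂ with
  | skip | const | add | sub | load | store => cases h₂; exact ⟨rfl, rfl⟩
  | query s I hI hB =>
    cases h₂ with
    | query _ J hJ _ => obtain rfl := hI.unique hJ; exact ⟨rfl, rfl⟩
  | seq _ _ ih₁ ih₂ =>
    cases h₂ with
    | seq k₁ k₂ =>
      obtain ⟨rfl, rfl⟩ := ih₁ k₁
      obtain ⟨rfl, rfl⟩ := ih₂ k₂
      exact ⟨rfl, rfl⟩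
  | ite_true hx _ ih =>
    cases h₂ with
    | ite_true _ k => obtain ⟨rfl, rfl⟩ := ih k; exact ⟨rfl, rfl⟩
    | ite_false hx' _ => exact absurd hx' hx
  | ite_false hx _ ih =>
    cases h₂ with
    | ite_true hx' _ => exact absurd hx hx'
    | ite_false _ k => obtain ⟨rfl, rfl⟩ := ih k; exact ⟨rfl, rfl⟩
  | loop_done hx =>
    cases h₂ with
    | loop_done => exact ⟨rfl, rfl⟩
    | loop_step hx' => exact absurd hx hx'
  | loop_step hx _ _ ih₁ ih₂ =>
    cases h₂ with
    | loop_done hx' => exact absurd hx' hx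
    | loop_step _ k₁ k₂ =>
      obtain ⟨rfl, rfl⟩ := ih₁ k₁
      obtain ⟨rfl, rfl⟩ := ih₂ k₂
      exact ⟨rfl, rfl⟩

end FOLearning

/-!
Model checking is reduced to learning through the question which vertices a quantifier has to range
over. Let `q` be the quantifier rank of the sentence. If every tuple of fewer than `q` vertices has
a short list of *representative* extensions, meaning that each extension satisfies the same formulas
of quantifier rank at most `q` as one on the list, then the quantifiers need only range over
representatives. The tuples that arise form a tree of depth `q` (`IsTree`), and a universal formula
holds at a node if and only if the formula in its scope holds at all children
(`IsTruthVector.all`). The sentence is evaluated on the tree from right to left, its symbols being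
in Polish notation, with a stack of vectors of truth values that are indexed by the nodes
(`runs_evalLoop`). This costs a constant number of steps for each symbol and each node.

To find out whether an extension `b` is represented by an extension `a`, the learner is asked for a
formula, without parameters, that accepts `a` and rejects `b`. The learner may use parameters, and
it may use a quantifier rank beyond `q`. The parameters are made harmless by asking the question in
the disjoint union of `m` copies of the graph, where `m` exceeds the number of parameters, with a
new colour for each copy, and with all copies of `a` as positive and all copies of `b` as negative
examples (`pairInstance`).

* If the learner rejects, then `a` and `b` satisfy the same formulas of quantifier rank `q`: a
  formula that told them apart could be relativized to the copy that contains the example, and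
  relativization to a union of colour classes does not raise the rank (`rankEquiv_of_reject`).
* If the learner returns a hypothesis of rank at most `R`, then `a` and `b` are not `R`-round
  back-and-forth equivalent: some copy contains no parameter, and an equivalence would carry over
  from `a` and `b` to their copies there, in the presence of all parameters elsewhere
  (`sat_copies_iff`, `not_backForth_of_hypothesis`).

An extension is added to the list unless it is equivalent, by the first alternative, to one that is
already there. By the second alternative the members of the list have different back-and-forth
types, of which there are at most `typeBound c R q`, a computable number independent of the graph
(`exists_types`, `Kids.card_le`). Hence the tree has boundedly many nodes, and its construction
takes a bounded number of passes over the vertices, with boundedly many oracle calls in each step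
(`runs_buildTree`).

The examples are always `q`-tuples, padded with the vertex `0`, so that the adjacency matrix, the
colours and the header of the instance are written only once, in time quadratic in `n`
(`runs_buildGraph`). The machine cannot compute the number of parameters `L 0 q q`, but it learns
it from the answer to a first instance without examples, which the learner cannot reject
(`runs_countCopies`).

The running time is established in a logic of total correctness with time bounds, `Runs`, in which
every program carries along the fact that it changes only registers and arrays that occur in it as
targets (`Frame`).
-/

namespace FOLearning

open FirstOrder

/-! ### Satisfaction of formulas over the graph vocabulary -/

/-- `G ⊨ φ(v; xs)` for a formula with free variables `v` and bound variables `xs` in scope. -/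
def ColoredGraph.Sat {c n : ℕ} (G : ColoredGraph c n) {α : Type} {s : ℕ}
    (φ : (graphLang c).BoundedFormula α s) (v : α → Fin n) (xs : Fin s → Fin n) : Prop :=
  letI := G.toStructure
  φ.Realize v xs

/-- The variable that a term consists of: the graph vocabulary has no function symbols. -/
def termVar {c : ℕ} {β : Type} : (graphLang c).Term β → β
  | .var b => b
  | .func F _ => F.elim

section Sat

variable {c n : ℕ} (G : ColoredGraph c n) {α : Type} {s : ℕ} (v : α → Fin n) (xs : Fin s → Fin n)

theorem realize_eq_termVar {β : Type} (t : (graphLang c).Term β) (ρ : β → Fin n) :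
    (letI := G.toStructure; t.realize ρ) = ρ (termVar t) := by
  cases t with
  | var b => rfl
  | func F _ => exact F.elim

theorem ColoredGraph.sat_falsum : ¬ G.Sat (.falsum : (graphLang c).BoundedFormula α s) v xs :=
  fun h => h

theorem ColoredGraph.sat_equal (t₁ t₂ : (graphLang c).Term (α ⊕ Fin s)) :
    G.Sat (.equal t₁ t₂) v xs ↔ Sum.elim v xs (termVar t₁) = Sum.elim v xs (termVar t₂) := by
  rw [← realize_eq_termVar G t₁ (Sum.elim v xs), ← realize_eq_termVar G t₂ (Sum.elim v xs)]; rfl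

theorem ColoredGraph.sat_edge (ts : Fin 2 → (graphLang c).Term (α ⊕ Fin s)) :
    G.Sat (.rel (.edge : GraphRel c 2) ts) v xs ↔
      G.graph.Adj (Sum.elim v xs (termVar (ts 0))) (Sum.elim v xs (termVar (ts 1))) := by
  rw [← realize_eq_termVar G (ts 0) (Sum.elim v xs),
    ← realize_eq_termVar G (ts 1) (Sum.elim v xs)]
  rfl

theorem ColoredGraph.sat_color (i : Fin c) (ts : Fin 1 → (graphLang c).Term (α ⊕ Fin s)) :
    G.Sat (.rel (.color i : GraphRel c 1) ts) v xs ↔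
      Sum.elim v xs (termVar (ts 0)) ∈ G.color i := by
  rw [← realize_eq_termVar G (ts 0) (Sum.elim v xs)]
  exact Iff.rfl

theorem ColoredGraph.sat_imp (φ ψ : (graphLang c).BoundedFormula α s) :
    G.Sat (.imp φ ψ) v xs ↔ (G.Sat φ v xs → G.Sat ψ v xs) := Iff.rfl

theorem ColoredGraph.sat_all (φ : (graphLang c).BoundedFormula α (s + 1)) :
    G.Sat (.all φ) v xs ↔ ∀ x, G.Sat φ v (Fin.snoc xs x) := Iff.rfl

end Sat

/-! ### Disjoint copies of a graph -/

/-- The disjoint union of `m` copies of `G`. The vertex `u` of the copy `e` is `e * n + u`, and the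
copy `e` is marked by the additional colour `c + e`. -/
def ColoredGraph.copies {c n : ℕ} (G : ColoredGraph c n) (m : ℕ) :
    ColoredGraph (c + m) (m * n) where
  graph :=
    { Adj := fun w w' => w.divNat = w'.divNat ∧ G.graph.Adj w.modNat w'.modNat
      symm := ⟨fun _ _ h => ⟨h.1.symm, h.2.symm⟩⟩
      loopless := ⟨fun _ h => G.graph.loopless.irrefl _ h.2⟩ }
  color := Fin.addCases (fun i => {w | w.modNat ∈ G.color i}) (fun e => {w | w.divNat = e})

/-- The vertex `u` of the copy `e`. -/
def inCopy {m n : ℕ} (e : Fin m) (u : Fin n) : Fin (m * n) := finProdFinEquiv (e, u)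

@[simp] theorem divNat_inCopy {m n : ℕ} (e : Fin m) (u : Fin n) : (inCopy e u).divNat = e :=
  congrArg Prod.fst (finProdFinEquiv.symm_apply_apply (e, u))

@[simp] theorem modNat_inCopy {m n : ℕ} (e : Fin m) (u : Fin n) : (inCopy e u).modNat = u :=
  congrArg Prod.snd (finProdFinEquiv.symm_apply_apply (e, u))

theorem inCopy_divNat_modNat {m n : ℕ} (w : Fin (m * n)) : inCopy w.divNat w.modNat = w :=
  finProdFinEquiv.apply_symm_apply w

theorem inCopy_val {m n : ℕ} (e : Fin m) (u : Fin n) : (inCopy e u : ℕ) = e * n + u := by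
  simp [inCopy, finProdFinEquiv, add_comm, mul_comm]

theorem inCopy_right_injective {m n : ℕ} (e : Fin m) :
    Function.Injective (inCopy e : Fin n → Fin (m * n)) := fun u v h => by
  simpa using congrArg Fin.modNat h

section copies

variable {c n m : ℕ} (G : ColoredGraph c n)

theorem copies_adj (w w' : Fin (m * n)) : (G.copies m).graph.Adj w w' ↔
    w.divNat = w'.divNat ∧ G.graph.Adj w.modNat w'.modNat := Iff.rfl

theorem mem_copies_color_castAdd (w : Fin (m * n)) (i : Fin c) :
    w ∈ (G.copies m).color (Fin.castAdd m i) ↔ w.modNat ∈ G.color i := by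
  simp [ColoredGraph.copies]

theorem mem_copies_color_natAdd (w : Fin (m * n)) (e : Fin m) :
    w ∈ (G.copies m).color (Fin.natAdd c e) ↔ w.divNat = e := by
  simp [ColoredGraph.copies]

end copies

/-! ### Relativization to a copy -/

/-- The formula saying that the variables `x` and `y` lie in the same one of `m` copies. -/
def sameCopy (c m : ℕ) {β : Type} {t : ℕ} (x y : β ⊕ Fin t) :
    (graphLang (c + m)).BoundedFormula β t :=
  (List.finRange m).foldr (fun e φ =>
    .imp (.imp (.rel (.color (Fin.natAdd c e) : GraphRel (c + m) 1) fun _ => .var x)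
      (.imp (.rel (.color (Fin.natAdd c e) : GraphRel (c + m) 1) fun _ => .var y) .falsum)) φ)
    .falsum

theorem quantRank_sameCopy (c m : ℕ) {β : Type} {t : ℕ} (x y : β ⊕ Fin t) :
    quantRank (sameCopy c m x y) = 0 := by
  unfold sameCopy
  induction List.finRange m with
  | nil => rfl
  | cons e l ih => simpa [quantRank] using ih

theorem sat_sameCopy {c n m : ℕ} (G : ColoredGraph c n) {β : Type} {t : ℕ} (x y : β ⊕ Fin t)
    (v : β → Fin (m * n)) (xs : Fin t → Fin (m * n)) :
    (G.copies m).Sat (sameCopy c m x y) v xs ↔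
      (Sum.elim v xs x).divNat = (Sum.elim v xs y).divNat := by
  have key : ∀ l : List (Fin m), (G.copies m).Sat (l.foldr (fun e φ =>
    .imp (.imp (.rel (.color (Fin.natAdd c e) : GraphRel (c + m) 1) fun _ => .var x)
      (.imp (.rel (.color (Fin.natAdd c e) : GraphRel (c + m) 1) fun _ => .var y) .falsum)) φ)
    .falsum) v xs ↔ ∃ e ∈ l, (Sum.elim v xs x).divNat = e ∧ (Sum.elim v xs y).divNat = e := by
    intro l
    induction l with
    | nil => simp [ColoredGraph.sat_falsum]
    | cons e l ih =>
      simp only [List.foldr_cons, ColoredGraph.sat_imp, ih, ColoredGraph.sat_color,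
        mem_copies_color_natAdd, termVar, List.mem_cons, exists_eq_or_imp,
        ColoredGraph.sat_falsum]
      tauto
  rw [sameCopy, key]
  constructor
  · rintro ⟨e, -, h, h'⟩; rw [h, h']
  · intro h; exact ⟨_, List.mem_finRange _, h, rfl⟩

/-- The embedding of the graph vocabulary into one with more colours. -/
def liftRel {c m : ℕ} : {l : ℕ} → GraphRel c l → GraphRel (c + m) l
  | _, .edge => .edge
  | _, .color i => .color (Fin.castAdd m i)

/-- Relativization of a formula to the copy that contains the value of `x`. The map `f` says which
variable of the new formula replaces each variable of the old one. -/
def relativize {c : ℕ} (m : ℕ) {β : Type} (x : β) :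
    {s : ℕ} → (graphLang c).BoundedFormula Empty s → {t : ℕ} → (Fin s → β ⊕ Fin t) →
      (graphLang (c + m)).BoundedFormula β t
  | _, .falsum, _, _ => .falsum
  | _, .equal t₁ t₂, _, f =>
    .equal (.var (Sum.elim Empty.elim f (termVar t₁))) (.var (Sum.elim Empty.elim f (termVar t₂)))
  | _, .rel R ts, _, f =>
    .rel (liftRel R) fun i => .var (Sum.elim Empty.elim f (termVar (ts i)))
  | _, .imp φ ψ, _, f => .imp (relativize m x φ f) (relativize m x ψ f)
  | _, .all φ, t, f =>
    .all (.imp (sameCopy c m (.inr (Fin.last t)) (.inl x))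
      (relativize m x φ (Fin.snoc (α := fun _ => β ⊕ Fin (t + 1))
        (fun i => (f i).map id Fin.castSucc) (.inr (Fin.last t)))))

theorem quantRank_relativize {c m : ℕ} {β : Type} (x : β) {s : ℕ}
    (φ : (graphLang c).BoundedFormula Empty s) {t : ℕ} (f : Fin s → β ⊕ Fin t) :
    quantRank (relativize m x φ f) = quantRank φ := by
  induction φ generalizing t with
  | falsum | equal | rel => rfl
  | imp φ ψ ih₁ ih₂ => simp [relativize, quantRank, ih₁, ih₂]
  | all φ ih => simp [relativize, quantRank, ih, quantRank_sameCopy]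

theorem sat_relativize {c n m : ℕ} (G : ColoredGraph c n) (e : Fin m) {β : Type} (x : β) {s : ℕ}
    (φ : (graphLang c).BoundedFormula Empty s) {t : ℕ} (f : Fin s → β ⊕ Fin t)
    (v : β → Fin (m * n)) (ys : Fin t → Fin (m * n)) (xs : Fin s → Fin n)
    (hx : (v x).divNat = e) (hf : ∀ i, Sum.elim v ys (f i) = inCopy e (xs i)) :
    (G.copies m).Sat (relativize m x φ f) v ys ↔ G.Sat φ Empty.elim xs := by
  induction φ generalizing t with
  | falsum => exact Iff.rfl
  | @equal s t₁ t₂ =>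
    have h : ∀ z, Sum.elim v ys (Sum.elim Empty.elim f z) = inCopy e (Sum.elim Empty.elim xs z) :=
      Sum.rec (fun a => a.elim) hf
    simp only [relativize, ColoredGraph.sat_equal, termVar, h, (inCopy_right_injective e).eq_iff]
  | @rel s l R ts =>
    have h : ∀ z, Sum.elim v ys (Sum.elim Empty.elim f z) = inCopy e (Sum.elim Empty.elim xs z) :=
      Sum.rec (fun a => a.elim) hf
    cases R with
    | edge =>
      simp only [relativize, liftRel, ColoredGraph.sat_edge, termVar, h, copies_adj,
        divNat_inCopy, modNat_inCopy, true_and]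
    | color i =>
      simp only [relativize, liftRel, ColoredGraph.sat_color, termVar, h,
        mem_copies_color_castAdd, modNat_inCopy]
  | imp φ ψ ih₁ ih₂ =>
    simp only [relativize, ColoredGraph.sat_imp, ih₁ f ys xs hf, ih₂ f ys xs hf]
  | @all s φ ih =>
    simp only [relativize, ColoredGraph.sat_all, ColoredGraph.sat_imp, sat_sameCopy]
    have step : ∀ u : Fin n, (G.copies m).Sat (relativize m x φ
        (Fin.snoc (α := fun _ => β ⊕ Fin (t + 1)) (fun i => (f i).map id Fin.castSucc)
          (.inr (Fin.last t)))) v (Fin.snoc ys (inCopy e u)) ↔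
        G.Sat φ Empty.elim (Fin.snoc xs u) := by
      intro u
      refine ih _ _ _ fun i => ?_
      refine Fin.lastCases ?_ (fun i => ?_) i
      · simp
      · rw [Fin.snoc_castSucc, Fin.snoc_castSucc, ← hf i]
        cases f i <;> simp
    constructor
    · intro h u
      exact (step u).1 (h (inCopy e u) (by simp [hx]))
    · intro h w hw
      have hw' : w.divNat = e := by simpa [hx] using hw
      have := (step w.modNat).2 (h _)
      rwa [← hw', inCopy_divNat_modNat] at this

/-! ### Back-and-forth types -/

/-- The tuples `b` and `b'` satisfy the same atomic formulas. -/
def AtomicEquiv {c n : ℕ} (G : ColoredGraph c n) {k : ℕ} (b b' : Fin k → Fin n) : Prop :=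
  (∀ i j, b i = b j ↔ b' i = b' j) ∧ (∀ i j, G.graph.Adj (b i) (b j) ↔ G.graph.Adj (b' i) (b' j)) ∧
  ∀ p i, b i ∈ G.color p ↔ b' i ∈ G.color p

/-- The `r`-round back-and-forth equivalence of tuples of vertices of `G`. -/
def BackForth {c n : ℕ} (G : ColoredGraph c n) : (r : ℕ) → {k : ℕ} → (b b' : Fin k → Fin n) → Prop
  | 0, _, b, b' => AtomicEquiv G b b'
  | r + 1, _, b, b' =>
    (∀ x, ∃ y, BackForth G r (Fin.snoc b x : Fin _ → Fin n) (Fin.snoc b' y)) ∧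
    (∀ y, ∃ x, BackForth G r (Fin.snoc b x : Fin _ → Fin n) (Fin.snoc b' y))

theorem BackForth.atomicEquiv {c n : ℕ} {G : ColoredGraph c n} {r k : ℕ} {b b' : Fin k → Fin n}
    (h : BackForth G r b b') : AtomicEquiv G b b' := by
  induction r generalizing k with
  | zero => exact h
  | succ r ih =>
    rcases isEmpty_or_nonempty (Fin k) with hk | ⟨⟨i₀⟩⟩
    · exact ⟨fun i => hk.elim i, fun i => hk.elim i, fun _ i => hk.elim i⟩
    · obtain ⟨y, hy⟩ := h.1 (b i₀)
      obtain ⟨h₁, h₂, h₃⟩ := ih hy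
      exact ⟨fun i j => by simpa using h₁ i.castSucc j.castSucc,
        fun i j => by simpa using h₂ i.castSucc j.castSucc,
        fun p i => by simpa using h₃ p i.castSucc⟩

/-- A bound on the number of `r`-round types of `k`-tuples over `c` colours. -/
def typeBound (c r k : ℕ) : ℕ :=
  (fun x => 2 ^ x)^[r + 1] ((k + r) * (k + r) + (k + r) * (k + r) + c * (k + r))

theorem exists_map_fin {A B : Type} [Fintype B] (f : A → B) {N : ℕ} (hN : Fintype.card B = N) :
    ∃ τ : A → Fin N, ∀ a a', τ a = τ a' → f a = f a' :=
  ⟨fun a => Fintype.equivFinOfCardEq hN (f a), fun _ _ h => (Equiv.injective _) h⟩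

/-- Up to back-and-forth equivalence there are at most `typeBound c r k` tuples. -/
theorem exists_types {c n : ℕ} (G : ColoredGraph c n) (r k : ℕ) :
    ∃ τ : (Fin k → Fin n) → Fin (typeBound c r k), ∀ b b', τ b = τ b' → BackForth G r b b' := by
  classical
  induction r generalizing k with
  | zero =>
    let f : (Fin k → Fin n) → Finset ((Fin k × Fin k ⊕ Fin k × Fin k) ⊕ Fin c × Fin k) := fun b =>
      Finset.univ.filter (Sum.elim (Sum.elim (fun p => b p.1 = b p.2)
        (fun p => G.graph.Adj (b p.1) (b p.2))) (fun p => b p.2 ∈ G.color p.1))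
    obtain ⟨τ, hτ⟩ := exists_map_fin f (N := typeBound c 0 k) (by simp [typeBound])
    refine ⟨τ, fun b b' h => ?_⟩
    have h := Finset.ext_iff.1 (hτ b b' h)
    exact ⟨fun i j => by simpa [f] using h (.inl (.inl (i, j))),
      fun i j => by simpa [f] using h (.inl (.inr (i, j))),
      fun p i => by simpa [f] using h (.inr (p, i))⟩
  | succ r ih =>
    obtain ⟨τ, hτ⟩ := ih (k + 1)
    let f : (Fin k → Fin n) → Finset (Fin (typeBound c r (k + 1))) := fun b =>
      Finset.univ.image fun x => τ (Fin.snoc b x)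
    obtain ⟨τ', hτ'⟩ := exists_map_fin f (N := typeBound c (r + 1) k) (by
      rw [Fintype.card_finset, Fintype.card_fin, typeBound, typeBound,
        Function.iterate_succ_apply' _ (r + 1), show k + 1 + r = k + (r + 1) by ring])
    refine ⟨τ', fun b b' h => ?_⟩
    have h := Finset.ext_iff.1 (hτ' b b' h)
    simp only [f, Finset.mem_image, Finset.mem_univ, true_and] at h
    refine ⟨fun x => ?_, fun y => ?_⟩
    · obtain ⟨y, hy⟩ := (h _).1 ⟨x, rfl⟩
      exact ⟨y, hτ _ _ hy.symm⟩
    · obtain ⟨x, hx⟩ := (h _).2 ⟨y, rfl⟩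
      exact ⟨x, hτ _ _ hx⟩

/-- Replacing a tuple inside one copy by an equivalent one is not noticed by formulas, even in the
presence of arbitrary further elements of the other copies. -/
theorem sat_copies_iff {c n m : ℕ} (G : ColoredGraph c n) (e : Fin m) {α : Type} {s : ℕ}
    (φ : (graphLang (c + m)).BoundedFormula α s) {k r : ℕ} (b b' : Fin k → Fin n)
    (hb : BackForth G r b b') (hr : quantRank φ ≤ r) (v v' : α → Fin (m * n))
    (xs xs' : Fin s → Fin (m * n))
    (hv : ∀ z, (∃ i, Sum.elim v xs z = inCopy e (b i) ∧ Sum.elim v' xs' z = inCopy e (b' i)) ∨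
      (Sum.elim v xs z = Sum.elim v' xs' z ∧ (Sum.elim v xs z).divNat ≠ e)) :
    (G.copies m).Sat φ v xs ↔ (G.copies m).Sat φ v' xs' := by
  induction φ generalizing k r with
  | falsum => exact Iff.rfl
  | equal t₁ t₂ =>
    obtain ⟨h, -, -⟩ := hb.atomicEquiv
    simp only [ColoredGraph.sat_equal]
    rcases hv (termVar t₁) with ⟨i, h₁, h₁'⟩ | ⟨h₁, h₁'⟩ <;>
      rcases hv (termVar t₂) with ⟨j, h₂, h₂'⟩ | ⟨h₂, h₂'⟩
    · rw [h₁, h₁', h₂, h₂', (inCopy_right_injective e).eq_iff,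
        (inCopy_right_injective e).eq_iff, h]
    · rw [h₁, h₁', ← h₂]
      exact iff_of_false (fun h => h₂' (by simp [← h])) (fun h => h₂' (by simp [← h]))
    · rw [h₂, h₂', ← h₁]
      exact iff_of_false (fun h => h₁' (by simp [h])) (fun h => h₁' (by simp [h]))
    · rw [h₁, h₂]
  | rel R ts =>
    obtain ⟨-, hE, hC⟩ := hb.atomicEquiv
    cases R with
    | edge =>
      simp only [ColoredGraph.sat_edge, copies_adj]
      rcases hv (termVar (ts 0)) with ⟨i, h₁, h₁'⟩ | ⟨h₁, h₁'⟩ <;>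
        rcases hv (termVar (ts 1)) with ⟨j, h₂, h₂'⟩ | ⟨h₂, h₂'⟩
      · simp [h₁, h₁', h₂, h₂', hE i j]
      · rw [h₁, h₁', ← h₂]
        simp [h₂'.symm]
      · rw [h₂, h₂', ← h₁]
        simp [h₁']
      · rw [h₁, h₂]
    | color p =>
      simp only [ColoredGraph.sat_color]
      rcases hv (termVar (ts 0)) with ⟨i, h₁, h₁'⟩ | ⟨h₁, h₁'⟩
      · rw [h₁, h₁']
        refine Fin.addCases (fun p => ?_) (fun p => ?_) p
        · simp [mem_copies_color_castAdd, hC p i]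
        · simp [mem_copies_color_natAdd]
      · rw [h₁]
  | imp φ ψ ih₁ ih₂ =>
    simp only [quantRank, max_le_iff] at hr
    exact imp_congr (ih₁ b b' hb hr.1 _ _ hv) (ih₂ b b' hb hr.2 _ _ hv)
  | @all s φ ih =>
    obtain ⟨r, rfl⟩ : ∃ r', r = r' + 1 := ⟨r - 1, by simp only [quantRank] at hr; omega⟩
    replace hr : quantRank φ ≤ r := by simpa [quantRank] using hr
    -- A move inside the copy is answered by the back-and-forth system, any other move by itself.
    have inside : ∀ x y, BackForth G r (Fin.snoc b x : Fin _ → Fin n) (Fin.snoc b' y) →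
        ((G.copies m).Sat φ v (Fin.snoc xs (inCopy e x)) ↔
          (G.copies m).Sat φ v' (Fin.snoc xs' (inCopy e y))) := by
      intro x y hxy
      refine ih _ _ hxy hr _ _ ?_
      rintro (a | i)
      · rcases hv (.inl a) with ⟨j, h, h'⟩ | h
        · exact .inl ⟨j.castSucc, by simpa using h, by simpa using h'⟩
        · exact .inr h
      · refine Fin.lastCases (.inl ⟨Fin.last _, by simp, by simp⟩) (fun i => ?_) i
        rcases hv (.inr i) with ⟨j, h, h'⟩ | h
        · exact .inl ⟨j.castSucc, by simpa using h, by simpa using h'⟩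
        · exact .inr (by simpa using h)
    have outside : ∀ w : Fin (m * n), w.divNat ≠ e → ((G.copies m).Sat φ v (Fin.snoc xs w) ↔
        (G.copies m).Sat φ v' (Fin.snoc xs' w)) := by
      intro w hw
      rcases isEmpty_or_nonempty (Fin n) with hn | ⟨⟨u⟩⟩
      · exact hn.elim w.modNat
      obtain ⟨y, hy⟩ := hb.1 u
      refine ih _ _ hy hr _ _ ?_
      rintro (a | i)
      · rcases hv (.inl a) with ⟨j, h, h'⟩ | h
        · exact .inl ⟨j.castSucc, by simpa using h, by simpa using h'⟩
        · exact .inr h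
      · refine Fin.lastCases (.inr ⟨by simp, by simpa using hw⟩) (fun i => ?_) i
        rcases hv (.inr i) with ⟨j, h, h'⟩ | h
        · exact .inl ⟨j.castSucc, by simpa using h, by simpa using h'⟩
        · exact .inr (by simpa using h)
    simp only [ColoredGraph.sat_all]
    constructor
    · intro h w
      by_cases hw : w.divNat = e
      · obtain ⟨x, hx⟩ := hb.2 w.modNat
        have := (inside _ _ hx).1 (h _)
        rwa [← hw, inCopy_divNat_modNat] at this
      · exact (outside w hw).1 (h w)
    · intro h w
      by_cases hw : w.divNat = e
      · obtain ⟨x, hx⟩ := hb.1 w.modNat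
        have := (inside _ _ hx).2 (h _)
        rwa [← hw, inCopy_divNat_modNat] at this
      · exact (outside w hw).2 (h w)

/-! ### What the answers of the learner say -/

/-- The instance whose positive examples are the `m` copies of the tuple `a`, and whose negative
examples are the `m` copies of the tuple `b`. -/
def pairInstance {c n : ℕ} (G : ColoredGraph c n) (m q : ℕ) (a b : Fin q → Fin n) : LearnInput where
  c := c + m
  n := m * n
  k := q
  ℓ := 0
  q := q
  G := G.copies m
  pos := Finset.univ.image fun e : Fin m => fun j => inCopy e (a j)
  neg := Finset.univ.image fun e : Fin m => fun j => inCopy e (b j)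

/-- The tuples `xs` and `ys` satisfy the same formulas of quantifier rank at most `q`. -/
def RankEquiv {c n : ℕ} (G : ColoredGraph c n) (q : ℕ) {s : ℕ} (xs ys : Fin s → Fin n) : Prop :=
  ∀ φ : (graphLang c).BoundedFormula Empty s, quantRank φ ≤ q →
    (G.Sat φ Empty.elim xs ↔ G.Sat φ Empty.elim ys)

theorem pairInstance_disjoint {c n : ℕ} (G : ColoredGraph c n) (m q : ℕ) {a b : Fin q → Fin n}
    (hab : a ≠ b) : Disjoint (pairInstance G m q a b).pos (pairInstance G m q a b).neg := by
  rw [Finset.disjoint_left]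
  intro x hx hx'
  obtain ⟨e, -, rfl⟩ := Finset.mem_image.1 hx
  obtain ⟨e', -, h⟩ := Finset.mem_image.1 hx'
  refine hab (funext fun j => ?_)
  simpa using congrArg Fin.modNat (congrFun h.symm j)

theorem err_eq_zero_iff {I : LearnInput} {r : ℕ} (H : Hypothesis I r) :
    H.err = 0 ↔ (∀ v ∈ I.pos, H.Accepts v) ∧ ∀ v ∈ I.neg, ¬ H.Accepts v := by
  classical
  have h : H.err = 0 ↔ (I.pos.filter (fun v => ¬ H.Accepts v) ∪
      I.neg.filter (fun v => H.Accepts v)) = ∅ := by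
    rw [Hypothesis.err, div_eq_zero_iff, Nat.cast_eq_zero, Finset.card_eq_zero]
    constructor
    · rintro (h | h)
      · simpa using h
      · have h : I.pos.card + I.neg.card = 0 := by exact_mod_cast h
        simp only [Nat.add_eq_zero_iff, Finset.card_eq_zero] at h
        simp [h.1, h.2]
    · intro h; left; simpa using h
  rw [h, Finset.union_eq_empty, Finset.filter_eq_empty_iff, Finset.filter_eq_empty_iff]
  simp

/-- A rejection shows that the two tuples cannot be distinguished by a formula in any `s` of their
entries. -/
theorem rankEquiv_of_reject {c n m q : ℕ} (G : ColoredGraph c n) (a b : Fin q → Fin n)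
    (hrej : ¬ ∃ H : Hypothesis (pairInstance G m q a b) 0, quantRank H.formula ≤ q ∧ H.err = 0)
    (hq : 0 < q) {s : ℕ} (f : Fin s → Fin q) : RankEquiv G q (a ∘ f) (b ∘ f) := by
  have key : ∀ φ : (graphLang c).BoundedFormula Empty s, quantRank φ ≤ q →
      G.Sat φ Empty.elim (a ∘ f) → G.Sat φ Empty.elim (b ∘ f) := by
    intro φ hφ h
    by_contra h'
    let H : Hypothesis (pairInstance G m q a b) 0 :=
      { formula := relativize m (.inl ⟨0, hq⟩) φ (t := 0) fun i => .inl (.inl (f i))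
        params := Fin.elim0 }
    have hH : ∀ (d : Fin q → Fin n) (e : Fin m), H.Accepts (fun j => inCopy e (d j)) ↔
        G.Sat φ Empty.elim (d ∘ f) := fun d e =>
      sat_relativize G e (β := Fin q ⊕ Fin 0) (Sum.inl ⟨0, hq⟩) φ (t := 0)
        (fun i => .inl (.inl (f i))) (Sum.elim (fun j => inCopy e (d j)) Fin.elim0) default (d ∘ f)
        (divNat_inCopy _ _) fun i => rfl
    refine hrej ⟨H, (quantRank_relativize _ φ _).trans_le hφ, (err_eq_zero_iff H).2 ⟨?_, ?_⟩⟩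
    · intro v hv
      obtain ⟨e, -, rfl⟩ := Finset.mem_image.1 hv
      exact (hH a e).2 h
    · intro v hv
      obtain ⟨e, -, rfl⟩ := Finset.mem_image.1 hv
      exact fun hacc => h' ((hH b e).1 hacc)
  intro φ hφ
  refine ⟨key φ hφ, fun h => ?_⟩
  by_contra h'
  exact key (.imp φ .falsum) (by simpa [quantRank] using hφ) (fun h'' => h' h'') h

/-- A hypothesis with fewer parameters than copies separates the two tuples by their type. -/
theorem not_backForth_of_hypothesis {c n m q r R : ℕ} (G : ColoredGraph c n) (a b : Fin q → Fin n)
    (H : Hypothesis (pairInstance G m q a b) r) (hr : r < m) (hR : quantRank H.formula ≤ R)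
    (herr : H.err = 0) : ¬ BackForth G R a b := by
  intro hab
  obtain ⟨e, he⟩ : ∃ e : Fin m, ∀ j : Fin r, Fin.divNat (m := m) (n := n) (H.params j) ≠ e := by
    by_contra! h
    have := Fintype.card_le_of_surjective
      (fun j : Fin r => Fin.divNat (m := m) (n := n) (H.params j)) h
    simp at this
    omega
  obtain ⟨hpos, hneg⟩ := (err_eq_zero_iff H).1 herr
  refine hneg (fun j => inCopy e (b j)) (Finset.mem_image.2 ⟨e, Finset.mem_univ _, rfl⟩) ?_
  refine (sat_copies_iff G e H.formula a b hab hR _ _ _ _ ?_).1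
    (hpos (fun j => inCopy e (a j)) (Finset.mem_image.2 ⟨e, Finset.mem_univ _, rfl⟩))
  rintro ((i | j) | i)
  · exact .inl ⟨i, rfl, rfl⟩
  · exact .inr ⟨rfl, he j⟩
  · exact i.elim0

/-! ### A program logic for the machine -/

@[simp] theorem State.reg_setReg (s : State) (x v y : ℕ) :
    (s.setReg x v).reg y = if y = x then v else s.reg y := Function.update_apply ..

@[simp] theorem State.arr_setReg (s : State) (x v : ℕ) : (s.setReg x v).arr = s.arr := rfl

@[simp] theorem State.reg_setCell (s : State) (a i v : ℕ) : (s.setCell a i v).reg = s.reg := rfl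

@[simp] theorem State.arr_setCell (s : State) (a i v b j : ℕ) :
    (s.setCell a i v).arr b j = if b = a ∧ j = i then v else s.arr b j := by
  unfold State.setCell
  by_cases hb : b = a
  · subst hb; simp [Function.update_apply]
  · simp [hb]

/-- `P` may write into the register `y`. -/
def Program.writesReg : Program → ℕ → Bool
  | .skip, _ | .store _ _ _, _ | .query, _ => false
  | .const x _, y | .add x _ _, y | .sub x _ _, y | .load x _ _, y => y == x
  | .seq P Q, y | .ite _ P Q, y => P.writesReg y || Q.writesReg y
  | .loop _ P, y => P.writesReg y

/-- `P` may write into the array `b`. -/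
def Program.writesArr : Program → ℕ → Bool
  | .skip, _ | .const _ _, _ | .add _ _ _, _ | .sub _ _ _, _ | .load _ _ _, _ => false
  | .store a _ _, b => b == a
  | .query, b => b == 9 || b == 10 || b == 11
  | .seq P Q, b | .ite _ P Q, b => P.writesArr b || Q.writesArr b
  | .loop _ P, b => P.writesArr b

/-- The states `s` and `s'` agree on all registers and arrays that `P` does not write into. For a
concrete program the side conditions of the fields hold by computation, so that `F.reg 8 rfl` says
that the register number `8` is unchanged. -/
structure Frame (P : Program) (s s' : State) : Prop where
  reg : ∀ y, P.writesReg y = false → s'.reg y = s.reg y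
  arr : ∀ b, P.writesArr b = false → s'.arr b = s.arr b

theorem Frame.refl (P : Program) (s : State) : Frame P s s := ⟨fun _ _ => rfl, fun _ _ => rfl⟩

theorem Frame.trans {P : Program} {s s' s'' : State} (h : Frame P s s') (h' : Frame P s' s'') :
    Frame P s s'' :=
  ⟨fun y hy => (h'.reg y hy).trans (h.reg y hy), fun b hb => (h'.arr b hb).trans (h.arr b hb)⟩

theorem Frame.of_le {P Q : Program} {s s' : State} (h : Frame P s s')
    (hr : ∀ y, Q.writesReg y = false → P.writesReg y = false)
    (ha : ∀ y, Q.writesArr y = false → P.writesArr y = false) : Frame Q s s' :=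
  ⟨fun y hy => h.reg y (hr y hy), fun b hb => h.arr b (ha b hb)⟩

theorem State.answer_arr {s : State} {I : LearnInput} {r : ℕ} (o : Option (Hypothesis I r)) {b : ℕ}
    (hb : (b == 9 || b == 10 || b == 11) = false) : (s.answer o).arr b = s.arr b := by
  simp only [Bool.or_eq_false_iff, beq_eq_false_iff_ne] at hb
  cases o <;> simp [State.answer, State.setArr, hb]

theorem State.answer_reg {s : State} {I : LearnInput} {r : ℕ} (o : Option (Hypothesis I r)) :
    (s.answer o).reg = s.reg := by
  cases o <;> rfl

section Logic

variable {L : ℕ → ℕ → ℕ → ℕ} {O : LearnOracle L} {B : LearnInput → Prop}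

theorem Exec.frame {P : Program} {s s' : State} {t : ℕ} (h : Exec O B P s t s') :
    Frame P s s' := by
  induction h with
  | skip s => exact .refl _ _
  | const | add | sub | load =>
    refine ⟨fun y hy => ?_, fun _ _ => rfl⟩
    simp only [Program.writesReg, beq_eq_false_iff_ne] at hy
    simp [hy]
  | store =>
    refine ⟨fun _ _ => rfl, fun b hb => ?_⟩
    simp only [Program.writesArr, beq_eq_false_iff_ne] at hb
    funext j
    simp [hb]
  | query => exact ⟨fun _ _ => by rw [State.answer_reg], fun b hb => State.answer_arr _ hb⟩
  | seq _ _ ih₁ ih₂ =>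
    refine (ih₁.of_le ?_ ?_).trans (ih₂.of_le ?_ ?_) <;>
      simp +contextual [Program.writesReg, Program.writesArr]
  | ite_true _ _ ih | ite_false _ _ ih =>
    refine ih.of_le ?_ ?_ <;> simp +contextual [Program.writesReg, Program.writesArr]
  | loop_done => exact .refl _ _
  | loop_step _ _ _ ih₁ ih₂ => exact Frame.trans (P := .loop _ _) ⟨ih₁.reg, ih₁.arr⟩ ih₂

variable (O B) in
/-- Total correctness with a time bound: from `s`, the program `P` halts after at most `T` steps in
a state that satisfies `Φ`. -/
def Runs (P : Program) (s : State) (T : ℕ) (Φ : State → Prop) : Prop :=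
  ∃ t s', Exec O B P s t s' ∧ t ≤ T ∧ Φ s'

theorem Runs.mono {P : Program} {s : State} {T T' : ℕ} {Φ Ψ : State → Prop}
    (h : Runs O B P s T Φ) (hT : T ≤ T') (hΦ : ∀ s', Frame P s s' → Φ s' → Ψ s') :
    Runs O B P s T' Ψ := by
  obtain ⟨t, s', he, ht, hs⟩ := h
  exact ⟨t, s', he, ht.trans hT, hΦ s' he.frame hs⟩

theorem Runs.seq {P Q : Program} {s : State} {T₁ T₂ : ℕ} {Φ Ψ : State → Prop}
    (h₁ : Runs O B P s T₁ Ψ) (h₂ : ∀ s', Frame P s s' → Ψ s' → Runs O B Q s' T₂ Φ) :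
    Runs O B (.seq P Q) s (T₁ + T₂) Φ := by
  obtain ⟨t₁, s₁, e₁, ht₁, hs₁⟩ := h₁
  obtain ⟨t₂, s₂, e₂, ht₂, hs₂⟩ := h₂ s₁ e₁.frame hs₁
  exact ⟨_, s₂, .seq e₁ e₂, by omega, hs₂⟩

theorem Runs.ite {x : ℕ} {P Q : Program} {s : State} {T : ℕ} {Φ : State → Prop}
    (h₁ : s.reg x ≠ 0 → Runs O B P s T Φ) (h₂ : s.reg x = 0 → Runs O B Q s T Φ) :
    Runs O B (.ite x P Q) s (T + 1) Φ := by
  by_cases hx : s.reg x = 0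
  · obtain ⟨t, s', e, ht, hs⟩ := h₂ hx
    exact ⟨_, s', .ite_false hx e, by omega, hs⟩
  · obtain ⟨t, s', e, ht, hs⟩ := h₁ hx
    exact ⟨_, s', .ite_true hx e, by omega, hs⟩

theorem Runs.loop_done {x : ℕ} {P : Program} {s : State} {Φ : State → Prop} (hx : s.reg x = 0)
    (h : Φ s) : Runs O B (.loop x P) s 1 Φ :=
  ⟨1, s, .loop_done hx, le_rfl, h⟩

theorem Runs.loop_step {x : ℕ} {P : Program} {s : State} {T₁ T₂ : ℕ} {Φ Ψ : State → Prop}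
    (hx : s.reg x ≠ 0) (h₁ : Runs O B P s T₁ Ψ)
    (h₂ : ∀ s', Frame P s s' → Ψ s' → Runs O B (.loop x P) s' T₂ Φ) :
    Runs O B (.loop x P) s (T₁ + T₂ + 1) Φ := by
  obtain ⟨t₁, s₁, e₁, ht₁, hs₁⟩ := h₁
  obtain ⟨t₂, s₂, e₂, ht₂, hs₂⟩ := h₂ s₁ e₁.frame hs₁
  exact ⟨_, s₂, .loop_step hx e₁ e₂, by omega, hs₂⟩

theorem Runs.query {s : State} {Φ : State → Prop} (I : LearnInput) (hI : s.StoresQuery I)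
    (hB : B I) (h : Φ (s.answer (O I))) : Runs O B .query s 1 Φ :=
  ⟨1, _, .query s I hI hB, le_rfl, h⟩

/-! ### Straight-line code -/

/-- `P` contains neither loops nor oracle calls. -/
def Program.isStraight : Program → Bool
  | .query | .loop _ _ => false
  | .seq P Q | .ite _ P Q => P.isStraight && Q.isStraight
  | _ => true

/-- The effect of a program without loops and oracle calls. -/
def Program.run : Program → State → State
  | .skip, s | .query, s | .loop _ _, s => s
  | .const x v, s => s.setReg x v
  | .add x y z, s => s.setReg x (s.reg y + s.reg z)
  | .sub x y z, s => s.setReg x (s.reg y - s.reg z)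
  | .load x a y, s => s.setReg x (s.arr a (s.reg y))
  | .store a y x, s => s.setCell a (s.reg y) (s.reg x)
  | .seq P Q, s => Q.run (P.run s)
  | .ite x P Q, s => if s.reg x ≠ 0 then P.run s else Q.run s

/-- A bound on the running time of a program without loops and oracle calls. -/
def Program.cost : Program → ℕ
  | .seq P Q => P.cost + Q.cost
  | .ite _ P Q => max P.cost Q.cost + 1
  | _ => 1

theorem Runs.straight {P : Program} {s : State} {T : ℕ} {Φ : State → Prop}
    (hP : P.isStraight = true) (hT : P.cost ≤ T) (h : Φ (P.run s)) : Runs O B P s T Φ := by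
  suffices h' : ∀ s, Runs O B P s P.cost (fun s' => s' = P.run s) from
    (h' s).mono hT fun s' _ e => e ▸ h
  clear h hT
  induction P with
  | skip => exact fun s => ⟨1, _, .skip s, le_rfl, rfl⟩
  | const x v => exact fun s => ⟨1, _, .const s x v, le_rfl, rfl⟩
  | add x y z => exact fun s => ⟨1, _, .add s x y z, le_rfl, rfl⟩
  | sub x y z => exact fun s => ⟨1, _, .sub s x y z, le_rfl, rfl⟩
  | load x a y => exact fun s => ⟨1, _, .load s x a y, le_rfl, rfl⟩
  | store a y x => exact fun s => ⟨1, _, .store s a y x, le_rfl, rfl⟩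
  | query => simp [Program.isStraight] at hP
  | loop x P => simp [Program.isStraight] at hP
  | seq P Q ih₁ ih₂ =>
    simp only [Program.isStraight, Bool.and_eq_true] at hP
    intro s
    refine Runs.seq (ih₁ hP.1 s) fun s' _ h => ?_
    subst h
    exact ih₂ hP.2 _
  | ite x P Q ih₁ ih₂ =>
    simp only [Program.isStraight, Bool.and_eq_true] at hP
    intro s
    refine Runs.ite (fun hx => (ih₁ hP.1 s).mono (le_max_left _ _) ?_)
      (fun hx => (ih₂ hP.2 s).mono (le_max_right _ _) ?_)
    · intro s' _ h; simp [Program.run, hx, h]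
    · intro s' _ h; simp [Program.run, hx, h]

/-- Straight-line code in front of a program. -/
theorem Runs.straight_seq {P Q : Program} {s : State} {T T' : ℕ} {Φ : State → Prop}
    (hP : P.isStraight = true) (h : Frame P s (P.run s) → Runs O B Q (P.run s) T Φ)
    (hT : P.cost + T ≤ T') :
    Runs O B (.seq P Q) s T' Φ := by
  refine (Runs.seq (Ψ := fun s' => s' = P.run s) (.straight hP le_rfl rfl) ?_).mono hT
    fun _ _ h => h
  rintro s' hf rfl
  exact h hf

/-! ### Counting loops -/

-- Register `1` holds the constant one, register `2` is the loop guard, and array fillers keep the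
-- address in register `10` and the value in register `11`.

/-- `for i < b do body`. -/
def forLoop (i b : ℕ) (body : Program) : Program :=
  .seq (.const i 0) (.seq (.sub 2 b i) (.loop 2 (.seq body (.seq (.add i i 1) (.sub 2 b i)))))

/-- The registers of the loop `for i < b do body` do not interfere. -/
def loopSafe (i b : ℕ) (body : Program) : Bool :=
  i != b && i != 1 && i != 2 && b != 2 && !body.writesReg i && !body.writesReg b &&
    !body.writesReg 1

/-- The rule for counting loops with invariant `Inv`, which must not depend on the loop counter and
the guard. Each round may rely on the frame of the whole loop. -/
theorem runs_forLoop {i b : ℕ} {body : Program} {s : State} {N T : ℕ} {Φ : State → Prop}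
    (Inv : ℕ → State → Prop) (hsafe : loopSafe i b body = true) (h1 : s.reg 1 = 1)
    (hN : s.reg b = N) (hstable : ∀ j s' v w, Inv j s' → Inv j ((s'.setReg i v).setReg 2 w))
    (h0 : Inv 0 s)
    (hstep : ∀ j s', j < N → Frame (forLoop i b body) s s' → s'.reg i = j → Inv j s' →
      Runs O B body s' T (Inv (j + 1)))
    (hΦ : ∀ s', Frame (forLoop i b body) s s' → Inv N s' → Φ s') :
    Runs O B (forLoop i b body) s (3 + N * (T + 3)) Φ := by
  simp only [loopSafe, Bool.and_eq_true, bne_iff_ne, ne_eq, Bool.not_eq_true'] at hsafe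
  obtain ⟨⟨⟨⟨⟨⟨hib, hi1⟩, hi2⟩, hb2⟩, hwi⟩, hwb⟩, hw1⟩ := hsafe
  have hFb : ∀ {s' s''}, Frame (.seq body (.seq (.add i i 1) (.sub 2 b i))) s' s'' →
      Frame (forLoop i b body) s' s'' := fun h => h.of_le
    (by simp +contextual [forLoop, Program.writesReg])
    (by simp +contextual [forLoop, Program.writesArr])
  have key : ∀ d j s', j + d = N → Frame (forLoop i b body) s s' → s'.reg i = j →
      s'.reg 2 = d → Inv j s' →
      Runs O B (.loop 2 (.seq body (.seq (.add i i 1) (.sub 2 b i)))) s' (1 + d * (T + 3))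
        (fun s'' => Inv N s'') := by
    intro d
    induction d with
    | zero =>
      intro j s' hj _ _ h2 hI
      obtain rfl : j = N := by omega
      exact (Runs.loop_done h2 hI).mono (by omega) fun _ _ h => h
    | succ d ih =>
      intro j s' hj hF hi h2 hI
      refine (Runs.loop_step (T₁ := T + 2) (T₂ := 1 + d * (T + 3)) (by omega)
        (Runs.seq (T₂ := 2) (hstep j s' (by omega) hF hi hI) fun s₁ hF₁ hI₁ =>
          Runs.straight (Φ := fun s₂ => Inv (j + 1) s₂ ∧ s₂.reg i = j + 1 ∧ s₂.reg 2 = d)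
            rfl le_rfl ?_) fun s₂ hF₂ hs₂ => ?_).mono (by ring_nf; omega) fun _ _ h => h
      · have e1 : s₁.reg i = j := (hF₁.reg i hwi).trans hi
        have e2 : s₁.reg b = N := by
          rw [hF₁.reg b hwb, hF.reg b (by simp [forLoop, Program.writesReg, hwb, hb2,
            Ne.symm hib]), hN]
        have e3 : s₁.reg 1 = 1 := by
          rw [hF₁.reg 1 hw1, hF.reg 1 (by simp [forLoop, Program.writesReg, hw1,
            Ne.symm hi1]), h1]
        simp only [Program.run, State.reg_setReg, e1, e2, e3, if_neg (Ne.symm hib), if_true,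
          if_neg hi2]
        exact ⟨hstable _ _ _ _ hI₁, trivial, by omega⟩
      · exact ih (j + 1) s₂ (by omega) (hF.trans (hFb hF₂)) hs₂.2.1 hs₂.2.2 hs₂.1
  refine (Runs.straight_seq (P := .const i 0) (T := 2 + N * (T + 3)) rfl (fun _ =>
    Runs.straight_seq (P := .sub 2 b i) (T := 1 + N * (T + 3)) rfl (fun _ =>
      key N 0 _ (by omega) ?_ ?_ ?_ ?_) ?_) ?_).mono le_rfl fun s' hF h => hΦ s' hF h
  · refine ⟨fun y hy => ?_, fun _ _ => rfl⟩
    simp only [forLoop, Program.writesReg, Bool.or_eq_false_iff,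
      beq_eq_false_iff_ne] at hy
    simp [Program.run, hy]
  · simp [Program.run, hi2]
  · simp [Program.run, Ne.symm hib, hN]
  · exact hstable 0 s 0 _ h0
  · simp only [Program.cost]; omega
  · simp only [Program.cost]; omega

/-- `for i < b do dst[p + i] := value of body`, where `p` is the content of register `10`. -/
def fill (i b dst : ℕ) (body : Program) : Program :=
  forLoop i b (.seq body (.seq (.store dst 10 11) (.add 10 10 1)))

/-- The registers of a filler do not interfere, and its body is straight-line code without
effect on the array that is filled. -/
def fillSafe (i b dst : ℕ) (body : Program) : Bool :=
  loopSafe i b body && i != 10 && b != 10 && !body.writesReg 10 && !body.writesArr dst &&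
    body.isStraight

theorem runs_fill {i b dst : ℕ} {body : Program} {s : State} {N p C : ℕ} {Φ : State → Prop}
    (f : ℕ → ℕ) (hsafe : fillSafe i b dst body = true) (hC : body.cost ≤ C) (h1 : s.reg 1 = 1)
    (hN : s.reg b = N) (hp : s.reg 10 = p)
    (hbody : ∀ j s', j < N → Frame (fill i b dst body) s s' → s'.reg i = j → s'.reg 10 = p + j →
      (∀ r < j, s'.arr dst (p + r) = f r) →
      (∀ r, r < p ∨ p + j ≤ r → s'.arr dst r = s.arr dst r) → (body.run s').reg 11 = f j)
    (hΦ : ∀ s', Frame (fill i b dst body) s s' → s'.reg 10 = p + N →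
      (∀ r < N, s'.arr dst (p + r) = f r) →
      (∀ r, r < p ∨ p + N ≤ r → s'.arr dst r = s.arr dst r) → Φ s') :
    Runs O B (fill i b dst body) s (3 + N * (C + 5)) Φ := by
  simp only [fillSafe, loopSafe, Bool.and_eq_true, bne_iff_ne, ne_eq, Bool.not_eq_true'] at hsafe
  obtain ⟨⟨⟨⟨⟨⟨⟨⟨⟨⟨⟨hib, hi1⟩, hi2⟩, hb2⟩, hwi⟩, hwb⟩, hw1⟩, hi10⟩, hb10⟩, hw10⟩, hwa⟩, hstr⟩ :=
    hsafe
  refine (runs_forLoop (T := C + 2) (fun j s' => s'.reg 10 = p + j ∧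
    (∀ r < j, s'.arr dst (p + r) = f r) ∧
    (∀ r, r < p ∨ p + j ≤ r → s'.arr dst r = s.arr dst r)) ?_ h1 hN ?_ ?_ ?_
    (fun s' hF h => hΦ s' hF h.1 h.2.1 h.2.2))
  · simp [loopSafe, Program.writesReg, *]
  · intro j s' v w h
    simpa [Ne.symm hi10] using h
  · exact ⟨by simpa using hp, by simp, fun _ _ => rfl⟩
  · rintro j s' hj hF hi ⟨h10, hlow, hout⟩
    have hval := hbody j s' hj hF hi h10 hlow hout
    refine Runs.seq (T₂ := 2) (Ψ := fun s₁ => s₁.reg 11 = f j) (.straight hstr hC hval)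
      fun s₁ hF₁ hs₁ => Runs.straight rfl le_rfl ?_
    have e10 : s₁.reg 10 = p + j := (hF₁.reg 10 hw10).trans h10
    have e1 : s₁.reg 1 = 1 := by
      rw [hF₁.reg 1 hw1, hF.reg 1 (by simp [forLoop,
        Program.writesReg, hw1, Ne.symm hi1]), h1]
    have ed : s₁.arr dst = s'.arr dst := hF₁.arr dst hwa
    simp only [Program.run, State.reg_setCell, State.reg_setReg, State.arr_setReg,
      State.arr_setCell, e10, e1, hs₁, ed, if_true, true_and]
    refine ⟨by omega, fun r hr => ?_, fun r hr => ?_⟩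
    · rcases Nat.lt_succ_iff_lt_or_eq.1 hr with hr | rfl
      · rw [if_neg (by omega), hlow r hr]
      · rw [if_pos rfl]
    · rw [if_neg (by omega), hout r (by omega)]

/-- `for i < a, for j < b do dst[p + i * b + j] := value of body`. -/
def fill₂ (i a j b dst : ℕ) (body : Program) : Program :=
  forLoop i a (fill j b dst body)

theorem runs_fill₂ {i a j b dst : ℕ} {body : Program} {s : State} {M N p C : ℕ}
    {Φ : State → Prop} (f : ℕ → ℕ → ℕ) (hsafe : fillSafe j b dst body = true)
    (hsafe' : (loopSafe i a (fill j b dst body) && i != 10 && !body.writesReg b && i != b) = true)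
    (hC : body.cost ≤ C) (h1 : s.reg 1 = 1) (hM : s.reg a = M) (hN : s.reg b = N)
    (hp : s.reg 10 = p)
    (hbody : ∀ x y s', x < M → y < N → Frame (fill₂ i a j b dst body) s s' → s'.reg i = x →
      s'.reg j = y → (body.run s').reg 11 = f x y)
    (hΦ : ∀ s', Frame (fill₂ i a j b dst body) s s' → s'.reg 10 = p + M * N →
      (∀ x < M, ∀ y < N, s'.arr dst (p + (x * N + y)) = f x y) →
      (∀ r, r < p ∨ p + M * N ≤ r → s'.arr dst r = s.arr dst r) → Φ s') :
    Runs O B (fill₂ i a j b dst body) s (3 + M * (N * (C + 5) + 6)) Φ := by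
  have hs := hsafe
  simp only [fillSafe, loopSafe, Bool.and_eq_true, bne_iff_ne, ne_eq, Bool.not_eq_true']
    at hs hsafe'
  obtain ⟨⟨⟨hs', hi10⟩, hwb⟩, hib⟩ := hsafe'
  obtain ⟨⟨⟨⟨⟨⟨⟨⟨⟨⟨⟨hjb, hj1⟩, hj2⟩, hb2⟩, hwj⟩, hwb'⟩, hw1⟩, hj10⟩, hb10⟩, hw10⟩, hwa⟩, hstr⟩ := hs
  refine (runs_forLoop (T := 3 + N * (C + 5)) (fun x s' => s'.reg 10 = p + x * N ∧
    (∀ x' < x, ∀ y < N, s'.arr dst (p + (x' * N + y)) = f x' y) ∧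
    (∀ r, r < p ∨ p + x * N ≤ r → s'.arr dst r = s.arr dst r)) ?_ h1 hM ?_ ?_ ?_
    (fun s' hF h => hΦ s' hF h.1 h.2.1 h.2.2)).mono (by ring_nf; omega) fun _ _ h => h
  · simpa [loopSafe] using hs'
  · intro x s' v w h
    simpa [Ne.symm hi10] using h
  · exact ⟨by simpa using hp, by simp, fun _ _ => rfl⟩
  · rintro x s' hx hF hi ⟨h10, hlow, hout⟩
    have hsub : ∀ {s₁ s₂}, Frame (fill j b dst body) s₁ s₂ →
        Frame (fill₂ i a j b dst body) s₁ s₂ := fun h => h.of_le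
      (by simp +contextual [fill₂, forLoop, Program.writesReg])
      (by simp +contextual [fill₂, forLoop, Program.writesArr])
    have eN : s'.reg b = N := by
      rw [hF.reg b (by simp [fill, forLoop,
        Program.writesReg, hwb, hb2, hb10, Ne.symm hjb, Ne.symm hib]), hN]
    have e1 : s'.reg 1 = 1 := by
      rw [hF.reg 1 (by simp [fill, forLoop,
        Program.writesReg, hw1, Ne.symm hj1, Ne.symm hs'.1.1.1.1.1.2]), h1]
    refine runs_fill (f x) hsafe hC e1 eN h10 ?_ ?_
    · intro y s₁ hy hF₁ hj _ _ _
      refine hbody x y s₁ hx hy (hF.trans (hsub hF₁)) ?_ hj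
      rw [hF₁.reg i hs'.1.1.2, hi]
    · intro s₁ hF₁ h10' hlow' hout'
      have hxN : (x + 1) * N = x * N + N := by ring
      refine ⟨by omega, fun x' hx' y hy => ?_, fun r hr => ?_⟩
      · rcases Nat.lt_succ_iff_lt_or_eq.1 hx' with hx' | rfl
        · have : x' * N + N ≤ x * N := by nlinarith
          rw [hout' _ (by omega), hlow x' hx' y hy]
        · rw [← hlow' y hy, add_assoc]
      · rw [hout' r (by omega), hout r (by omega)]

end Logic

/-! ### Names of registers and arrays -/

/-- Sequential composition of programs. -/
infixr:60 ";;" => Program.seq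

-- Registers. The result and the constant one; the numbers of vertices and colours of the input graph
-- and the quantifier rank of the sentence; the number of copies and the number of vertices of their
-- union; the number of the next node of the tree and the next free address for tuples.
notation "rRes" => 0
notation "rOne" => 1
notation "rVert" => 3
notation "rCol" => 4
notation "rRank" => 5
notation "rCopies" => 6
notation "rSize" => 7
notation "rNodes" => 8
notation "rTop" => 9
-- Address and value of the array fillers, and scratch registers.
notation "rPtr" => 10
notation "rOut" => 11
notation "rA" => 12
notation "rB" => 13
notation "rC" => 14
-- The parser: height of its stack, position in the sentence, number of symbols, number of
-- enclosing quantifiers, and the symbol that has been read (in the evaluation, too).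
notation "rStack" => 15
notation "rPos" => 16
notation "rTok" => 17
notation "rLev" => 18
notation "rOp" => 19
-- Loop counters.
notation "rI" => 20
notation "rJ" => 21
notation "rCnt" => 26
-- The construction of the tree: first node of the current level and end of the level, its depth,
-- number of the node in the level, the node and the address of its tuple, and its first child.
notation "rLo" => 22
notation "rHi" => 23
notation "rDepth" => 24
notation "rXi" => 25
notation "rX" => 27
notation "rXPtr" => 28
notation "rFirst" => 29
-- The candidate: the vertex that is appended, and whether the extension is represented already;
-- the number of children so far, the number of the one that is compared, its node and its tuple.
notation "rV" => 30
notation "rCov" => 31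
notation "rKids" => 32
notation "rYi" => 33
notation "rY" => 34
notation "rYPtr" => 35
-- The evaluation: height of the stack of vectors, and the arguments of an atomic formula.
notation "rBase" => 36
notation "rArg" => 37
notation "rSnd" => 38

-- Arrays of the input and of the oracle calls, as fixed by the machine model.
notation "aInput" => 0
notation "aAdj" => 1
notation "aCol" => 2
notation "aCode" => 3
notation "aHead" => 4
notation "aQAdj" => 5
notation "aQCol" => 6
notation "aPos" => 7
notation "aNeg" => 8
notation "aAns" => 9
-- The entries of the tuples; the parent of each node and the address of its tuple; the multiples of
-- `n`; the stack of truth vectors and the vector under construction; the positions of the symbols of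
-- the sentence and the stack of the parser; the copy and the original of each vertex of the union;
-- the depth of each node.
notation "aTup" => 12
notation "aPar" => 13
notation "aPtr" => 17
notation "aMul" => 14
notation "aVec" => 15
notation "aTmp" => 16
notation "aStart" => 18
notation "aLev" => 19
notation "aBlk" => 20
notation "aOff" => 21
notation "aDep" => 22

/-! ### Words in memory -/

/-- The word `l` is stored in the array `a` from address `p` on. -/
def Stored (a : ℕ → ℕ) (p : ℕ) (l : List ℕ) : Prop :=
  ∀ i (h : i < l.length), a (p + i) = l[i]

theorem stored_nil (a : ℕ → ℕ) (p : ℕ) : Stored a p [] := fun i h => by simp at h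

theorem stored_cons {a : ℕ → ℕ} {p x : ℕ} {l : List ℕ} :
    Stored a p (x :: l) ↔ a p = x ∧ Stored a (p + 1) l := by
  constructor
  · intro h
    refine ⟨h 0 (by simp), fun i hi => ?_⟩
    have := h (i + 1) (by simpa using hi)
    rw [add_assoc, add_comm 1 i]
    simpa using this
  · rintro ⟨h₀, h⟩ i hi
    cases i with
    | zero => simpa using h₀
    | succ i =>
      have := h i (by simpa using hi)
      rw [add_assoc, add_comm 1 i] at this
      simpa using this

theorem stored_append {a : ℕ → ℕ} {p : ℕ} {l l' : List ℕ} :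
    Stored a p (l ++ l') ↔ Stored a p l ∧ Stored a (p + l.length) l' := by
  induction l generalizing p with
  | nil => simp [stored_nil]
  | cons x l ih =>
    rw [List.cons_append, stored_cons, stored_cons, ih, List.length_cons, add_right_comm,
      add_assoc p, and_assoc]

theorem Stored.congr {a a' : ℕ → ℕ} {p : ℕ} {l : List ℕ} (h : Stored a p l)
    (ha : ∀ i < l.length, a' (p + i) = a (p + i)) : Stored a' p l :=
  fun i hi => (ha i hi).trans (h i hi)

/-- The word of a subformula of a sentence. -/
abbrev wordOf {c s : ℕ} (φ : (graphLang c).BoundedFormula Empty s) : List ℕ :=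
  formulaCode Empty.elim 0 φ

/-- The positions at which the symbols of `φ` other than variables and colour numbers stand, if the
word of `φ` begins at position `p`. -/
def tokens {c : ℕ} : {s : ℕ} → (graphLang c).BoundedFormula Empty s → ℕ → List ℕ
  | _, .falsum, p | _, .equal _ _, p | _, .rel _ _, p => [p]
  | _, .imp φ ψ, p => p :: (tokens φ (p + 1) ++ tokens ψ (p + 1 + (wordOf φ).length))
  | _, .all φ, p => p :: tokens φ (p + 1)

theorem length_tokens_le {c s : ℕ} (φ : (graphLang c).BoundedFormula Empty s) (p : ℕ) :
    (tokens φ p).length ≤ (wordOf φ).length := by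
  induction φ generalizing p with
  | falsum => simp [tokens, formulaCode]
  | equal => simp [tokens, formulaCode]
  | rel R ts => cases R <;> simp [tokens, formulaCode, relCode]
  | imp φ ψ ih₁ ih₂ =>
    have := ih₁ (p + 1)
    have := ih₂ (p + 1 + (wordOf φ).length)
    simp only [tokens, wordOf, formulaCode, List.length_cons, List.length_append] at *
    omega
  | all φ ih =>
    have := ih (p + 1)
    simp only [tokens, wordOf, formulaCode, List.length_cons] at *
    omega

/-! ### Parsing: positions of the symbols, and the quantifier rank -/

/-- One step of the parser. Array `aLev` is a stack that holds, for each subformula that is still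
to be read, the number of quantifiers above it. -/
def parseStep : Program :=
  .sub rStack rStack rOne ;; .load rLev aLev rStack ;; .store aStart rTok rPos ;;
  .add rTok rTok rOne ;; .load rOp aCode rPos ;; .add rPos rPos rOne ;;
  .const rB 3 ;; .sub rC rOp rB ;;
  .ite rC
    (.sub rC rC rOne ;; .ite rC
      (.add rLev rLev rOne ;; .store aLev rStack rLev ;; .add rStack rStack rOne ;;
        .sub rC rLev rRank ;; .add rRank rRank rC)
      (.store aLev rStack rLev ;; .add rStack rStack rOne ;;
        .store aLev rStack rLev ;; .add rStack rStack rOne))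
    (.ite rOp (.add rPos rPos rOne ;; .add rPos rPos rOne) .skip)

/-- The parser reads symbols until its stack is empty. -/
def parseLoop : Program := .loop rStack parseStep

/-- The state `s'` arises from `s` when a subformula `φ` in the scope of `k` quantifiers, whose word
begins at position `p`, is read. -/
structure Parsed {c k : ℕ} (φ : (graphLang c).BoundedFormula Empty k) (p : ℕ) (s s' : State) :
    Prop where
  frame : Frame parseLoop s s'
  pos : s'.reg rPos = p + (wordOf φ).length
  stack : s'.reg rStack + 1 = s.reg rStack
  lev : ∀ r < s'.reg rStack, s'.arr aLev r = s.arr aLev r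
  tok : s'.reg rTok = s.reg rTok + (tokens φ p).length
  start : Stored (s'.arr aStart) (s.reg rTok) (tokens φ p)
  old : ∀ r < s.reg rTok, s'.arr aStart r = s.arr aStart r
  rank : s'.reg rRank = max (s.reg rRank) (k + quantRank φ)

section

variable {L : ℕ → ℕ → ℕ → ℕ} {O : LearnOracle L} {B : LearnInput → Prop}

/-- The parser, in continuation-passing style: to run on a stack whose top asks for `φ`, it suffices
to run on from any state in which `φ` has been read. -/
theorem runs_parseLoop {c k : ℕ} (φ : (graphLang c).BoundedFormula Empty k) (s : State)
    {p T : ℕ} {Φ : State → Prop} (h1 : s.reg rOne = 1) (hpos : s.reg rPos = p)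
    (hw : Stored (s.arr aCode) p (wordOf φ)) (hsp : s.reg rStack ≠ 0)
    (hlev : s.arr aLev (s.reg rStack - 1) = k) (hk : k ≤ s.reg rRank)
    (hrest : ∀ s', Parsed φ p s s' → Runs O B parseLoop s' T Φ) :
    Runs O B parseLoop s (T + 25 * (tokens φ p).length) Φ := by
  have step : ∀ (s : State) {T' : ℕ}, s.reg rStack ≠ 0 → (Frame parseLoop s (parseStep.run s) →
      Runs O B parseLoop (parseStep.run s) T' Φ) →
      Runs O B parseLoop s (T' + 25) Φ := fun s T' hs h =>
    (Runs.loop_step (T₁ := 24) hs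
      (.straight (Φ := fun s' => s' = parseStep.run s) rfl (by decide) rfl)
      fun s' hF e => by subst e; exact h ⟨hF.reg, hF.arr⟩).mono (by omega) fun _ _ h => h
  obtain ⟨S, hS⟩ := Nat.exists_eq_succ_of_ne_zero hsp
  have hS' : s.reg rStack = S + 1 := hS
  rw [hS', Nat.add_sub_cancel] at hlev
  induction φ generalizing s p T S with
  | falsum =>
    simp only [wordOf, formulaCode, stored_cons] at hw
    refine (step s hsp fun hF => hrest _ ⟨hF, ?_, ?_, ?_, ?_, ?_, ?_, ?_⟩).mono
      (by simp [tokens]) fun _ _ h => h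
    all_goals simp [parseStep, Program.run, hS', h1, hpos, hw, tokens, formulaCode, quantRank,
      Stored, hk]
    intro r hr h
    omega
  | equal t₁ t₂ =>
    simp only [wordOf, formulaCode, stored_cons] at hw
    refine (step s hsp fun hF => hrest _ ⟨hF, ?_, ?_, ?_, ?_, ?_, ?_, ?_⟩).mono
      (by simp [tokens]) fun _ _ h => h
    all_goals simp [parseStep, Program.run, hS', h1, hpos, hw, tokens, formulaCode, quantRank,
      Stored, hk]
    intro r hr h
    omega
  | rel R ts =>
    cases R with
    | edge =>
      simp only [wordOf, formulaCode, relCode, stored_cons] at hw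
      refine (step s hsp fun hF => hrest _ ⟨hF, ?_, ?_, ?_, ?_, ?_, ?_, ?_⟩).mono
        (by simp [tokens]) fun _ _ h => h
      all_goals simp [parseStep, Program.run, hS', h1, hpos, hw, tokens, formulaCode, relCode,
        quantRank, Stored, hk]
      intro r hr h
      omega
    | color i =>
      simp only [wordOf, formulaCode, relCode, stored_cons] at hw
      refine (step s hsp fun hF => hrest _ ⟨hF, ?_, ?_, ?_, ?_, ?_, ?_, ?_⟩).mono
        (by simp [tokens]) fun _ _ h => h
      all_goals simp [parseStep, Program.run, hS', h1, hpos, hw, tokens, formulaCode, relCode,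
        quantRank, Stored, hk]
      intro r hr h
      omega
  | @imp k φ ψ ih₁ ih₂ =>
    simp only [wordOf, formulaCode, stored_cons, stored_append] at hw
    obtain ⟨hop, hwφ, hwψ⟩ := hw
    refine (step s hsp (T' := T + 25 * (tokens ψ (p + 1 + (wordOf φ).length)).length +
      25 * (tokens φ (p + 1)).length) fun hF => ?_).mono (by simp [tokens]; ring_nf; omega)
        fun _ _ h => h
    have e1 : (parseStep.run s).reg rOne = 1 := by simp [parseStep, Program.run, h1, hS', hpos, hop]
    have e2 : (parseStep.run s).reg rPos = p + 1 := by
      simp [parseStep, Program.run, h1, hS', hpos, hop]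
    have e3 : (parseStep.run s).reg rStack = S + 1 + 1 := by
      simp [parseStep, Program.run, h1, hS', hpos, hop]
    have e4 : (parseStep.run s).arr aLev (S + 1) = k := by
      simp [parseStep, Program.run, h1, hS', hpos, hop, hlev]
    have e5 : (parseStep.run s).arr aLev S = k := by
      simp [parseStep, Program.run, h1, hS', hpos, hop, hlev]
    have e6 : (parseStep.run s).reg rTok = s.reg rTok + 1 := by
      simp [parseStep, Program.run, h1, hS', hpos, hop]
    have e7 : (parseStep.run s).reg rRank = s.reg rRank := by
      simp [parseStep, Program.run, h1, hS', hpos, hop]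
    have e8 : ∀ r, (parseStep.run s).arr aStart r =
        if r = s.reg rTok then p else s.arr aStart r := by
      simp [parseStep, Program.run, h1, hS', hpos, hop]
    have e9 : ∀ r < S, (parseStep.run s).arr aLev r = s.arr aLev r := by
      intro r hr
      have : r ≠ S + 1 := by omega
      simp [parseStep, Program.run, h1, hS', hpos, hop, this, hr.ne]
    refine ih₁ (parseStep.run s) e1 e2 (by rwa [hF.arr 3 rfl]) (by omega)
      (by rwa [e7]) (fun s₁ P₁ => ?_) (S + 1) e4 e3 e3
    have g3 : s₁.reg rStack = S + 1 := by have := P₁.stack; omega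
    refine ih₂ s₁ ((P₁.frame.reg 1 rfl).trans e1) P₁.pos
      (by rw [P₁.frame.arr 3 rfl, hF.arr 3 rfl]; exact hwψ) (by omega)
      (by rw [P₁.rank]; omega) (fun s₂ P₂ => ?_) S
      (by rw [P₁.lev S (by omega), e5]) g3 g3
    have g2 : s₂.reg rStack = S := by have := P₂.stack; omega
    have hlen : (wordOf (φ.imp ψ)).length = 1 + (wordOf φ).length + (wordOf ψ).length := by
      simp [formulaCode]; ring
    refine hrest s₂ ⟨hF.trans (P₁.frame.trans P₂.frame), ?_, by omega, ?_, ?_, ?_, ?_, ?_⟩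
    · rw [P₂.pos, hlen]; ring
    · intro r hr
      rw [P₂.lev r hr, P₁.lev r (by omega), e9 r (by omega)]
    · rw [P₂.tok, P₁.tok, e6]; simp [tokens]; ring
    · simp only [tokens]
      rw [stored_cons, stored_append]
      refine ⟨?_, ?_, ?_⟩
      · rw [P₂.old _ (by rw [P₁.tok]; omega), P₁.old _ (by omega), e8, if_pos rfl]
      · rw [← e6]
        refine P₁.start.congr fun i hi => P₂.old _ (by rw [P₁.tok]; omega)
      · rw [← e6, ← P₁.tok]
        exact P₂.start
    · intro r hr
      rw [P₂.old _ (by rw [P₁.tok]; omega), P₁.old _ (by omega), e8, if_neg (by omega)]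
    · rw [P₂.rank, P₁.rank, e7]; simp only [quantRank]; omega
  | @all k φ ih =>
    simp only [wordOf, formulaCode, stored_cons] at hw
    obtain ⟨hop, hwφ⟩ := hw
    refine (step s hsp (T' := T + 25 * (tokens φ (p + 1)).length) fun hF => ?_).mono
      (by simp [tokens]; ring_nf; omega) fun _ _ h => h
    have e1 : (parseStep.run s).reg rOne = 1 := by simp [parseStep, Program.run, h1, hS', hpos, hop]
    have e2 : (parseStep.run s).reg rPos = p + 1 := by
      simp [parseStep, Program.run, h1, hS', hpos, hop]
    have e3 : (parseStep.run s).reg rStack = S + 1 := by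
      simp [parseStep, Program.run, h1, hS', hpos, hop]
    have e4 : (parseStep.run s).arr aLev S = k + 1 := by
      simp [parseStep, Program.run, h1, hS', hpos, hop, hlev]
    have e6 : (parseStep.run s).reg rTok = s.reg rTok + 1 := by
      simp [parseStep, Program.run, h1, hS', hpos, hop]
    have e7 : (parseStep.run s).reg rRank = max (s.reg rRank) (k + 1) := by
      simp [parseStep, Program.run, h1, hS', hpos, hop, hlev]
      omega
    have e8 : ∀ r, (parseStep.run s).arr aStart r =
        if r = s.reg rTok then p else s.arr aStart r := by
      simp [parseStep, Program.run, h1, hS', hpos, hop]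
    have e9 : ∀ r < S, (parseStep.run s).arr aLev r = s.arr aLev r := by
      intro r hr
      simp [parseStep, Program.run, h1, hS', hpos, hop]
      intro; omega
    refine ih (parseStep.run s) e1 e2 (by rwa [hF.arr 3 rfl]) (by omega)
      (by rw [e7]; omega) (fun s₁ P₁ => ?_) S e4 e3 e3
    have hlen : (wordOf φ.all).length = 1 + (wordOf φ).length := by
      simp [formulaCode]; ring
    have g3 : s₁.reg rStack = S := by have := P₁.stack; omega
    refine hrest s₁ ⟨hF.trans P₁.frame, ?_, by omega, ?_, ?_, ?_, ?_, ?_⟩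
    · rw [P₁.pos, hlen]; ring
    · intro r hr
      rw [P₁.lev r (by omega), e9 r (by omega)]
    · rw [P₁.tok, e6]; simp [tokens]; ring
    · simp only [tokens]
      rw [stored_cons]
      refine ⟨?_, ?_⟩
      · rw [P₁.old _ (by omega), e8, if_pos rfl]
      · rw [← e6]
        exact P₁.start
    · intro r hr
      rw [P₁.old _ (by omega), e8, if_neg (by omega)]
    · rw [P₁.rank, e7]; simp only [quantRank]; omega

end

/-! ### Trees of representative tuples -/

/-- A tree of tuples of vertices with nodes `1, …, N - 1` and root `1`. The node `x` of depth `k`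
stands for the `k`-tuple `tup (ptr x), …, tup (ptr x + k - 1)`, and each child extends the tuple of
its parent by one vertex. Up to formulas of quantifier rank `q`, every extension of the tuple of a
node of depth less than `q` is represented by a child. -/
structure IsTree {c n : ℕ} (G : ColoredGraph c n) (q N : ℕ) (tup par ptr dep : ℕ → ℕ) : Prop where
  root : 1 < N
  dep_root : dep 1 = 0
  par_zero : par 0 = 0
  par_root : par 1 = 0
  par_pos : ∀ y, 2 ≤ y → y < N → 1 ≤ par y
  dep_child : ∀ y, 2 ≤ y → y < N → dep y = dep (par y) + 1
  tup_child : ∀ y, 2 ≤ y → y < N → ∀ j < dep (par y), tup (ptr y + j) = tup (ptr (par y) + j)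
  tup_lt : ∀ y, 2 ≤ y → y < N → tup (ptr y + dep (par y)) < n
  complete : ∀ x, 1 ≤ x → x < N → dep x < q → ∀ xs : Fin (dep x) → Fin n,
    (∀ j : Fin (dep x), tup (ptr x + j) = xs j) → ∀ v, ∃ y < N, par y = x ∧ ∃ u : Fin n,
      tup (ptr y + dep x) = u ∧ RankEquiv G q (Fin.snoc xs v : Fin _ → Fin n) (Fin.snoc xs u)

open Classical in
/-- The vector `w` gives the truth value of `φ`, which lies in the scope of `k` quantifiers, at all
nodes of depth `k`. Nothing is said about the other entries of `w`. -/
def IsTruthVector {c n k : ℕ} (G : ColoredGraph c n) (N : ℕ) (tup ptr dep : ℕ → ℕ)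
    (φ : (graphLang c).BoundedFormula Empty k) (w : ℕ → ℕ) : Prop :=
  ∀ x, 1 ≤ x → x < N → dep x = k → ∀ xs : Fin k → Fin n,
    (∀ j : Fin k, tup (ptr x + j) = xs j) →
    w x = if G.Sat φ Empty.elim xs then 1 else 0

/-- A universally quantified formula is true at a node if and only if the formula in its scope is
true at all children. -/
theorem IsTruthVector.all {c n k q N : ℕ} {G : ColoredGraph c n} {tup par ptr dep : ℕ → ℕ}
    (ht : IsTree G q N tup par ptr dep) {φ : (graphLang c).BoundedFormula Empty (k + 1)}
    {w w' : ℕ → ℕ} (hφ : IsTruthVector G N tup ptr dep φ w) (hq : k + 1 + quantRank φ ≤ q)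
    (h0 : ∀ x < N, (∃ y < N, par y = x ∧ w y = 0) → w' x = 0)
    (h1 : ∀ x < N, (∀ y < N, par y = x → w y ≠ 0) → w' x = 1) :
    IsTruthVector G N tup ptr dep φ.all w' := by
  classical
  intro x hx hxN hd xs hxs
  -- The only nodes whose parent is not a node are the root and the dummy `0`.
  have htwo : ∀ y, par y = x → 2 ≤ y := by
    intro y hy
    rcases Nat.lt_or_ge y 2 with h | h
    · interval_cases y
      · rw [ht.par_zero] at hy; omega
      · rw [ht.par_root] at hy; omega
    · exact h
  have child : ∀ y < N, par y = x → ∀ u : Fin n, tup (ptr y + k) = u →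
      w y = if G.Sat φ Empty.elim (Fin.snoc xs u) then 1 else 0 := by
    intro y hy hpar u hu
    refine hφ y (by have := htwo y hpar; omega) hy
      (by rw [ht.dep_child y (htwo y hpar) hy, hpar, hd]) _ fun j => ?_
    refine Fin.lastCases (by simpa using hu) (fun j => ?_) j
    have := ht.tup_child y (htwo y hpar) hy j (by rw [hpar, hd]; exact j.2)
    rw [hpar] at this
    simpa [this] using hxs j
  by_cases hall : G.Sat φ.all Empty.elim xs
  · rw [if_pos hall]
    refine h1 x hxN fun y hy hpar => ?_
    have hlt := ht.tup_lt y (htwo y hpar) hy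
    rw [hpar, hd] at hlt
    rw [child y hy hpar ⟨_, hlt⟩ rfl, if_pos ((G.sat_all _ _ φ).1 hall _)]
    exact one_ne_zero
  · rw [if_neg hall]
    obtain ⟨v, hv⟩ : ∃ v, ¬ G.Sat φ Empty.elim (Fin.snoc xs v) := by
      simpa [ColoredGraph.sat_all] using hall
    subst hd
    obtain ⟨y, hy, hpar, u, hu, heq⟩ := ht.complete x hx hxN (by omega) xs hxs v
    exact h0 x hxN ⟨y, hy, hpar, by
      rw [child y hy hpar u hu, if_neg (fun h => hv ((heq φ (by omega)).2 h))]⟩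

/-! ### Evaluation of a formula on a tree -/

/-- The truth value of the atomic formula with symbol `rOp` and arguments `rArg`, `rSnd` at the
node `rX`. -/
def atomBody : Program :=
  .load rXPtr aPtr rX ;;
  .ite rOp
    (.sub rC rOp rOne ;; .ite rC
      (.sub rC rC rOne ;; .ite rC
        (.add rA rXPtr rSnd ;; .load rA aTup rA ;; .load rB aMul rArg ;; .add rA rA rB ;;
          .load rOut aCol rA)
        (.add rA rXPtr rArg ;; .load rA aTup rA ;; .load rA aMul rA ;; .add rB rXPtr rSnd ;;
          .load rB aTup rB ;; .add rA rA rB ;; .load rOut aAdj rA))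
      (.add rA rXPtr rArg ;; .load rA aTup rA ;; .add rB rXPtr rSnd ;; .load rB aTup rB ;;
        .sub rC rA rB ;; .sub rA rB rA ;; .add rC rC rA ;; .sub rOut rOne rC))
    (.const rOut 0)

/-- Copy a register. -/
def move (x y : ℕ) : Program := .const rA 0 ;; .add x y rA

/-- The vector of an atomic formula is pushed. -/
def atomStep : Program := move rPtr rBase ;; fill rX rNodes aVec atomBody ;; move rBase rPtr

/-- The truth value of an implication at the node `rX`. The vector of the premise lies on top of the
vector of the conclusion, since the formula is read from right to left. -/
def impBody : Program :=
  .load rC aVec rPtr ;; .add rA rPtr rNodes ;; .load rB aVec rA ;;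
  .ite rB (.const rA 0 ;; .add rOut rC rA) (.const rOut 1)

/-- The two topmost vectors are replaced by the vector of the implication. -/
def impStep : Program :=
  (.sub rPtr rBase rNodes ;; .sub rPtr rPtr rNodes) ;; fill rX rNodes aVec impBody ;;
    move rBase rPtr

/-- If the formula is false at the node `rX`, then its universal closure is false at the parent. -/
def scatterBody : Program :=
  .add rA rBase rX ;; .load rA aVec rA ;;
  .ite rA .skip (.load rB aPar rX ;; .const rC 0 ;; .store aTmp rB rC)

/-- The topmost vector is replaced by the one of the universally quantified formula: this is true at
a node unless one of the children refutes it. -/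
def allStep : Program :=
  .const rPtr 0 ;; fill rX rNodes aTmp (.const rOut 1) ;; .sub rBase rBase rNodes ;;
  forLoop rX rNodes scatterBody ;; move rPtr rBase ;; fill rX rNodes aVec (.load rOut aTmp rX) ;;
  move rBase rPtr

/-- The next symbol and its arguments are fetched. Its number is compared with `3` and `4`, to tell
atomic formulas, implications and quantifiers apart. -/
def evalFetch : Program :=
  .sub rTok rTok rOne ;; .load rPos aStart rTok ;; .load rOp aCode rPos ;; .add rPos rPos rOne ;;
  .load rArg aCode rPos ;; .add rPos rPos rOne ;; .load rSnd aCode rPos ;;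
  .const rA 3 ;; .sub rC rOp rA ;; .const rA 4 ;; .sub rB rOp rA

/-- Evaluation of the formula from right to left, with a stack of vectors that are indexed by the
nodes of the tree. -/
def evalLoop : Program :=
  .loop rTok (evalFetch ;; .ite rC (.ite rB allStep impStep) atomStep)

/-- What the evaluation reads. -/
structure EvalCtx {c n : ℕ} (G : ColoredGraph c n) (q N : ℕ) (tup par ptr dep : ℕ → ℕ)
    (s : State) : Prop where
  one : s.reg rOne = 1
  nodes : s.reg rNodes = N
  graph : StoresGraph (s.arr aAdj) (s.arr aCol) G
  mul : ∀ i, i < n ∨ i < c → s.arr aMul i = i * n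
  tup_eq : s.arr aTup = tup
  par_eq : s.arr aPar = par
  ptr_eq : s.arr aPtr = ptr
  tree : IsTree G q N tup par ptr dep

/-- The vector `f` has been written to the addresses from `b` on. -/
structure Pushed (N b : ℕ) (f : ℕ → ℕ) (s s' : State) : Prop where
  base : s'.reg rBase = b + N
  vec : ∀ x < N, s'.arr aVec (b + x) = f x
  old : ∀ r < b, s'.arr aVec r = s.arr aVec r

/-- `φ` has been evaluated, and the stack has grown by one vector. -/
structure Evaluated {c n k : ℕ} (G : ColoredGraph c n) (N : ℕ) (tup ptr dep : ℕ → ℕ)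
    (φ : (graphLang c).BoundedFormula Empty k) (t b : ℕ) (s s' : State) : Prop where
  frame : Frame evalLoop s s'
  tok : s'.reg rTok = t
  base : s'.reg rBase = b + N
  vec : IsTruthVector G N tup ptr dep φ fun x => s'.arr aVec (b + x)
  old : ∀ r < b, s'.arr aVec r = s.arr aVec r

section

variable {L : ℕ → ℕ → ℕ → ℕ} {O : LearnOracle L} {B : LearnInput → Prop}

theorem runs_atomStep (s : State) {N b : ℕ} (f : ℕ → ℕ) (h1 : s.reg rOne = 1)
    (hN : s.reg rNodes = N) (hb : s.reg rBase = b)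
    (hf : ∀ x s', x < N → s'.reg rX = x → s'.reg rOne = 1 → s'.reg rOp = s.reg rOp →
      s'.reg rArg = s.reg rArg → s'.reg rSnd = s.reg rSnd → s'.arr aAdj = s.arr aAdj →
      s'.arr aCol = s.arr aCol → s'.arr aTup = s.arr aTup → s'.arr aMul = s.arr aMul →
      s'.arr aPtr = s.arr aPtr → (atomBody.run s').reg rOut = f x) :
    Runs O B atomStep s (N * 20 + 7) (Pushed N b f s) := by
  refine Runs.straight_seq (T := N * 20 + 5) rfl (fun hF => ?_)
    (by simp [move, Program.cost]; omega)
  have e10 : ((move rPtr rBase).run s).reg rPtr = b := by simp [move, Program.run, hb]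
  refine (Runs.seq (T₂ := 2) (runs_fill (C := 15) f rfl (by decide)
    ((hF.reg 1 rfl).trans h1) ((hF.reg 8 rfl).trans hN) e10 ?_ (Φ := fun s' =>
      s'.reg rPtr = b + N ∧ (∀ x < N, s'.arr aVec (b + x) = f x) ∧
      ∀ r < b, s'.arr aVec r = s.arr aVec r) ?_) ?_).mono (by omega) fun _ _ h => h
  · intro j s' hj hF' hx _ _ _
    exact hf j s' hj hx (((hF'.reg 1 rfl).trans (hF.reg 1 rfl)).trans h1)
      ((hF'.reg 19 rfl).trans (hF.reg 19 rfl)) ((hF'.reg 37 rfl).trans (hF.reg 37 rfl))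
      ((hF'.reg 38 rfl).trans (hF.reg 38 rfl)) ((hF'.arr 1 rfl).trans (hF.arr 1 rfl))
      ((hF'.arr 2 rfl).trans (hF.arr 2 rfl)) ((hF'.arr 12 rfl).trans (hF.arr 12 rfl))
      ((hF'.arr 14 rfl).trans (hF.arr 14 rfl)) ((hF'.arr 17 rfl).trans (hF.arr 17 rfl))
  · intro s' _ h h' h''
    exact ⟨h, h', fun r hr => (h'' r (.inl hr)).trans (by rw [hF.arr 15 rfl])⟩
  · rintro s' _ ⟨h, h', h''⟩
    exact Runs.straight rfl (by decide)
      ⟨by simp [move, Program.run, h], by simpa [move, Program.run] using h',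
        by simpa [move, Program.run] using h''⟩

theorem runs_impStep (s : State) {N b : ℕ} (h1 : s.reg rOne = 1)
    (hN : s.reg rNodes = N) (hb : s.reg rBase = b + N + N) :
    Runs O B impStep s (N * 20 + 7)
      (Pushed N b (fun x => if s.arr aVec (b + N + x) = 0 then 1 else s.arr aVec (b + x)) s) := by
  refine Runs.straight_seq (T := N * 20 + 5) rfl (fun hF => ?_) (by simp [Program.cost]; omega)
  have e10 :
      ((Program.sub rPtr rBase rNodes ;; Program.sub rPtr rPtr rNodes).run s).reg rPtr = b := by
    simp [Program.run, hb, hN]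
  refine (Runs.seq (T₂ := 2) (runs_fill (C := 15)
    (fun x => if s.arr aVec (b + N + x) = 0 then 1 else s.arr aVec (b + x)) rfl (by decide)
    ((hF.reg 1 rfl).trans h1) ((hF.reg 8 rfl).trans hN) e10 ?_ (Φ := fun s' =>
      s'.reg rPtr = b + N ∧ (∀ x < N, s'.arr aVec (b + x) =
        if s.arr aVec (b + N + x) = 0 then 1 else s.arr aVec (b + x)) ∧
      ∀ r < b, s'.arr aVec r = s.arr aVec r) ?_) ?_).mono (by omega) fun _ _ h => h
  · intro j s' hj hF' hx h10 _ hout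
    have e8 : s'.reg rNodes = N := ((hF'.reg 8 rfl).trans (hF.reg 8 rfl)).trans hN
    have ea : s'.arr aVec (b + j) = s.arr aVec (b + j) := by
      rw [hout _ (by omega), hF.arr 15 rfl]
    have eb : s'.arr aVec (b + j + N) = s.arr aVec (b + N + j) := by
      rw [hout _ (by omega), hF.arr 15 rfl, add_right_comm]
    by_cases h : s.arr aVec (b + N + j) = 0 <;> simp [impBody, Program.run, h10, e8, ea, eb, h]
  · intro s' _ h h' h''
    exact ⟨h, h', fun r hr => (h'' r (.inl hr)).trans (by rw [hF.arr 15 rfl])⟩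
  · rintro s' _ ⟨h, h', h''⟩
    exact Runs.straight rfl (by decide)
      ⟨by simp [move, Program.run, h], by simpa [move, Program.run] using h',
        by simpa [move, Program.run] using h''⟩

open Classical in
theorem runs_allStep (s : State) {N b : ℕ} (h1 : s.reg rOne = 1) (hN : s.reg rNodes = N)
    (hb : s.reg rBase = b + N) :
    Runs O B allStep s (N * 40 + 20)
      (Pushed N b (fun x => if ∃ y < N, s.arr aPar y = x ∧ s.arr aVec (b + y) = 0 then 0 else 1)
        s) := by
  refine (Runs.seq (T₁ := 1) (Ψ := fun s₁ => s₁.reg rPtr = 0) (.straight rfl le_rfl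
    (by simp [Program.run])) fun s₁ F₁ p₁ => ?_).mono
    (T := 1 + (3 + N * 6 + (1 + (3 + N * 11 + (2 + (3 + N * 6 + 2)))))) (by omega)
      fun _ _ h => h
  refine Runs.seq (runs_fill (C := 1) (fun _ => 1) rfl le_rfl ((F₁.reg 1 rfl).trans h1)
    ((F₁.reg 8 rfl).trans hN) p₁ (Φ := fun s' => ∀ x < N, s'.arr aTmp x = 1)
    (fun _ _ _ _ _ _ _ _ => by simp [Program.run])
    (fun s' _ _ h _ x hx => by simpa using h x hx)) fun s₂ F₂ p₂ => ?_
  refine Runs.seq (Ψ := fun s' => s'.reg rBase = b ∧ ∀ x < N, s'.arr aTmp x = 1)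
    (.straight rfl le_rfl ⟨?_, by simpa [Program.run] using p₂⟩) fun s₃ F₃ p₃ => ?_
  · simp [Program.run, F₂.reg 36 rfl, F₁.reg 36 rfl, F₂.reg 8 rfl, F₁.reg 8 rfl, hb, hN]
  have v₃ : s₃.arr aVec = s.arr aVec := by
    rw [F₃.arr 15 rfl, F₂.arr 15 rfl, F₁.arr 15 rfl]
  have par₃ : s₃.arr aPar = s.arr aPar := by
    rw [F₃.arr 13 rfl, F₂.arr 13 rfl, F₁.arr 13 rfl]
  have e1₃ : s₃.reg rOne = 1 := by
    rw [F₃.reg 1 rfl, F₂.reg 1 rfl, F₁.reg 1 rfl, h1]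
  have eN₃ : s₃.reg rNodes = N := by
    rw [F₃.reg 8 rfl, F₂.reg 8 rfl, F₁.reg 8 rfl, hN]
  refine Runs.seq (runs_forLoop (T := 8) (fun j s' => ∀ x < N, s'.arr aTmp x =
    if ∃ y < j, s.arr aPar y = x ∧ s.arr aVec (b + y) = 0 then 0 else 1) rfl e1₃ eN₃
    (fun j s' v w h => by simpa using h) (by simpa using p₃.2) ?_ (fun s' _ h => h))
    fun s₄ F₄ p₄ => ?_
  · intro j s' hj hF hi hI
    refine .straight rfl (by decide) fun x hx => ?_
    have eb : s'.reg rBase = b := (hF.reg 36 rfl).trans p₃.1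
    have ev : s'.arr aVec = s.arr aVec := (hF.arr 15 rfl).trans v₃
    have ep : s'.arr aPar = s.arr aPar := (hF.arr 13 rfl).trans par₃
    have hsplit : (∃ y < j + 1, s.arr aPar y = x ∧ s.arr aVec (b + y) = 0) ↔
        (s.arr aPar j = x ∧ s.arr aVec (b + j) = 0) ∨
          ∃ y < j, s.arr aPar y = x ∧ s.arr aVec (b + y) = 0 := by
      constructor
      · rintro ⟨y, hy, h⟩
        rcases Nat.lt_succ_iff_lt_or_eq.1 hy with hy | rfl
        · exact .inr ⟨y, hy, h⟩
        · exact .inl h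
      · rintro (h | ⟨y, hy, h⟩)
        · exact ⟨j, by omega, h⟩
        · exact ⟨y, by omega, h⟩
    simp only [hsplit]
    by_cases hz : s.arr aVec (b + j) = 0
    · by_cases hpx : s.arr aPar j = x
      · simp [scatterBody, Program.run, eb, ev, ep, hi, hz, hpx]
      · simp [scatterBody, Program.run, eb, ev, ep, hi, hz, hpx, Ne.symm hpx, hI x hx]
    · simp [scatterBody, Program.run, eb, ev, hi, hz, hI x hx]
  refine Runs.seq (T₁ := 2) (Ψ := fun s' => s'.reg rPtr = b) (.straight rfl (by decide)
    (by simp [move, Program.run, F₄.reg 36 rfl, p₃.1])) fun s₅ F₅ p₅ => ?_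
  refine Runs.seq (runs_fill (C := 1)
    (fun x => if ∃ y < N, s.arr aPar y = x ∧ s.arr aVec (b + y) = 0 then 0 else 1) rfl le_rfl
    (by rw [F₅.reg 1 rfl, F₄.reg 1 rfl, e1₃]) (by rw [F₅.reg 8 rfl, F₄.reg 8 rfl, eN₃]) p₅
    ?_ (fun s' _ h h' h'' => And.intro h (And.intro h' h''))) fun s₆ F₆ p₆ => ?_
  · intro j s' hj hF hi _ _ _
    simp only [Program.run, State.reg_setReg, if_true, hi]
    rw [hF.arr 16 rfl, F₅.arr 16 rfl, p₄ j hj]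
  · obtain ⟨h, h', h''⟩ := p₆
    refine Runs.straight rfl (by decide)
      ⟨by simp [move, Program.run, h], by simpa [move, Program.run] using h', fun r hr => ?_⟩
    have : s₆.arr aVec r = s.arr aVec r := by
      rw [h'' r (.inl hr), F₅.arr 15 rfl, F₄.arr 15 rfl, v₃]
    simpa [move, Program.run] using this

theorem EvalCtx.mono {c n q N : ℕ} {G : ColoredGraph c n} {tup par ptr dep : ℕ → ℕ} {s s' : State}
    (h : EvalCtx G q N tup par ptr dep s) (hF : Frame evalLoop s s') :
    EvalCtx G q N tup par ptr dep s' where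
  one := (hF.reg 1 rfl).trans h.one
  nodes := (hF.reg 8 rfl).trans h.nodes
  graph := by rw [hF.arr 1 rfl, hF.arr 2 rfl]; exact h.graph
  mul := by rw [hF.arr 14 rfl]; exact h.mul
  tup_eq := (hF.arr 12 rfl).trans h.tup_eq
  par_eq := (hF.arr 13 rfl).trans h.par_eq
  ptr_eq := (hF.arr 17 rfl).trans h.ptr_eq
  tree := h.tree

/-- One round of the evaluation loop. The hypothesis `hstep` provides the effect of the branch that
is taken. -/
theorem runs_evalRound {s : State} {N b t p T : ℕ} {f : ℕ → ℕ} {Φ : State → Prop}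
    (h1 : s.reg rOne = 1) (ht : s.reg rTok = t + 1) (hp : s.arr aStart t = p)
    (hstep : ∀ s', Frame evalFetch s s' → s'.reg rOp = s.arr aCode p →
      s'.reg rArg = s.arr aCode (p + 1) → s'.reg rSnd = s.arr aCode (p + 1 + 1) →
      s'.reg rC = s.arr aCode p - 3 → s'.reg rB = s.arr aCode p - 4 →
      Runs O B (.ite rC (.ite rB allStep impStep) atomStep) s' (N * 40 + 22) (Pushed N b f s'))
    (hrest : ∀ s', Frame evalLoop s s' → s'.reg rTok = t → Pushed N b f s s' →
      Runs O B evalLoop s' T Φ) :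
    Runs O B evalLoop s (T + (N * 40 + 40)) Φ := by
  refine (Runs.loop_step (T₁ := N * 40 + 33) (Ψ := fun s' => s'.reg rTok = t ∧ Pushed N b f s s')
    (by omega) (Runs.straight_seq (T := N * 40 + 22) rfl (fun hF =>
      (hstep _ hF ?_ ?_ ?_ ?_ ?_).mono le_rfl fun s' F h =>
        ⟨?_, h.base, h.vec, fun r hr => ?_⟩)
        (by simp [evalFetch, Program.cost]; omega))
    fun s' F h => hrest s' ⟨F.reg, F.arr⟩ h.1 h.2).mono (by omega) fun _ _ h => h
  all_goals try simp [evalFetch, Program.run, h1, ht, hp]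
  · rw [F.reg 17 rfl]; simp [evalFetch, Program.run, h1, ht]
  · rw [h.old r hr]; simp [evalFetch, Program.run]

/-- The evaluation of an atomic formula, given the value `f` of `atomBody`. -/
theorem runs_evalAtom {c n k q N : ℕ} {G : ColoredGraph c n} {tup par ptr dep : ℕ → ℕ}
    {φ : (graphLang c).BoundedFormula Empty k} {s : State} {p b t T : ℕ} {Φ : State → Prop}
    (f : ℕ → ℕ) (hc : EvalCtx G q N tup par ptr dep s)
    (hf : IsTruthVector G N tup ptr dep φ f) (hφ : tokens φ p = [p]) (hop : s.arr aCode p < 4)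
    (htok : Stored (s.arr aStart) t (tokens φ p)) (ht : s.reg rTok = t + (tokens φ p).length)
    (hb : s.reg rBase = b)
    (hval : ∀ x s', s'.reg rX = x → s'.reg rOne = 1 → s'.reg rOp = s.arr aCode p →
      s'.reg rArg = s.arr aCode (p + 1) → s'.reg rSnd = s.arr aCode (p + 1 + 1) →
      s'.arr aAdj = s.arr aAdj → s'.arr aCol = s.arr aCol → s'.arr aTup = s.arr aTup →
      s'.arr aMul = s.arr aMul → s'.arr aPtr = s.arr aPtr → (atomBody.run s').reg rOut = f x)
    (hrest : ∀ s', Evaluated G N tup ptr dep φ t b s s' → Runs O B evalLoop s' T Φ) :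
    Runs O B evalLoop s (T + (tokens φ p).length * (N * 40 + 40)) Φ := by
  rw [hφ, stored_cons] at htok
  rw [hφ] at ht ⊢
  refine (runs_evalRound (f := f) hc.one ht htok.1 ?_ fun s' F h h' =>
    hrest s' ⟨F, h, h'.base, ?_, h'.old⟩).mono (by simp) fun _ _ h => h
  · intro s' F e1 e2 e3 e4 _
    refine (Runs.ite (fun h => absurd e4 (by omega)) fun _ => runs_atomStep s' f
      ((F.reg 1 rfl).trans hc.one) ((F.reg 8 rfl).trans hc.nodes) ((F.reg 36 rfl).trans hb)
      fun x s'' _ h1 h2 h3 h4 h5 h6 h7 h8 h9 h10 => hval x s'' h1 h2 (h3.trans e1) (h4.trans e2)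
        (h5.trans e3) (h6.trans (F.arr 1 rfl)) (h7.trans (F.arr 2 rfl)) (h8.trans (F.arr 12 rfl))
        (h9.trans (F.arr 14 rfl)) (h10.trans (F.arr 17 rfl))).mono (by omega) fun _ _ h => h
  · intro x hx hxN hd xs hxs
    exact (h'.vec x hxN).trans (hf x hx hxN hd xs hxs)

/-- The evaluation, in continuation-passing style. The loop counts `rTok` down to `t`, which passes
over exactly the symbols of `φ`, and leaves the vector of `φ` on the stack. -/
theorem runs_evalLoop {c n k q N : ℕ} {G : ColoredGraph c n} {tup par ptr dep : ℕ → ℕ}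
    (φ : (graphLang c).BoundedFormula Empty k) (s : State) {p b t T : ℕ} {Φ : State → Prop}
    (hc : EvalCtx G q N tup par ptr dep s) (hw : Stored (s.arr aCode) p (wordOf φ))
    (htok : Stored (s.arr aStart) t (tokens φ p)) (ht : s.reg rTok = t + (tokens φ p).length)
    (hb : s.reg rBase = b) (hq : k + quantRank φ ≤ q)
    (hrest : ∀ s', Evaluated G N tup ptr dep φ t b s s' → Runs O B evalLoop s' T Φ) :
    Runs O B evalLoop s (T + (tokens φ p).length * (N * 40 + 40)) Φ := by
  classical
  have var : ∀ {k : ℕ} (xs : Fin k → Fin n) (τ : (graphLang c).Term (Empty ⊕ Fin k)) (x : ℕ),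
      (∀ j : Fin k, tup (ptr x + j) = xs j) →
      tup (ptr x + termCode Empty.elim 0 τ) = (Sum.elim Empty.elim xs (termVar τ) : Fin n) := by
    intro k xs τ x hxs
    match τ with
    | .var (.inr i) => simpa [termCode, termVar] using hxs i
    | .var (.inl a) => exact a.elim
    | .func F _ => exact F.elim
  induction φ generalizing s p b t T with
  | @falsum k =>
    simp only [wordOf, formulaCode, stored_cons] at hw
    refine runs_evalAtom (φ := .falsum) (fun _ => 0) hc (fun x _ _ _ xs _ => ?_) rfl (by simp [hw.1])
      htok ht hb
      (fun x s' h1 h2 h3 h4 h5 h6 h7 h8 h9 h10 => ?_) hrest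
    · rw [if_neg (G.sat_falsum _ _)]
    · simp [atomBody, Program.run, h3, hw.1]
  | @equal k t₁ t₂ =>
    simp only [wordOf, formulaCode, stored_cons] at hw
    refine runs_evalAtom (φ := .equal t₁ t₂) (fun x => if tup (ptr x + termCode Empty.elim 0 t₁) =
      tup (ptr x + termCode Empty.elim 0 t₂) then 1 else 0) hc (fun x _ _ _ xs hxs => ?_) rfl
      (by simp [hw.1]) htok ht hb (fun x s' h1 h2 h3 h4 h5 h6 h7 h8 h9 h10 => ?_) hrest
    · simp only [G.sat_equal, var xs _ x hxs, Fin.val_inj]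
    · simp [atomBody, Program.run, h1, h2, h3, h4, h5, h8, h10, hw, hc.tup_eq, hc.ptr_eq]
      split_ifs <;> omega
  | @rel k l R ts =>
    cases R with
    | edge =>
      simp only [wordOf, formulaCode, relCode, stored_cons] at hw
      refine runs_evalAtom (φ := .rel .edge ts) (fun x => s.arr aAdj (s.arr aMul
        (tup (ptr x + termCode Empty.elim 0 (ts 0))) + tup (ptr x + termCode Empty.elim 0 (ts 1))))
        hc (fun x _ _ _ xs hxs => ?_) rfl
        (by simp [hw.1]) htok ht hb (fun x s' h1 h2 h3 h4 h5 h6 h7 h8 h9 h10 => ?_) hrest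
      · simp only [G.sat_edge, var xs _ x hxs]
        rw [hc.mul _ (.inl (Fin.is_lt _)), hc.graph.1]
      · simp [atomBody, Program.run, h1, h2, h3, h4, h5, h6, h8, h9, h10, hw, hc.tup_eq, hc.ptr_eq]
    | color i =>
      simp only [wordOf, formulaCode, relCode, stored_cons] at hw
      refine runs_evalAtom (φ := .rel (.color i) ts) (fun x => s.arr aCol (tup (ptr x +
        termCode Empty.elim 0 (ts 0)) + s.arr aMul i)) hc (fun x _ _ _ xs hxs => ?_) rfl
        (by simp [hw.1]) htok ht hb (fun x s' h1 h2 h3 h4 h5 h6 h7 h8 h9 h10 => ?_) hrest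
      · simp only [G.sat_color, var xs _ x hxs]
        rw [hc.mul _ (.inr i.2), add_comm, hc.graph.2]
      · simp [atomBody, Program.run, h1, h2, h3, h4, h5, h7, h8, h9, h10, hw, hc.tup_eq, hc.ptr_eq]
  | @imp k φ ψ ih₁ ih₂ =>
    simp only [wordOf, formulaCode, stored_cons, stored_append] at hw
    obtain ⟨hop, hwφ, hwψ⟩ := hw
    simp only [tokens, stored_cons, stored_append] at htok
    obtain ⟨hp, htφ, htψ⟩ := htok
    simp only [tokens, List.length_cons, List.length_append] at ht
    have hr : k + quantRank φ ≤ q ∧ k + quantRank ψ ≤ q := by simp only [quantRank] at hq; omega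
    refine (ih₂ s hc hwψ (t := t + 1 + (tokens φ (p + 1)).length) htψ
      (by simp only [wordOf] at ht ⊢; omega) hb hr.2
      (T := T + (N * 40 + 40) + (tokens φ (p + 1)).length * (N * 40 + 40)) fun s₁ E₁ =>
      ih₁ s₁ (hc.mono E₁.frame) (by rw [E₁.frame.arr 3 rfl]; exact hwφ) (t := t + 1)
        (by rw [E₁.frame.arr 18 rfl]; exact htφ) E₁.tok E₁.base hr.1 fun s₂ E₂ => ?_).mono
        (by simp only [tokens, List.length_cons, List.length_append]; apply le_of_eq; ring)
        fun _ _ h => h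
    have hF := E₁.frame.trans E₂.frame
    have hop' : s₂.arr aCode p = 4 := by rw [hF.arr 3 rfl]; exact hop
    refine runs_evalRound (p := p)
      (f := fun x => if s₂.arr aVec (b + N + x) = 0 then 1 else s₂.arr aVec (b + x))
      (hc.mono hF).one E₂.tok (by rw [hF.arr 18 rfl]; exact hp) ?_ fun s' F h h' =>
      hrest s' ⟨hF.trans F, h, h'.base, ?_, fun r hr => ?_⟩
    · intro s' F e1 e2 e3 e4 e5
      rw [hop'] at e4 e5
      refine (Runs.ite (fun _ => Runs.ite (fun h => absurd e5 h) fun _ =>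
        (runs_impStep s' ((F.reg 1 rfl).trans (hc.mono hF).one)
          ((F.reg 8 rfl).trans (hc.mono hF).nodes) ((F.reg 36 rfl).trans E₂.base)))
        fun h => absurd (e4.symm.trans h) (by decide)).mono (by omega) fun s'' _ h => ?_
      rwa [F.arr 15 rfl] at h
    · intro x hx hxN hd xs hxs
      have h₁ := E₁.vec x hx hxN hd xs hxs
      have h₂ := E₂.vec x hx hxN hd xs hxs
      simp only [h'.vec x hxN, h₂, E₂.old (b + x) (by omega), h₁, G.sat_imp]
      by_cases hφ : G.Sat φ Empty.elim xs <;> simp [hφ]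
    · rw [h'.old r hr, E₂.old r (by omega), E₁.old r hr]
  | @all k φ ih =>
    simp only [wordOf, formulaCode, stored_cons] at hw
    obtain ⟨hop, hwφ⟩ := hw
    simp only [tokens, stored_cons] at htok
    obtain ⟨hp, htφ⟩ := htok
    simp only [tokens, List.length_cons] at ht
    have hr : k + 1 + quantRank φ ≤ q := by simp only [quantRank] at hq; omega
    refine (ih s hc hwφ (t := t + 1) htφ (by omega) hb hr
      (T := T + (N * 40 + 40)) fun s₁ E₁ => ?_).mono
        (by simp only [tokens, List.length_cons]; apply le_of_eq; ring) fun _ _ h => h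
    have hF := E₁.frame
    have hop' : s₁.arr aCode p = 5 := by rw [hF.arr 3 rfl]; exact hop
    refine runs_evalRound (p := p)
      (f := fun x => if ∃ y < N, s₁.arr aPar y = x ∧ s₁.arr aVec (b + y) = 0 then 0 else 1)
      (hc.mono hF).one E₁.tok (by rw [hF.arr 18 rfl]; exact hp) ?_ fun s' F h h' =>
      hrest s' ⟨hF.trans F, h, h'.base, ?_, fun r hr => ?_⟩
    · intro s' F e1 e2 e3 e4 e5
      rw [hop'] at e4 e5
      refine (Runs.ite (fun _ => Runs.ite (fun _ =>
        (runs_allStep s' ((F.reg 1 rfl).trans (hc.mono hF).one)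
          ((F.reg 8 rfl).trans (hc.mono hF).nodes) ((F.reg 36 rfl).trans E₁.base)))
        fun h => absurd (e5.symm.trans h) (by decide))
        fun h => absurd (e4.symm.trans h) (by decide)).mono (by omega) fun s'' _ h => ?_
      rwa [F.arr 15 rfl, F.arr 13 rfl] at h
    · rw [← (hc.mono hF).par_eq] at hc
      refine IsTruthVector.all hc.tree E₁.vec hr (fun x hx h => ?_) (fun x hx h => ?_)
      · rw [h'.vec x hx, if_pos h]
      · rw [h'.vec x hx, if_neg]
        rintro ⟨y, hy, hpar, h0⟩
        exact h y hy hpar h0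
    · rw [h'.old r hr, E₁.old r hr]

end

/-! ### Preparation of the instances -/

/-- The instance without examples on a single vertex. The answer to it reveals the number of
parameters of all later answers. -/
def emptyInstance (q : ℕ) : LearnInput where
  c := 0
  n := 1
  k := q
  ℓ := 0
  q := q
  G := ⟨⊥, Fin.elim0⟩
  pos := ∅
  neg := ∅

/-- The number of copies is one more than the number of parameters of the answers. -/
def countCopies : Program :=
  (.const rA 0 ;; .store aHead rA rOne ;; .const rA 2 ;; .store aHead rA rRank ;; .const rA 4 ;;
    .store aHead rA rRank) ;; .query ;; .const rA 2 ;; .load rCopies aAns rA ;;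
    .add rCopies rCopies rOne

/-- Adjacency of the vertices `rI` and `rJ` of the union: they are adjacent if they lie in the same
copy and their originals are adjacent. -/
def adjBody : Program :=
  .load rA aBlk rI ;; .load rB aBlk rJ ;; .sub rC rA rB ;; .sub rB rB rA ;; .add rC rC rB ;;
  .ite rC (.const rOut 0)
    (.load rA aOff rI ;; .load rA aMul rA ;; .load rB aOff rJ ;; .add rA rA rB ;;
      .load rOut aAdj rA)

/-- The original of the vertex `rJ` has the colour `rI`. -/
def colorBody : Program :=
  .load rA aMul rI ;; .load rB aOff rJ ;; .add rA rA rB ;; .load rOut aCol rA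

/-- The vertex `rJ` lies in the copy `rI`. -/
def copyColorBody : Program :=
  .load rA aBlk rJ ;; .sub rB rI rA ;; .sub rA rA rI ;; .add rA rA rB ;; .sub rOut rOne rA

/-- Tables of the multiples of `n`, and of the copy and the original of each vertex of the disjoint
union. -/
def buildTables : Program :=
  (.add rCnt rVert rCol ;; .add rCnt rCnt rCopies ;; .const rPtr 1) ;;
  fill rI rCnt aMul (.sub rA rPtr rOne ;; .load rA aMul rA ;; .add rOut rA rVert) ;;
  .const rPtr 0 ;; fill₂ rI rCopies rJ rVert aBlk (move rOut rI) ;;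
  .const rPtr 0 ;; fill₂ rI rCopies rJ rVert aOff (move rOut rJ) ;; move rSize rPtr

/-- The disjoint union of copies is written into the query arrays. -/
def buildGraph : Program :=
  .const rPtr 0 ;; fill₂ rI rSize rJ rSize aQAdj adjBody ;;
  .const rPtr 0 ;; fill₂ rI rCol rJ rSize aQCol colorBody ;;
  fill₂ rI rCopies rJ rSize aQCol copyColorBody ;;
  (.const rA 0 ;; .store aHead rA rSize ;; .const rA 1 ;; .add rB rCol rCopies ;;
    .store aHead rA rB ;; .const rA 5 ;; .store aHead rA rCopies ;; .const rA 6 ;;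
    .store aHead rA rCopies)

/-- The query arrays are ready for `pairInstance G m q`, up to the examples. -/
structure QueryCtx {c n : ℕ} (G : ColoredGraph c n) (q m : ℕ) (s : State) : Prop where
  one : s.reg rOne = 1
  vert : s.reg rVert = n
  rank : s.reg rRank = q
  copies : s.reg rCopies = m
  mul : ∀ i ≤ n + c + m, s.arr aMul i = i * n
  head : s.arr aHead 0 = m * n ∧ s.arr aHead 1 = c + m ∧ s.arr aHead 2 = q ∧ s.arr aHead 3 = 0 ∧
    s.arr aHead 4 = q ∧ s.arr aHead 5 = m ∧ s.arr aHead 6 = m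
  graph : StoresGraph (s.arr aQAdj) (s.arr aQCol) (G.copies m)

/-- Each of `m` blocks of length `n` contains its own number in `aBlk` and `0, …, n - 1` in
`aOff`. -/
structure Tables (c n m : ℕ) (s : State) : Prop where
  mul : ∀ i ≤ n + c + m, s.arr aMul i = i * n
  blk : ∀ i < m, ∀ j < n, s.arr aBlk (i * n + j) = i
  off : ∀ i < m, ∀ j < n, s.arr aOff (i * n + j) = j
  size : s.reg rSize = m * n

section

variable {L : ℕ → ℕ → ℕ → ℕ} {O : LearnOracle L} {B : LearnInput → Prop}

theorem storesQuery_empty {s : State} {q : ℕ} (hhead : s.arr aHead 0 = 1 ∧ s.arr aHead 1 = 0 ∧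
    s.arr aHead 2 = q ∧ s.arr aHead 3 = 0 ∧ s.arr aHead 4 = q ∧ s.arr aHead 5 = 0 ∧
    s.arr aHead 6 = 0) (hadj : s.arr aQAdj 0 = 0) :
    s.StoresQuery (emptyInstance q) := by
  obtain ⟨h0, h1, h2, h3, h4, h5, h6⟩ := hhead
  refine ⟨h0, h1, h2, h3, h4, ⟨fun u v => ?_, fun i => i.elim0⟩, ⟨fun e he => ?_, fun x hx => ?_⟩,
    ⟨fun e he => ?_, fun x hx => ?_⟩⟩
  · have hu : u = ⟨0, one_pos⟩ := Subsingleton.elim (α := Fin 1) _ _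
    have hv : v = ⟨0, one_pos⟩ := Subsingleton.elim (α := Fin 1) _ _
    subst hu hv
    simp [emptyInstance, hadj]
  · rw [h5] at he; omega
  · exact absurd hx (Finset.notMem_empty _)
  · rw [h6] at he; omega
  · exact absurd hx (Finset.notMem_empty _)

/-- The answer to the instance without examples cannot be a rejection, since every formula has
training error zero. -/
theorem runs_countCopies {Q : ℕ → ℕ → ℕ → ℕ} (hO : SolvesFOLearn Q O) {q : ℕ} (s : State)
    (hB : B (emptyInstance q)) (h1 : s.reg rOne = 1) (hq : s.reg rRank = q)
    (hzero : ∀ a, 4 ≤ a → a ≤ 8 → ∀ i, s.arr a i = 0) :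
    Runs O B countCopies s 10 (fun s' => s'.reg rCopies = L 0 q q + 1 ∧
      s'.arr aHead 2 = q ∧ s'.arr aHead 3 = 0 ∧ s'.arr aHead 4 = q) := by
  refine Runs.straight_seq (T := 4) rfl (fun F => ?_) (by decide)
  have hq' : ((Program.const rA 0 ;; .store aHead rA rOne ;; .const rA 2 ;;
      .store aHead rA rRank ;; .const rA 4 ;; .store aHead rA rRank).run s).StoresQuery
      (emptyInstance q) := by
    refine storesQuery_empty ?_ ?_ <;> simp [Program.run, h1, hq, hzero]
  refine Runs.seq (T₁ := 1) (T₂ := 3) (Ψ := fun s' => s'.arr aAns 2 = L 0 q q)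
    (Runs.query _ hq' hB ?_) fun s₁ F₁ h => .straight rfl (by decide) ?_
  · have := hO (emptyInstance q) one_pos (Finset.disjoint_empty_left _)
    rcases hOI : O (emptyInstance q) with _ | H
    · rw [hOI] at this
      refine absurd ⟨⟨.falsum, Fin.elim0⟩, Nat.zero_le _, ?_⟩ this
      exact (err_eq_zero_iff _).2 ⟨fun v hv => absurd hv (Finset.notMem_empty _),
        fun v hv => absurd hv (Finset.notMem_empty _)⟩
    · simp [State.answer, State.setArr]
      rfl
  · have e1 : s₁.reg rOne = 1 := by rw [F₁.reg 1 rfl, F.reg 1 rfl, h1]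
    have e4 : s₁.arr aHead = _ := F₁.arr 4 rfl
    simp [Program.run, h, e1, e4, hq, hzero]

theorem runs_buildTables {c n m : ℕ} (s : State) (h1 : s.reg rOne = 1) (hn : s.reg rVert = n)
    (hc : s.reg rCol = c) (hm : s.reg rCopies = m) (hzero : s.arr aMul 0 = 0) :
    Runs O B buildTables s ((n + c + m) * 8 + 2 * (m * (n * 7 + 6)) + 16) (Tables c n m) := by
  refine Runs.straight_seq (T := (n + c + m) * 8 + 2 * (m * (n * 7 + 6)) + 13) rfl (fun F => ?_)
    (by simp only [Program.cost]; omega)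
  set s₀ := (Program.add rCnt rVert rCol ;; Program.add rCnt rCnt rCopies ;;
    Program.const rPtr 1).run s with hs₀
  have ecnt : s₀.reg rCnt = n + c + m := by simp [hs₀, Program.run, hn, hc, hm]
  have eptr : s₀.reg rPtr = 1 := by simp [hs₀, Program.run]
  refine (Runs.seq (runs_fill (C := 3) (fun j => (j + 1) * n) rfl le_rfl ((F.reg 1 rfl).trans h1)
    ecnt eptr ?_ (Φ := fun s' => ∀ i ≤ n + c + m, s'.arr aMul i = i * n) ?_)
    fun s₁ F₁ p₁ => ?_).mono (T := 3 + (n + c + m) * 8 + (1 + (3 + m * (n * 7 + 6) + (1 +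
      (3 + m * (n * 7 + 6) + 2))))) (by omega) fun _ _ h => h
  · intro j s' hj hF hi hp hlow hout
    have e1 : s'.reg rOne = 1 := by rw [hF.reg 1 rfl, F.reg 1 rfl, h1]
    have e3 : s'.reg rVert = n := by rw [hF.reg 3 rfl, F.reg 3 rfl, hn]
    have ej : s'.arr aMul j = j * n := by
      rcases j with _ | j
      · rw [hout 0 (by omega), F.arr 14 rfl, hzero, zero_mul]
      · rw [add_comm j 1, hlow j (by omega), add_comm 1 j]
    simp [Program.run, hp, e1, e3, ej]
    ring
  · intro s' _ _ h h' i hi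
    rcases i with _ | i
    · rw [h' 0 (by omega), F.arr 14 rfl, hzero, zero_mul]
    · rw [add_comm i 1, h i (by omega), add_comm 1 i]
  have e1 : s₁.reg rOne = 1 := by rw [F₁.reg 1 rfl, F.reg 1 rfl, h1]
  have en : s₁.reg rVert = n := by rw [F₁.reg 3 rfl, F.reg 3 rfl, hn]
  have em : s₁.reg rCopies = m := by rw [F₁.reg 6 rfl, F.reg 6 rfl, hm]
  refine Runs.seq (Ψ := fun s' => s'.reg rPtr = 0) (.straight rfl le_rfl (by simp [Program.run]))
    fun s₂ F₂ p₂ => ?_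
  refine Runs.seq (runs_fill₂ (C := 2) (fun i _ => i) rfl rfl le_rfl ((F₂.reg 1 rfl).trans e1)
    ((F₂.reg 6 rfl).trans em) ((F₂.reg 3 rfl).trans en) p₂
    (fun x y s' _ _ _ hx hy => by simp [move, Program.run, hx])
    (Φ := fun s' => ∀ i < m, ∀ j < n, s'.arr aBlk (i * n + j) = i)
    fun s' _ _ h _ x hx y hy => by simpa using h x hx y hy) fun s₃ F₃ p₃ => ?_
  refine Runs.seq (Ψ := fun s' => s'.reg rPtr = 0) (.straight rfl le_rfl (by simp [Program.run]))
    fun s₄ F₄ p₄ => ?_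
  refine Runs.seq (runs_fill₂ (C := 2) (fun _ j => j) rfl rfl le_rfl
    (by rw [F₄.reg 1 rfl, F₃.reg 1 rfl, F₂.reg 1 rfl, e1])
    (by rw [F₄.reg 6 rfl, F₃.reg 6 rfl, F₂.reg 6 rfl, em])
    (by rw [F₄.reg 3 rfl, F₃.reg 3 rfl, F₂.reg 3 rfl, en]) p₄
    (fun x y s' _ _ _ hx hy => by simp [move, Program.run, hy])
    (Φ := fun s' => s'.reg rPtr = m * n ∧ ∀ i < m, ∀ j < n, s'.arr aOff (i * n + j) = j)
    fun s' _ hp h _ => ⟨by simpa using hp, fun x hx y hy => by simpa using h x hx y hy⟩)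
    fun s₅ F₅ p₅ => ?_
  refine (Runs.straight (Φ := fun s' => s'.reg rSize = m * n) rfl le_rfl
    (by simp [move, Program.run, p₅])).mono le_rfl fun s₆ F₆ p₆ => ⟨?_, ?_, ?_, p₆⟩
  · rw [F₆.arr 14 rfl, F₅.arr 14 rfl, F₄.arr 14 rfl, F₃.arr 14 rfl, F₂.arr 14 rfl]
    exact p₁
  · rw [F₆.arr 20 rfl, F₅.arr 20 rfl, F₄.arr 20 rfl]
    exact p₃
  · rw [F₆.arr 21 rfl]
    exact p₅.2

theorem runs_buildGraph {c n m q : ℕ} (G : ColoredGraph c n) (s : State) (h1 : s.reg rOne = 1)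
    (hn : s.reg rVert = n) (hc : s.reg rCol = c) (hq : s.reg rRank = q) (hm : s.reg rCopies = m)
    (hT : Tables c n m s) (hG : StoresGraph (s.arr aAdj) (s.arr aCol) G)
    (hhead : s.arr aHead 2 = q ∧ s.arr aHead 3 = 0 ∧ s.arr aHead 4 = q) :
    Runs O B buildGraph s (m * n * (m * n * 17 + 6) + (c + m) * (m * n * 10 + 6) + 20)
      (QueryCtx G q m) := by
  classical
  -- The tables give the copy and the original of a vertex of the disjoint union.
  have hdiv : ∀ w : Fin (m * n), s.arr aBlk w = w.divNat ∧ s.arr aOff w = w.modNat := by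
    intro w
    have hw : (w : ℕ) = w.divNat * n + w.modNat := by
      rw [← inCopy_val, inCopy_divNat_modNat]
    have hb := hT.blk w.divNat w.divNat.2 w.modNat w.modNat.2
    have ho := hT.off w.divNat w.divNat.2 w.modNat w.modNat.2
    rw [← hw] at hb ho
    exact ⟨hb, ho⟩
  refine (Runs.seq (T₁ := 1) (Ψ := fun s' => s'.reg rPtr = 0) (.straight rfl le_rfl
    (by simp [Program.run])) fun s₁ F₁ p₁ => ?_).mono (T := 1 + (3 + m * n * (m * n * 17 + 6) + (1 +
      (3 + c * (m * n * 9 + 6) + (3 + m * (m * n * 10 + 6) + 9))))) (by ring_nf; omega)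
        fun _ _ h => h
  refine Runs.seq (runs_fill₂ (C := 12) (fun w w' => if s.arr aBlk w = s.arr aBlk w' then
      s.arr aAdj (s.arr aMul (s.arr aOff w) + s.arr aOff w') else 0) rfl rfl (by decide)
    ((F₁.reg 1 rfl).trans h1) ((F₁.reg 7 rfl).trans hT.size) ((F₁.reg 7 rfl).trans hT.size) p₁
    ?_ (Φ := fun s' => ∀ w < m * n, ∀ w' < m * n, s'.arr aQAdj (w * (m * n) + w') =
      if s.arr aBlk w = s.arr aBlk w' then
      s.arr aAdj (s.arr aMul (s.arr aOff w) + s.arr aOff w') else 0) ?_) fun s₂ F₂ p₂ => ?_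
  · intro x y s' hx hy hF hi hj
    have ea : s'.arr aBlk = s.arr aBlk := by rw [hF.arr 20 rfl, F₁.arr 20 rfl]
    have eb : s'.arr aOff = s.arr aOff := by rw [hF.arr 21 rfl, F₁.arr 21 rfl]
    have ec : s'.arr aMul = s.arr aMul := by rw [hF.arr 14 rfl, F₁.arr 14 rfl]
    have ed : s'.arr aAdj = s.arr aAdj := by rw [hF.arr 1 rfl, F₁.arr 1 rfl]
    by_cases h : s.arr aBlk x = s.arr aBlk y
    · simp [adjBody, Program.run, hi, hj, ea, eb, ec, ed, h]
    · have : ¬ (s.arr aBlk x - s.arr aBlk y = 0 ∧ s.arr aBlk y - s.arr aBlk x = 0) := by omega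
      simp [adjBody, Program.run, hi, hj, ea, h, this]
  · intro s' _ _ h _ w hw w' hw'
    simpa using h w hw w' hw'
  refine Runs.seq (Ψ := fun s' => s'.reg rPtr = 0) (.straight rfl le_rfl (by simp [Program.run]))
    fun s₃ F₃ p₃ => ?_
  refine Runs.seq (runs_fill₂ (C := 4) (fun i w => s.arr aCol (s.arr aMul i + s.arr aOff w))
    rfl rfl le_rfl
    (by rw [F₃.reg 1 rfl, F₂.reg 1 rfl, F₁.reg 1 rfl, h1])
    (by rw [F₃.reg 4 rfl, F₂.reg 4 rfl, F₁.reg 4 rfl, hc])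
    (by rw [F₃.reg 7 rfl, F₂.reg 7 rfl, F₁.reg 7 rfl, hT.size]) p₃
    ?_ (Φ := fun s' => s'.reg rPtr = c * (m * n) ∧ ∀ i < c, ∀ w < m * n,
      s'.arr aQCol (i * (m * n) + w) = s.arr aCol (s.arr aMul i + s.arr aOff w)) ?_)
    fun s₄ F₄ p₄ => ?_
  · intro x y s' hx hy hF hi hj
    have eb : s'.arr aOff = s.arr aOff := by
      rw [hF.arr 21 rfl, F₃.arr 21 rfl, F₂.arr 21 rfl, F₁.arr 21 rfl]
    have ec : s'.arr aMul = s.arr aMul := by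
      rw [hF.arr 14 rfl, F₃.arr 14 rfl, F₂.arr 14 rfl, F₁.arr 14 rfl]
    have ed : s'.arr aCol = s.arr aCol := by
      rw [hF.arr 2 rfl, F₃.arr 2 rfl, F₂.arr 2 rfl, F₁.arr 2 rfl]
    simp [colorBody, Program.run, hi, hj, eb, ec, ed]
  · intro s' _ hp h _
    exact ⟨by simpa using hp, fun w hw w' hw' => by simpa using h w hw w' hw'⟩
  have e1₄ : s₄.reg rOne = 1 := by
    rw [F₄.reg 1 rfl, F₃.reg 1 rfl, F₂.reg 1 rfl, F₁.reg 1 rfl, h1]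
  refine Runs.seq (runs_fill₂ (C := 5) (fun i w => if i = s.arr aBlk w then 1 else 0)
    rfl rfl le_rfl e1₄
    (by rw [F₄.reg 6 rfl, F₃.reg 6 rfl, F₂.reg 6 rfl, F₁.reg 6 rfl, hm])
    (by rw [F₄.reg 7 rfl, F₃.reg 7 rfl, F₂.reg 7 rfl, F₁.reg 7 rfl, hT.size]) p₄.1
    ?_ (Φ := fun s' => (∀ i < c, ∀ w < m * n,
      s'.arr aQCol (i * (m * n) + w) = s.arr aCol (s.arr aMul i + s.arr aOff w)) ∧
      ∀ i < m, ∀ w < m * n,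
        s'.arr aQCol ((c + i) * (m * n) + w) = if i = s.arr aBlk w then 1 else 0) ?_)
    fun s₅ F₅ p₅ => ?_
  · intro x y s' hx hy hF hi hj
    have ea : s'.arr aBlk = s.arr aBlk := by
      rw [hF.arr 20 rfl, F₄.arr 20 rfl, F₃.arr 20 rfl, F₂.arr 20 rfl, F₁.arr 20 rfl]
    have e1 : s'.reg rOne = 1 := (hF.reg 1 rfl).trans e1₄
    simp [copyColorBody, Program.run, hi, hj, ea, e1]
    split_ifs <;> omega
  · intro s' _ _ h h'
    refine ⟨fun i hi w hw => ?_, fun i hi w hw => ?_⟩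
    · have : i * (m * n) + m * n ≤ c * (m * n) := by nlinarith
      rw [h' _ (by omega), p₄.2 i hi w hw]
    · rw [← h i hi w hw]
      congr 1
      ring
  have e1 : s₅.reg rOne = 1 := (F₅.reg 1 rfl).trans e1₄
  have en : s₅.reg rVert = n := by
    rw [F₅.reg 3 rfl, F₄.reg 3 rfl, F₃.reg 3 rfl, F₂.reg 3 rfl, F₁.reg 3 rfl, hn]
  have ec : s₅.reg rCol = c := by
    rw [F₅.reg 4 rfl, F₄.reg 4 rfl, F₃.reg 4 rfl, F₂.reg 4 rfl, F₁.reg 4 rfl, hc]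
  have eq : s₅.reg rRank = q := by
    rw [F₅.reg 5 rfl, F₄.reg 5 rfl, F₃.reg 5 rfl, F₂.reg 5 rfl, F₁.reg 5 rfl, hq]
  have em : s₅.reg rCopies = m := by
    rw [F₅.reg 6 rfl, F₄.reg 6 rfl, F₃.reg 6 rfl, F₂.reg 6 rfl, F₁.reg 6 rfl, hm]
  have eM : s₅.reg rSize = m * n := by
    rw [F₅.reg 7 rfl, F₄.reg 7 rfl, F₃.reg 7 rfl, F₂.reg 7 rfl, F₁.reg 7 rfl, hT.size]
  have eh : s₅.arr aHead = s.arr aHead := by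
    rw [F₅.arr 4 rfl, F₄.arr 4 rfl, F₃.arr 4 rfl, F₂.arr 4 rfl, F₁.arr 4 rfl]
  have emul : s₅.arr aMul = s.arr aMul := by
    rw [F₅.arr 14 rfl, F₄.arr 14 rfl, F₃.arr 14 rfl, F₂.arr 14 rfl, F₁.arr 14 rfl]
  have eadj : s₅.arr aQAdj = s₂.arr aQAdj := by
    rw [F₅.arr 5 rfl, F₄.arr 5 rfl, F₃.arr 5 rfl]
  have hgraph : StoresGraph (s₅.arr aQAdj) (s₅.arr aQCol) (G.copies m) := by
    refine ⟨fun u v => ?_, fun i v => ?_⟩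
    · rw [eadj, p₂ u u.2 v v.2, (hdiv u).1, (hdiv v).1, (hdiv u).2, (hdiv v).2,
        hT.mul _ (by have := u.modNat.2; omega), hG.1]
      simp only [copies_adj, Fin.val_inj]
      by_cases h : u.divNat = v.divNat <;> simp [h]
    · refine Fin.addCases (fun i => ?_) (fun e => ?_) i
      · rw [Fin.val_castAdd, p₅.1 i i.2 v v.2, (hdiv v).2, hT.mul _ (by have := i.2; omega), hG.2]
        simp only [mem_copies_color_castAdd]
      · rw [Fin.val_natAdd, p₅.2 e e.2 v v.2, (hdiv v).1]
        simp only [mem_copies_color_natAdd, Fin.val_inj, eq_comm]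
  refine .straight rfl le_rfl ⟨?_, ?_, ?_, ?_, ?_, ?_, ?_⟩
  · simpa [Program.run] using e1
  · simpa [Program.run] using en
  · simpa [Program.run] using eq
  · simpa [Program.run] using em
  · have := hT.mul; rw [← emul] at this; simpa [Program.run] using this
  · simp [Program.run, ec, em, eM, eh, hhead]
  · simpa [Program.run, StoresGraph] using hgraph

end

/-! ### Comparing two tuples with a call to the learner -/

/-- The tuple `a` is stored from address `p` on. -/
def TupleAt (tup : ℕ → ℕ) (p : ℕ) {q n : ℕ} (a : Fin q → Fin n) : Prop :=
  ∀ j : Fin q, tup (p + j) = a j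

theorem TupleAt.unique {tup : ℕ → ℕ} {p q n : ℕ} {a b : Fin q → Fin n} (ha : TupleAt tup p a)
    (hb : TupleAt tup p b) : a = b :=
  funext fun j => Fin.ext ((ha j).symm.trans (hb j))

theorem exists_tupleAt {tup : ℕ → ℕ} {p q n : ℕ} (h : ∀ j < q, tup (p + j) < n) :
    ∃ a : Fin q → Fin n, TupleAt tup p a :=
  ⟨fun j => ⟨_, h j j.2⟩, fun _ => rfl⟩

theorem storesTuples_copies {arr : ℕ → ℕ} {n m q : ℕ} (a : Fin q → Fin n)
    (h : ∀ e < m, ∀ j : Fin q, arr (e * q + j) = e * n + a j) :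
    StoresTuples arr m (Finset.univ.image fun e : Fin m => fun j => inCopy e (a j)) := by
  refine ⟨fun e he => ⟨_, Finset.mem_image_of_mem _ (Finset.mem_univ ⟨e, he⟩), fun j => ?_⟩,
    fun x hx => ?_⟩
  · rw [h e he, inCopy_val]
  · obtain ⟨e, -, rfl⟩ := Finset.mem_image.1 hx
    exact ⟨e, e.2, fun j => by rw [h e e.2, inCopy_val]⟩

/-- Entry `rJ` of the copy number `rI` of the tuple at the address in register `base`. -/
def exampleBody (base : ℕ) : Program :=
  .load rOut aMul rI ;; .add rA base rJ ;; .load rA aTup rA ;; .add rOut rOut rA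

/-- The copies of the tuple at the address in register `base` are written into the array `dst`. -/
def writeExamples (dst base : ℕ) : Program :=
  .const rPtr 0 ;; fill₂ rI rCopies rJ rRank dst (exampleBody base)

/-- Vertex number `rYi` of the children found so far is compared with the candidate. -/
def compareStep : Program :=
  (.add rY rFirst rYi ;; .load rYPtr aPtr rY) ;; writeExamples aPos rYPtr ;; .query ;;
    .const rA 0 ;; .load rA aAns rA ;; .ite rA .skip (.const rCov 1)

/-- Entry `rJ` of the candidate: the vertex `rV` in position `rDepth`, and elsewhere the entry of the
tuple of the node `rX`. -/
def candidateBody : Program :=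
  .add rA rXPtr rJ ;; .load rOut aTup rA ;; .sub rA rJ rDepth ;; .sub rB rDepth rJ ;;
  .add rA rA rB ;; .ite rA .skip (.const rA 0 ;; .add rOut rV rA)

/-- The candidate, which is already in place behind the other tuples, becomes a child of `rX`. -/
def appendNode : Program :=
  .store aPar rNodes rX ;; .store aPtr rNodes rTop ;; .add rA rDepth rOne ;;
  .store aDep rNodes rA ;; .add rNodes rNodes rOne ;; .add rTop rTop rRank

/-- The extension of the tuple of the node `rX` by the vertex `rV` becomes a new node, unless it is
equivalent to an extension that is already there. -/
def tryStep : Program :=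
  move rPtr rTop ;; fill rJ rRank aTup candidateBody ;; writeExamples aNeg rTop ;;
  (.const rCov 0 ;; .sub rKids rNodes rFirst) ;; forLoop rYi rKids compareStep ;;
  .ite rCov .skip appendNode

/-- All extensions of the tuple of the node number `rXi` of the current level are tried. -/
def expandStep : Program :=
  (.add rX rLo rXi ;; .load rXPtr aPtr rX ;; move rFirst rNodes) ;; forLoop rV rVert tryStep

/-- All nodes of the current level are expanded; the new nodes form the next level. -/
def levelStep : Program :=
  (.sub rCnt rNodes rLo ;; move rHi rNodes) ;; forLoop rXi rCnt expandStep ;; move rLo rHi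

/-- The tree of representative tuples is built level by level. -/
def buildTree : Program := .const rLo 1 ;; forLoop rDepth rRank levelStep

/-- `P` does not write into what `QueryCtx` speaks about. -/
def keepsQuery (P : Program) : Bool :=
  !P.writesReg rOne && !P.writesReg rVert && !P.writesReg rRank && !P.writesReg rCopies &&
    !P.writesArr aMul && !P.writesArr aHead && !P.writesArr aQAdj && !P.writesArr aQCol

theorem QueryCtx.mono {c n q m : ℕ} {G : ColoredGraph c n} {P : Program} {s s' : State}
    (h : QueryCtx G q m s) (hF : Frame P s s') (hP : keepsQuery P = true) :
    QueryCtx G q m s' := by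
  simp only [keepsQuery, Bool.and_eq_true, Bool.not_eq_true'] at hP
  obtain ⟨⟨⟨⟨⟨⟨⟨h1, h3⟩, h5⟩, h6⟩, a14⟩, a4⟩, a5⟩, a6⟩ := hP
  exact
    { one := (hF.reg 1 h1).trans h.one
      vert := (hF.reg 3 h3).trans h.vert
      rank := (hF.reg 5 h5).trans h.rank
      copies := (hF.reg 6 h6).trans h.copies
      mul := by rw [hF.arr 14 a14]; exact h.mul
      head := by rw [hF.arr 4 a4]; exact h.head
      graph := by rw [hF.arr 5 a5, hF.arr 6 a6]; exact h.graph }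

section

variable {L : ℕ → ℕ → ℕ → ℕ} {O : LearnOracle L} {B : LearnInput → Prop}

theorem RankEquiv.symm {c n q k : ℕ} {G : ColoredGraph c n} {xs ys : Fin k → Fin n}
    (h : RankEquiv G q xs ys) : RankEquiv G q ys xs := fun φ hφ => (h φ hφ).symm

/-- The answer `0` means that `a` and `b` are not told apart by formulas of quantifier rank `q`, any
other answer that they have different types. -/
theorem runs_query {Q : ℕ → ℕ → ℕ → ℕ} (hO : SolvesFOLearn Q O) {c n m q : ℕ}
    {G : ColoredGraph c n} {s : State} {a b : Fin q → Fin n} (hc : QueryCtx G q m s)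
    (hpos : StoresTuples (s.arr aPos) m (pairInstance G m q a b).pos)
    (hneg : StoresTuples (s.arr aNeg) m (pairInstance G m q a b).neg)
    (hB : B (pairInstance G m q a b)) (hab : a ≠ b) (hq : 0 < q) (hm : L 0 q q < m) :
    Runs O B .query s 1 fun s' =>
      (s'.arr aAns 0 = 0 → ∀ {k : ℕ} (f : Fin k → Fin q), RankEquiv G q (a ∘ f) (b ∘ f)) ∧
      (s'.arr aAns 0 ≠ 0 → ¬ BackForth G (Q q q 0) a b) := by
  obtain ⟨h0, h1, h2, h3, h4, h5, h6⟩ := hc.head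
  refine Runs.query (pairInstance G m q a b) ⟨h0, h1, h2, h3, h4, hc.graph, ?_, ?_⟩ hB ?_
  · rw [h5]; exact hpos
  · rw [h6]; exact hneg
  · have hn : 0 < m * n := Nat.mul_pos (by omega) ((a ⟨0, hq⟩).pos)
    have := hO (pairInstance G m q a b) hn (pairInstance_disjoint G m q hab)
    rcases hOI : O (pairInstance G m q a b) with _ | H
    · rw [hOI] at this
      refine ⟨fun _ k f => rankEquiv_of_reject G a b this hq f, fun h => absurd ?_ h⟩
      simp [State.answer, State.setArr]
    · rw [hOI] at this
      refine ⟨fun h => absurd h ?_, fun _ => not_backForth_of_hypothesis G a b H hm this.1 this.2⟩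
      simp [State.answer, State.setArr]

theorem runs_writeExamples {c n m q : ℕ} {G : ColoredGraph c n} {s : State} {a : Fin q → Fin n}
    (dst base p : ℕ) (hc : QueryCtx G q m s) (hp : s.reg base = p)
    (ha : TupleAt (s.arr aTup) p a)
    (hs : fillSafe rJ rRank dst (exampleBody base) = true)
    (hs' : (loopSafe rI rCopies (fill rJ rRank dst (exampleBody base)) && rI != 10 &&
      !(exampleBody base).writesReg rRank && rI != rRank) = true)
    (hb : base ≠ 11 ∧ (writeExamples dst base).writesReg base = false)
    (hdst : (writeExamples dst base).writesArr aTup = false ∧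
      (writeExamples dst base).writesArr aMul = false) :
    Runs O B (writeExamples dst base) s (m * (q * 9 + 6) + 4) fun s' =>
      StoresTuples (s'.arr dst) m
        (Finset.univ.image fun e : Fin m => fun j => inCopy e (a j)) := by
  refine (Runs.seq (T₁ := 1) (Ψ := fun s' => s'.reg rPtr = 0 ∧ s'.reg base = p) (.straight rfl
    le_rfl ?_) fun s₁ F₁ p₁ => ?_).mono (T := 1 + (3 + m * (q * (4 + 5) + 6))) (by norm_num; omega)
      fun _ _ h => h
  · refine ⟨by simp [Program.run], ?_⟩
    have hb10 : base ≠ 10 := by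
      rintro rfl
      exact absurd hb.2 (by simp [writeExamples, Program.writesReg])
    simp [Program.run, hb10, hp]
  refine runs_fill₂ (C := 4) (fun e j => e * n + s.arr aTup (p + j)) hs hs'
    (by simp [exampleBody, Program.cost]) ((F₁.reg 1 rfl).trans hc.one)
    ((F₁.reg 6 rfl).trans hc.copies) ((F₁.reg 5 rfl).trans hc.rank) p₁.1 ?_ ?_
  · intro e j s' he hj F hi hj'
    have e1 : s'.reg base = p := by
      rw [F.reg base, p₁.2]
      have h := hb.2
      simp only [writeExamples, Program.writesReg, Bool.or_eq_false_iff] at h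
      exact h.2
    have e2 : s'.arr aTup = s.arr aTup := by
      rw [F.arr 12 (by simpa [writeExamples, Program.writesArr] using hdst.1), F₁.arr 12 rfl]
    have e3 : s'.arr aMul = s.arr aMul := by
      rw [F.arr 14 (by simpa [writeExamples, Program.writesArr] using hdst.2), F₁.arr 14 rfl]
    simp [exampleBody, Program.run, hi, hj', e1, e2, e3, hb.1, hc.mul e (by omega)]
  · intro s' _ _ h _
    refine storesTuples_copies a fun e he j => ?_
    rw [← ha j, ← h e he j j.2, zero_add]

/-! ### Construction of the tree -/

/-- The nodes built so far form a tree of `q`-tuples; a child differs from its parent in the entry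
whose number is the depth of the parent. -/
structure TreeInv (n q : ℕ) (s : State) : Prop where
  root : 1 < s.reg rNodes
  top : s.reg rTop = s.reg rNodes * q
  ptr : ∀ x, 1 ≤ x → x < s.reg rNodes → s.arr aPtr x = x * q
  tup_lt : ∀ x, 1 ≤ x → x < s.reg rNodes → ∀ j < q, s.arr aTup (x * q + j) < n
  dep_root : s.arr aDep 1 = 0
  par_zero : s.arr aPar 0 = 0
  par_root : s.arr aPar 1 = 0
  par_pos : ∀ y, 2 ≤ y → y < s.reg rNodes → 1 ≤ s.arr aPar y
  par_lt : ∀ y, 2 ≤ y → y < s.reg rNodes → s.arr aPar y < y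
  dep_lt : ∀ y, 2 ≤ y → y < s.reg rNodes → s.arr aDep (s.arr aPar y) < q
  dep_child : ∀ y, 2 ≤ y → y < s.reg rNodes → s.arr aDep y = s.arr aDep (s.arr aPar y) + 1
  tup_child : ∀ y, 2 ≤ y → y < s.reg rNodes → ∀ j < q, j ≠ s.arr aDep (s.arr aPar y) →
    s.arr aTup (y * q + j) = s.arr aTup (s.arr aPar y * q + j)

/-- The tree of the state `s'` extends the one of `s`. -/
structure Extends (q : ℕ) (s s' : State) : Prop where
  nodes : s.reg rNodes ≤ s'.reg rNodes
  par : ∀ x < s.reg rNodes, s'.arr aPar x = s.arr aPar x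
  dep : ∀ x < s.reg rNodes, s'.arr aDep x = s.arr aDep x
  ptr : ∀ x < s.reg rNodes, s'.arr aPtr x = s.arr aPtr x
  tup : ∀ i < s.reg rNodes * q, s'.arr aTup i = s.arr aTup i

theorem Extends.refl (q : ℕ) (s : State) : Extends q s s :=
  ⟨le_rfl, fun _ _ => rfl, fun _ _ => rfl, fun _ _ => rfl, fun _ _ => rfl⟩

theorem Extends.trans {q : ℕ} {s s' s'' : State} (h : Extends q s s') (h' : Extends q s' s'') :
    Extends q s s'' where
  nodes := h.nodes.trans h'.nodes
  par x hx := (h'.par x (hx.trans_le h.nodes)).trans (h.par x hx)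
  dep x hx := (h'.dep x (hx.trans_le h.nodes)).trans (h.dep x hx)
  ptr x hx := (h'.ptr x (hx.trans_le h.nodes)).trans (h.ptr x hx)
  tup i hi := (h'.tup i (hi.trans_le (Nat.mul_le_mul_right q h.nodes))).trans (h.tup i hi)

theorem addr_lt {x N q j : ℕ} (hx : x < N) (hj : j < q) : x * q + j < N * q := by
  have : (x + 1) * q ≤ N * q := Nat.mul_le_mul_right q hx
  rw [add_mul, one_mul] at this
  omega

theorem Extends.tup_node {q : ℕ} {s s' : State} (h : Extends q s s') {x j : ℕ}
    (hx : x < s.reg rNodes) (hj : j < q) : s'.arr aTup (x * q + j) = s.arr aTup (x * q + j) :=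
  h.tup _ (addr_lt hx hj)

/-- An extension without new nodes is again a tree. -/
theorem TreeInv.congr {n q : ℕ} {s s' : State} (h : TreeInv n q s) (he : Extends q s s')
    (hN : s'.reg rNodes = s.reg rNodes) (ht : s'.reg rTop = s.reg rTop) : TreeInv n q s' where
  root := hN ▸ h.root
  top := by rw [ht, hN, h.top]
  ptr x h1 hx := by rw [hN] at hx; rw [he.ptr x hx, h.ptr x h1 hx]
  tup_lt x h1 hx j hj := by rw [hN] at hx; rw [he.tup_node hx hj]; exact h.tup_lt x h1 hx j hj
  dep_root := by rw [he.dep 1 h.root, h.dep_root]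
  par_zero := by rw [he.par 0 (by have := h.root; omega), h.par_zero]
  par_root := by rw [he.par 1 h.root, h.par_root]
  par_pos y h2 hy := by rw [hN] at hy; rw [he.par y hy]; exact h.par_pos y h2 hy
  par_lt y h2 hy := by rw [hN] at hy; rw [he.par y hy]; exact h.par_lt y h2 hy
  dep_lt y h2 hy := by
    rw [hN] at hy
    rw [he.par y hy, he.dep _ ((h.par_lt y h2 hy).trans hy)]
    exact h.dep_lt y h2 hy
  dep_child y h2 hy := by
    rw [hN] at hy
    rw [he.par y hy, he.dep y hy, he.dep _ ((h.par_lt y h2 hy).trans hy)]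
    exact h.dep_child y h2 hy
  tup_child y h2 hy j hj hne := by
    rw [hN] at hy
    have hp := (h.par_lt y h2 hy).trans hy
    rw [he.par y hy, he.dep _ hp] at hne
    rw [he.par y hy, he.tup_node hy hj, he.tup_node hp hj]
    exact h.tup_child y h2 hy j hj hne

/-- Some child of the node `x` represents the extension of the tuple of `x` by the vertex `v`. -/
def Covered {c n : ℕ} (G : ColoredGraph c n) (q : ℕ) (s : State) (x : ℕ) (v : Fin n) : Prop :=
  ∀ k, s.arr aDep x = k → ∀ xs : Fin k → Fin n, (∀ j : Fin k, s.arr aTup (x * q + j) = xs j) →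
    ∃ y < s.reg rNodes, s.arr aPar y = x ∧ ∃ u : Fin n, s.arr aTup (y * q + k) = u ∧
      RankEquiv G q (Fin.snoc xs v : Fin _ → Fin n) (Fin.snoc xs u)

theorem Covered.mono {c n q : ℕ} {G : ColoredGraph c n} {s s' : State} {x : ℕ} {v : Fin n}
    (h : Covered G q s x v) (he : Extends q s s') (hx : x < s.reg rNodes) (hd : s.arr aDep x < q) :
    Covered G q s' x v := by
  intro k hk xs hxs
  rw [he.dep x hx] at hk
  obtain ⟨y, hy, hp, u, hu, hr⟩ := h k hk xs fun j => by
    rw [← hxs j, he.tup_node hx (by have := j.2; omega)]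
  exact ⟨y, hy.trans_le he.nodes, (he.par y hy).trans hp, u, by
    rw [he.tup_node hy (by omega), hu], hr⟩

/-- The nodes from number `first` on are the children of the node `x` of depth `d`. They extend the
tuple of `x` by vertices below `v`, and their tuples have pairwise different types. -/
structure Kids {c n : ℕ} (G : ColoredGraph c n) (q R x d first v : ℕ) (s : State) : Prop where
  le : first ≤ s.reg rNodes
  par : ∀ y, first ≤ y → y < s.reg rNodes → s.arr aPar y = x
  lt : ∀ y, first ≤ y → y < s.reg rNodes → s.arr aTup (y * q + d) < v
  distinct : ∀ y y', first ≤ y → y < y' → y' < s.reg rNodes → ∀ a b : Fin q → Fin n,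
    TupleAt (s.arr aTup) (y * q) a → TupleAt (s.arr aTup) (y' * q) b → ¬ BackForth G R a b

/-- There are no more children than types. -/
theorem Kids.card_le {c n q R x d first v : ℕ} {G : ColoredGraph c n} {s : State}
    (h : Kids G q R x d first v s) (ht : TreeInv n q s) (hf : 1 ≤ first) :
    s.reg rNodes - first ≤ typeBound c R q := by
  obtain ⟨τ, hτ⟩ := exists_types G R q
  have ha : ∀ y : {y // first ≤ y ∧ y < s.reg rNodes}, ∃ a : Fin q → Fin n,
      TupleAt (s.arr aTup) (y * q) a := fun y =>
    exists_tupleAt (ht.tup_lt y (hf.trans y.2.1) y.2.2)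
  choose a ha using ha
  have hinj : Function.Injective fun i : Fin (s.reg rNodes - first) =>
      τ (a ⟨first + i, by omega, by omega⟩) := by
    have key : ∀ i j : Fin (s.reg rNodes - first), i < j →
        τ (a ⟨first + i, by omega, by omega⟩) ≠ τ (a ⟨first + j, by omega, by omega⟩) := by
      intro i j hij he
      exact h.distinct (first + i) (first + j) (by omega) (by simpa using hij) (by omega) _ _
        (ha ⟨first + i, by omega, by omega⟩) (ha ⟨first + j, by omega, by omega⟩) (hτ _ _ he)
    intro i j hij
    rcases lt_trichotomy i j with hlt | rfl | hlt
    · exact absurd hij (key i j hlt)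
    · rfl
    · exact absurd hij.symm (key j i hlt)
  simpa using Fintype.card_le_of_injective _ hinj

theorem Kids.congr {c n q R x d first v : ℕ} {G : ColoredGraph c n} {s s' : State}
    (h : Kids G q R x d first v s) (he : Extends q s s') (hN : s'.reg rNodes = s.reg rNodes)
    (hd : d < q) {v' : ℕ} (hv : v ≤ v') : Kids G q R x d first v' s' where
  le := hN ▸ h.le
  par y h1 hy := by rw [hN] at hy; rw [he.par y hy]; exact h.par y h1 hy
  lt y h1 hy := by
    rw [hN] at hy; rw [he.tup_node hy hd]; exact (h.lt y h1 hy).trans_le hv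
  distinct y y' h1 hlt hy' a b ha hb := by
    rw [hN] at hy'
    exact h.distinct y y' h1 hlt hy' a b
      (fun j => by rw [← he.tup_node (hlt.trans hy') j.2]; exact ha j)
      (fun j => by rw [← he.tup_node hy' j.2]; exact hb j)

/-- The state `s'` arises from `s` by appending a child of the node `x` of depth `d`. -/
structure Appended (q x d : ℕ) (s s' : State) : Prop where
  nodes : s'.reg rNodes = s.reg rNodes + 1
  top : s'.reg rTop = s.reg rTop + q
  par : ∀ y, s'.arr aPar y = if y = s.reg rNodes then x else s.arr aPar y
  ptr : ∀ y, s'.arr aPtr y = if y = s.reg rNodes then s.reg rTop else s.arr aPtr y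
  dep : ∀ y, s'.arr aDep y = if y = s.reg rNodes then d + 1 else s.arr aDep y
  tup : s'.arr aTup = s.arr aTup

theorem Appended.extends {q x d : ℕ} {s s' : State} (h : Appended q x d s s') :
    Extends q s s' where
  nodes := by rw [h.nodes]; omega
  par y hy := by rw [h.par, if_neg hy.ne]
  dep y hy := by rw [h.dep, if_neg hy.ne]
  ptr y hy := by rw [h.ptr, if_neg hy.ne]
  tup y _ := by rw [h.tup]

/-- The free space behind the tuples holds the tuple of `x`, with `v` in position `d`. -/
def IsCandidate (q x d v : ℕ) (s : State) : Prop :=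
  ∀ j < q, s.arr aTup (s.reg rNodes * q + j) = if j = d then v else s.arr aTup (x * q + j)

theorem TreeInv.append {n q x d v : ℕ} {s s' : State} (h : TreeInv n q s)
    (ha : Appended q x d s s') (hx : 1 ≤ x) (hxN : x < s.reg rNodes) (hd : s.arr aDep x = d)
    (hdq : d < q) (hv : v < n) (hc : IsCandidate q x d v s) : TreeInv n q s' := by
  have hroot := h.root
  have hcase : ∀ {y}, y < s'.reg rNodes → y < s.reg rNodes ∨ y = s.reg rNodes := fun hy => by
    rw [ha.nodes] at hy; omega
  have hpar : s'.arr aPar (s.reg rNodes) = x := by rw [ha.par, if_pos rfl]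
  have hdepx : s'.arr aDep x = d := by rw [ha.dep, if_neg hxN.ne, hd]
  have he := ha.extends
  refine ⟨by rw [ha.nodes]; omega, ?_, fun y h1 hy => ?_, fun y h1 hy j hj => ?_, ?_, ?_, ?_,
    fun y h2 hy => ?_, fun y h2 hy => ?_, fun y h2 hy => ?_, fun y h2 hy => ?_,
    fun y h2 hy j hj hne => ?_⟩
  · rw [ha.top, ha.nodes, h.top]; ring
  · rcases hcase hy with hy | rfl
    · rw [he.ptr y hy, h.ptr y h1 hy]
    · rw [ha.ptr, if_pos rfl, h.top]
  · rw [ha.tup]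
    rcases hcase hy with hy | rfl
    · exact h.tup_lt y h1 hy j hj
    · rw [hc j hj]
      split_ifs
      · exact hv
      · exact h.tup_lt x hx hxN j hj
  · rw [he.dep 1 hroot, h.dep_root]
  · rw [he.par 0 (by omega), h.par_zero]
  · rw [he.par 1 hroot, h.par_root]
  · rcases hcase hy with hy | rfl
    · rw [he.par y hy]; exact h.par_pos y h2 hy
    · rwa [hpar]
  · rcases hcase hy with hy | rfl
    · rw [he.par y hy]; exact h.par_lt y h2 hy
    · rwa [hpar]
  · rcases hcase hy with hy | rfl
    · rw [he.par y hy, he.dep _ ((h.par_lt y h2 hy).trans hy)]; exact h.dep_lt y h2 hy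
    · rwa [hpar, hdepx]
  · rcases hcase hy with hy | rfl
    · rw [he.par y hy, he.dep y hy, he.dep _ ((h.par_lt y h2 hy).trans hy)]
      exact h.dep_child y h2 hy
    · rw [hpar, hdepx, ha.dep, if_pos rfl]
  · rw [ha.tup]
    rcases hcase hy with hy | rfl
    · rw [he.par y hy, he.dep _ ((h.par_lt y h2 hy).trans hy)] at hne
      rw [he.par y hy]
      exact h.tup_child y h2 hy j hj hne
    · rw [hpar, hdepx] at hne
      rw [hpar, hc j hj, if_neg hne]

theorem Kids.append {c n q R x d first v : ℕ} {G : ColoredGraph c n} {s s' : State}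
    (h : Kids G q R x d first v s) (ha : Appended q x d s s') (hdq : d < q)
    (hc : IsCandidate q x d v s)
    (hdist : ∀ y, first ≤ y → y < s.reg rNodes → ∀ a b : Fin q → Fin n,
      TupleAt (s.arr aTup) (y * q) a → TupleAt (s.arr aTup) (s.reg rNodes * q) b →
      ¬ BackForth G R a b) : Kids G q R x d first (v + 1) s' := by
  have hcase : ∀ {y}, y < s'.reg rNodes → y < s.reg rNodes ∨ y = s.reg rNodes := fun hy => by
    rw [ha.nodes] at hy; omega
  refine ⟨h.le.trans ha.extends.nodes, fun y h1 hy => ?_, fun y h1 hy => ?_,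
    fun y y' h1 hlt hy a b => ?_⟩
  · rcases hcase hy with hy | rfl
    · rw [ha.extends.par y hy]; exact h.par y h1 hy
    · rw [ha.par, if_pos rfl]
  · rw [ha.tup]
    rcases hcase hy with hy | rfl
    · exact (h.lt y h1 hy).trans (Nat.lt_succ_self v)
    · rw [hc d hdq, if_pos rfl]; exact Nat.lt_succ_self v
  · rw [ha.tup]
    rcases hcase hy with hy | rfl
    · exact h.distinct y y' h1 hlt hy a b
    · exact hdist y h1 hlt a b

/-- Running time of `writeExamples`. -/
abbrev exampleTime (m q : ℕ) : ℕ := m * (q * 9 + 6) + 4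

/-- What one call to `compareStep` finds out: either the child `y` and the candidate `b` agree on
all formulas, or they have different types. -/
theorem runs_compareStep {Q : ℕ → ℕ → ℕ → ℕ} (hO : SolvesFOLearn Q O) {c n m q y : ℕ}
    {G : ColoredGraph c n} {s : State} {a b : Fin q → Fin n} (hc : QueryCtx G q m s)
    (hB : B (pairInstance G m q a b)) (hab : a ≠ b) (hq : 0 < q) (hm : L 0 q q < m)
    (hy : s.reg rFirst + s.reg rYi = y) (hptr : s.arr aPtr y = y * q)
    (ha : TupleAt (s.arr aTup) (y * q) a)
    (hneg : StoresTuples (s.arr aNeg) m (pairInstance G m q a b).neg) :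
    Runs O B compareStep s (exampleTime m q + 7) fun s' =>
      s'.reg rCov = 1 ∧ (∀ {k : ℕ} (f : Fin k → Fin q), RankEquiv G q (a ∘ f) (b ∘ f)) ∨
      s'.reg rCov = s.reg rCov ∧ ¬ BackForth G (Q q q 0) a b := by
  refine Runs.straight_seq (T := exampleTime m q + 5) rfl (fun F => ?_)
    (by simp only [Program.cost]; omega)
  set s₀ := (Program.add rY rFirst rYi ;; Program.load rYPtr aPtr rY).run s with hs₀
  have ep : s₀.reg rYPtr = y * q := by simp [hs₀, Program.run, hy, hptr]
  have hc₀ : QueryCtx G q m s₀ := hc.mono F rfl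
  refine (Runs.seq (T₂ := 5) (runs_writeExamples aPos rYPtr _ hc₀ ep
    (by rw [F.arr 12 rfl]; exact ha) rfl rfl ⟨by decide, rfl⟩ ⟨rfl, rfl⟩) fun s₁ F₁ p₁ => ?_).mono
    le_rfl fun _ _ h => h
  refine Runs.seq (T₁ := 1) (T₂ := 4) (runs_query hO (hc₀.mono F₁ rfl) p₁
    (by rw [F₁.arr 8 rfl, F.arr 8 rfl]; exact hneg) hB hab hq hm) fun s₂ F₂ p₂ => ?_
  refine .straight rfl (by decide) ?_
  have ecov : s₂.reg rCov = s.reg rCov := by rw [F₂.reg 31 rfl, F₁.reg 31 rfl, F.reg 31 rfl]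
  by_cases h : s₂.arr aAns 0 = 0
  · left
    exact ⟨by simp [Program.run, h], p₂.1 h⟩
  · right
    exact ⟨by simp [Program.run, h, ecov], p₂.2 h⟩

/-- Running time of `tryStep`, if there are at most `K` children. -/
abbrev tryTime (m q K : ℕ) : ℕ := q * 13 + exampleTime m q + K * (exampleTime m q + 10) + 17

/-- After a step the extension by `v` is represented, and the children still have pairwise different
types: a new child has been compared with all others, and each time the learner has returned a
hypothesis. -/
theorem runs_tryStep {Q : ℕ → ℕ → ℕ → ℕ} (hO : SolvesFOLearn Q O) {c n m q x d first : ℕ}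
    {G : ColoredGraph c n} {s : State} (hc : QueryCtx G q m s) (ht : TreeInv n q s)
    (hB : ∀ a b : Fin q → Fin n, B (pairInstance G m q a b)) (hm : L 0 q q < m)
    (hx : 1 ≤ x) (hxf : x < first) (hd : s.arr aDep x = d) (hdq : d < q) (v : Fin n)
    (hk : Kids G q (Q q q 0) x d first v s) (rx : s.reg rX = x) (rp : s.reg rXPtr = x * q)
    (rf : s.reg rFirst = first) (rd : s.reg rDepth = d) (rv : s.reg rV = v) :
    Runs O B tryStep s (tryTime m q (typeBound c (Q q q 0) q)) fun s' =>
      Extends q s s' ∧ TreeInv n q s' ∧ Kids G q (Q q q 0) x d first (v + 1) s' ∧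
      Covered G q s' x v := by
  have hfN := hk.le
  have hxN : x < s.reg rNodes := by omega
  refine (Runs.seq (T₁ := 2) (T₂ := (3 + q * 13) + (exampleTime m q + (2 + (3 +
    (s.reg rNodes - first) * (exampleTime m q + 10) + 7))))
    (Ψ := fun s' => s'.reg rPtr = s.reg rNodes * q) (.straight rfl (by decide)
      (by simp [move, Program.run, ht.top])) fun s₁ F₁ p₁ => ?_).mono ?_ fun _ _ h => h
  swap
  · have := Nat.mul_le_mul_right (exampleTime m q + 10) (hk.card_le ht (by omega))
    simp only [tryTime]
    omega
  -- The candidate is written behind the tuples of the tree.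
  refine Runs.seq (Ψ := fun s' => (∀ j < q, s'.arr aTup (s.reg rNodes * q + j) =
      if j = d then (v : ℕ) else s.arr aTup (x * q + j)) ∧
      ∀ i < s.reg rNodes * q, s'.arr aTup i = s.arr aTup i)
    (runs_fill (C := 8) (fun j => if j = d then (v : ℕ) else s.arr aTup (x * q + j)) rfl (by decide)
      ((F₁.reg 1 rfl).trans hc.one) ((F₁.reg 5 rfl).trans hc.rank) p₁ ?_ ?_) fun s₂ F₂ p₂ => ?_
  · intro j s' hj F hj' _ _ hout
    have e1 : s'.reg rXPtr = x * q := by rw [F.reg 28 rfl, F₁.reg 28 rfl, rp]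
    have e2 : s'.reg rDepth = d := by rw [F.reg 24 rfl, F₁.reg 24 rfl, rd]
    have e3 : s'.reg rV = v := by rw [F.reg 30 rfl, F₁.reg 30 rfl, rv]
    have e4 : s'.arr aTup (x * q + j) = s.arr aTup (x * q + j) := by
      rw [hout _ (.inl (addr_lt hxN hj)), F₁.arr 12 rfl]
    by_cases h : j = d
    · simp [candidateBody, Program.run, hj', e1, e2, e3, h]
    · have : ¬ (j - d = 0 ∧ d - j = 0) := by omega
      simp only [candidateBody, Program.run, State.reg_setReg, hj', e1, e2, h]
      rw [if_pos (by simp; omega)]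
      simp [e4]
  · intro s' F _ h h'
    exact ⟨h, fun i hi => by rw [h' i (.inl hi), F₁.arr 12 rfl]⟩
  have hN₂ : s₂.reg rNodes = s.reg rNodes := by rw [F₂.reg 8 rfl, F₁.reg 8 rfl]
  have hext₂ : Extends q s s₂ := by
    refine ⟨hN₂.ge, fun y _ => ?_, fun y _ => ?_, fun y _ => ?_, p₂.2⟩
    · rw [F₂.arr 13 rfl, F₁.arr 13 rfl]
    · rw [F₂.arr 22 rfl, F₁.arr 22 rfl]
    · rw [F₂.arr 17 rfl, F₁.arr 17 rfl]
  have ht₂ : TreeInv n q s₂ := ht.congr hext₂ hN₂ (by rw [F₂.reg 9 rfl, F₁.reg 9 rfl])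
  have hk₂ : Kids G q (Q q q 0) x d first v s₂ := hk.congr hext₂ hN₂ hdq le_rfl
  have hcand₂ : IsCandidate q x d v s₂ := by
    intro j hj
    rw [hN₂, p₂.1 j hj, hext₂.tup_node hxN hj]
  have hd₂ : s₂.arr aDep x = d := by rw [hext₂.dep x hxN, hd]
  obtain ⟨b, hb⟩ : ∃ b : Fin q → Fin n, TupleAt (s₂.arr aTup) (s₂.reg rNodes * q) b := by
    refine exists_tupleAt fun j hj => ?_
    rw [hcand₂ j hj]
    split_ifs
    · exact v.2
    · exact ht₂.tup_lt x hx (by omega) j hj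
  have hc₂ : QueryCtx G q m s₂ := (hc.mono F₁ rfl).mono F₂ rfl
  refine Runs.seq (runs_writeExamples aNeg rTop _ hc₂ ht₂.top hb rfl rfl ⟨by decide, rfl⟩
    ⟨rfl, rfl⟩) fun s₃ F₃ p₃ => ?_
  refine Runs.seq (Ψ := fun s' => s'.reg rCov = 0 ∧ s'.reg rKids = s.reg rNodes - first)
    (.straight rfl (by decide) ?_) fun s₄ F₄ p₄ => ?_
  · simp [Program.run, F₃.reg 8 rfl, hN₂, F₃.reg 29 rfl, F₂.reg 29 rfl, F₁.reg 29 rfl, rf]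
  have hc₄ : QueryCtx G q m s₄ := (hc₂.mono F₃ rfl).mono F₄ rfl
  have etup₄ : s₄.arr aTup = s₂.arr aTup := by rw [F₄.arr 12 rfl, F₃.arr 12 rfl]
  refine Runs.seq (T₂ := 7) (runs_forLoop (T := exampleTime m q + 7) (fun i s' =>
      s'.reg rCov = 1 ∧ (∃ y, first ≤ y ∧ y < s.reg rNodes ∧ ∃ a : Fin q → Fin n,
        TupleAt (s₂.arr aTup) (y * q) a ∧
        ∀ {k : ℕ} (f : Fin k → Fin q), RankEquiv G q (a ∘ f) (b ∘ f)) ∨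
      s'.reg rCov = 0 ∧ ∀ y, first ≤ y → y < first + i → ∀ a : Fin q → Fin n,
        TupleAt (s₂.arr aTup) (y * q) a → ¬ BackForth G (Q q q 0) a b)
    rfl hc₄.one p₄.2 (fun j s' v w h => by simpa using h)
    (.inr ⟨p₄.1, fun y h1 h2 => by omega⟩) ?_ fun s' _ h => h) fun s₅ F₅ p₅ => ?_
  · intro i s' hi F ri hI
    have hyN : first + i < s₂.reg rNodes := by omega
    obtain ⟨a, ha⟩ : ∃ a : Fin q → Fin n, TupleAt (s₂.arr aTup) ((first + i) * q) a :=
      exists_tupleAt (ht₂.tup_lt _ (by omega) hyN)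
    have hab : a ≠ b := by
      rintro rfl
      have h1 := hk₂.lt (first + i) (by omega) hyN
      rw [ha ⟨d, hdq⟩, ← hb ⟨d, hdq⟩, hcand₂ d hdq, if_pos rfl] at h1
      exact lt_irrefl _ h1
    refine (runs_compareStep hO (hc₄.mono F rfl) (hB a b) hab (by omega) hm (y := first + i) ?_ ?_
      (by rw [F.arr 12 rfl, etup₄]; exact ha)
      (by rw [F.arr 8 rfl, F₄.arr 8 rfl]; exact p₃)).mono le_rfl fun s'' _ h => ?_
    · rw [ri, F.reg 29 rfl, F₄.reg 29 rfl, F₃.reg 29 rfl, F₂.reg 29 rfl, F₁.reg 29 rfl, rf]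
    · rw [F.arr 17 rfl, F₄.arr 17 rfl, F₃.arr 17 rfl]
      exact ht₂.ptr _ (by omega) hyN
    · rcases h with ⟨h1, h2⟩ | ⟨h1, h2⟩
      · exact .inl ⟨h1, first + i, by omega, by omega, a, ha, h2⟩
      · rw [h1]
        refine hI.imp id fun hI => ⟨hI.1, fun y hy1 hy2 a' ha' => ?_⟩
        rcases Nat.lt_or_ge y (first + i) with hy | hy
        · exact hI.2 y hy1 hy a' ha'
        · obtain rfl : y = first + i := by omega
          rw [ha'.unique ha]
          exact h2
  have hN₅ : s₅.reg rNodes = s₂.reg rNodes := by rw [F₅.reg 8 rfl, F₄.reg 8 rfl, F₃.reg 8 rfl]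
  have etup : s₅.arr aTup = s₂.arr aTup := by rw [F₅.arr 12 rfl, etup₄]
  have epar : s₅.arr aPar = s₂.arr aPar := by rw [F₅.arr 13 rfl, F₄.arr 13 rfl, F₃.arr 13 rfl]
  have edep : s₅.arr aDep = s₂.arr aDep := by rw [F₅.arr 22 rfl, F₄.arr 22 rfl, F₃.arr 22 rfl]
  have eptr : s₅.arr aPtr = s₂.arr aPtr := by rw [F₅.arr 17 rfl, F₄.arr 17 rfl, F₃.arr 17 rfl]
  have hext₅ : Extends q s₂ s₅ := ⟨hN₅.ge, fun y _ => by rw [epar], fun y _ => by rw [edep],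
    fun y _ => by rw [eptr], fun y _ => by rw [etup]⟩
  have ht₅ : TreeInv n q s₅ := ht₂.congr hext₅ hN₅
    (by rw [F₅.reg 9 rfl, F₄.reg 9 rfl, F₃.reg 9 rfl])
  have hk₅ : Kids G q (Q q q 0) x d first v s₅ := hk₂.congr hext₅ hN₅ hdq le_rfl
  have hcand₅ : IsCandidate q x d v s₅ := by
    intro j hj
    rw [hN₅, etup]
    exact hcand₂ j hj
  refine (Runs.ite (T := 6) (fun h => ?_) fun h => ?_).mono le_rfl fun _ _ h => h
  · -- The candidate is covered by an earlier child.
    have hbv : ∀ j : Fin q, (b j : ℕ) = if (j : ℕ) = d then (v : ℕ) else s₂.arr aTup (x * q + j) :=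
      fun j => by rw [← hb j, hcand₂ j j.2]
    refine .straight rfl (by decide) ⟨hext₂.trans hext₅, ht₅, hk₅.congr (.refl _ _) rfl hdq
      (Nat.le_succ _), ?_⟩
    obtain ⟨y, hy1, hy2, a, ha, heq⟩ := (p₅.resolve_right fun h' => h h'.1).2
    intro k hk' xs hxs
    simp only [Program.run] at hk' hxs ⊢
    rw [edep, hd₂] at hk'
    subst hk'
    have hpar : s₂.arr aPar y = x := hk₂.par y hy1 (by omega)
    refine ⟨y, by omega, by rw [epar, hpar], a ⟨d, hdq⟩, by rw [etup]; exact ha ⟨d, hdq⟩, ?_⟩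
    have hf := (heq (Fin.castLE hdq : Fin (d + 1) → Fin q)).symm
    convert hf using 1
    · funext j
      apply Fin.ext
      refine Fin.lastCases ?_ (fun j => ?_) j
      · simp [hbv]
      · simp [hbv, j.2.ne, ← hxs j, etup]
    · funext j
      apply Fin.ext
      refine Fin.lastCases ?_ (fun j => ?_) j
      · simp
        rfl
      · have hjd := ht₂.tup_child y (by omega) (by omega) j (by omega)
          (by rw [hpar, hd₂]; exact j.2.ne)
        rw [hpar] at hjd
        rw [Fin.snoc_castSucc, ← hxs j, etup, ← hjd]
        exact ha (Fin.castLE hdq j.castSucc)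
  · -- The candidate becomes a new child.
    have hcov : ∀ y, first ≤ y → y < s₅.reg rNodes → ∀ a b' : Fin q → Fin n,
        TupleAt (s₅.arr aTup) (y * q) a → TupleAt (s₅.arr aTup) (s₅.reg rNodes * q) b' →
        ¬ BackForth G (Q q q 0) a b' := by
      intro y hy1 hy2 a b' ha hb'
      rw [etup] at ha hb'
      rw [hN₅] at hb'
      rw [hb'.unique hb]
      exact (p₅.resolve_left fun h' => by omega).2 y hy1 (by omega) a ha
    have e1 : s₅.reg rOne = 1 := by rw [F₅.reg 1 rfl]; exact hc₄.one
    have eq : s₅.reg rRank = q := by rw [F₅.reg 5 rfl]; exact hc₄.rank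
    have ex : s₅.reg rX = x := by
      rw [F₅.reg 27 rfl, F₄.reg 27 rfl, F₃.reg 27 rfl, F₂.reg 27 rfl, F₁.reg 27 rfl, rx]
    have ed : s₅.reg rDepth = d := by
      rw [F₅.reg 24 rfl, F₄.reg 24 rfl, F₃.reg 24 rfl, F₂.reg 24 rfl, F₁.reg 24 rfl, rd]
    have happ : Appended q x d s₅ (appendNode.run s₅) := by
      refine ⟨?_, ?_, fun y => ?_, fun y => ?_, fun y => ?_, ?_⟩
      · simp [appendNode, Program.run, e1]
      · simp [appendNode, Program.run, eq]
      · simp [appendNode, Program.run, ex]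
      · simp [appendNode, Program.run]
      · simp [appendNode, Program.run, e1, ed]
      · funext i
        simp [appendNode, Program.run]
    have hd₅ : s₅.arr aDep x = d := by rw [edep, hd₂]
    refine .straight rfl (by decide) ⟨hext₂.trans (hext₅.trans happ.extends),
      ht₅.append happ hx (by omega) hd₅ hdq v.2 hcand₅, hk₅.append happ hdq hcand₅ hcov, ?_⟩
    intro k hk' xs _
    rw [happ.extends.dep x (by omega), hd₅] at hk'
    subst hk'
    refine ⟨s₅.reg rNodes, by rw [happ.nodes]; omega, by rw [happ.par, if_pos rfl], v, ?_,
      fun φ _ => Iff.rfl⟩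
    rw [happ.tup, hcand₅ d hdq, if_pos rfl]

theorem extends_of_eq {q : ℕ} {s s' : State} (hN : s'.reg rNodes = s.reg rNodes)
    (ha : s'.arr aPar = s.arr aPar ∧ s'.arr aDep = s.arr aDep ∧ s'.arr aPtr = s.arr aPtr ∧
      s'.arr aTup = s.arr aTup) : Extends q s s' :=
  ⟨hN.ge, fun _ _ => by rw [ha.1], fun _ _ => by rw [ha.2.1], fun _ _ => by rw [ha.2.2.1],
    fun _ _ => by rw [ha.2.2.2]⟩

/-- Running time of `expandStep`. -/
abbrev expandTime (n m q K : ℕ) : ℕ := n * (tryTime m q K + 3) + 8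

theorem runs_expandStep {Q : ℕ → ℕ → ℕ → ℕ} (hO : SolvesFOLearn Q O) {c n m q x d : ℕ}
    {G : ColoredGraph c n} {s : State} (hc : QueryCtx G q m s) (ht : TreeInv n q s)
    (hB : ∀ a b : Fin q → Fin n, B (pairInstance G m q a b)) (hm : L 0 q q < m)
    (hx : 1 ≤ x) (hxN : x < s.reg rNodes) (hd : s.arr aDep x = d) (hdq : d < q)
    (rx : s.reg rLo + s.reg rXi = x) (rd : s.reg rDepth = d) :
    Runs O B expandStep s (expandTime n m q (typeBound c (Q q q 0) q)) fun s' =>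
      Extends q s s' ∧ TreeInv n q s' ∧
      s'.reg rNodes ≤ s.reg rNodes + typeBound c (Q q q 0) q ∧
      (∀ y, s.reg rNodes ≤ y → y < s'.reg rNodes → s'.arr aDep y = d + 1) ∧
      ∀ v, Covered G q s' x v := by
  refine Runs.straight_seq (T := 3 + n * (tryTime m q (typeBound c (Q q q 0) q) + 3)) rfl
    (fun F => ?_) (by simp only [Program.cost, move, expandTime]; omega)
  set s₀ := (Program.seq _ _).run s with hs₀
  have hN₀ : s₀.reg rNodes = s.reg rNodes := F.reg 8 rfl
  have he₀ : Extends q s s₀ :=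
    extends_of_eq hN₀ ⟨F.arr 13 rfl, F.arr 22 rfl, F.arr 17 rfl, F.arr 12 rfl⟩
  have ht₀ : TreeInv n q s₀ := ht.congr he₀ hN₀ (F.reg 9 rfl)
  have hc₀ : QueryCtx G q m s₀ := hc.mono F rfl
  have e1 : s₀.reg rX = x := by simp [hs₀, Program.run, move, rx]
  have e2 : s₀.reg rXPtr = x * q := by simp [hs₀, Program.run, move, rx, ht.ptr x hx hxN]
  have e3 : s₀.reg rFirst = s.reg rNodes := by simp [hs₀, Program.run, move]
  have hd₀ : s₀.arr aDep x = d := by rw [he₀.dep x hxN, hd]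
  refine runs_forLoop (fun v s' => Extends q s₀ s' ∧ TreeInv n q s' ∧
    Kids G q (Q q q 0) x d (s.reg rNodes) v s' ∧ ∀ u : Fin n, (u : ℕ) < v → Covered G q s' x u)
    rfl hc₀.one hc₀.vert ?_ ?_ ?_ ?_
  · rintro j s' v w ⟨h1, h2, h3, h4⟩
    have hN' : ((s'.setReg rV v).setReg 2 w).reg rNodes = s'.reg rNodes := by simp
    have he' : Extends q s' ((s'.setReg rV v).setReg 2 w) :=
      extends_of_eq hN' ⟨rfl, rfl, rfl, rfl⟩
    have hx' : x < s'.reg rNodes := by have := h1.nodes; omega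
    exact ⟨h1.trans he', h2.congr he' hN' (by simp), h3.congr he' hN' hdq le_rfl,
      fun u hu => (h4 u hu).mono he' hx' (by rwa [h1.dep x (by omega), hd₀])⟩
  · exact ⟨.refl _ _, ht₀, ⟨hN₀.ge, fun y h1 h2 => by omega, fun y h1 h2 => by omega,
      fun y y' h1 h2 h3 => by omega⟩, fun u hu => by omega⟩
  · rintro v s' hv F' rv ⟨h1, h2, h3, h4⟩
    have hd' : s'.arr aDep x = d := by rw [h1.dep x (by omega), hd₀]
    have hx' : x < s'.reg rNodes := by have := h1.nodes; omega
    refine (runs_tryStep hO (hc₀.mono F' rfl) h2 hB hm hx hxN hd' hdq ⟨v, hv⟩ h3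
      ((F'.reg 27 rfl).trans e1) ((F'.reg 28 rfl).trans e2) ((F'.reg 29 rfl).trans e3)
      (((F'.reg 24 rfl).trans (F.reg 24 rfl)).trans rd) rv).mono le_rfl fun s'' _ h => ?_
    obtain ⟨g1, g2, g3, g4⟩ := h
    refine ⟨h1.trans g1, g2, g3, fun u hu => ?_⟩
    rcases Nat.lt_succ_iff_lt_or_eq.1 hu with hu | hu
    · exact (h4 u hu).mono g1 hx' (by rwa [hd'])
    · obtain rfl : u = ⟨v, hv⟩ := Fin.ext hu
      exact g4
  · rintro s' F' ⟨h1, h2, h3, h4⟩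
    refine ⟨he₀.trans h1, h2, ?_, fun y hy1 hy2 => ?_, fun v => h4 v v.2⟩
    · have := h3.card_le h2 (by omega)
      omega
    · rw [h2.dep_child y (by omega) hy2, h3.par y hy1 hy2, h1.dep x (by omega), hd₀]

/-- The tree is complete above the current level, which consists of the nodes of depth `d` and
begins at node `rLo`; each node has at most `K` children. -/
structure LevelInv {c n : ℕ} (G : ColoredGraph c n) (q K d : ℕ) (s : State) : Prop where
  tree : TreeInv n q s
  lo_pos : 1 ≤ s.reg rLo
  lo_le : s.reg rLo ≤ s.reg rNodes
  bound : s.reg rNodes ≤ 1 + (K + 1) ^ d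
  level : ∀ x, s.reg rLo ≤ x → x < s.reg rNodes → s.arr aDep x = d
  dep_lt : ∀ x, 1 ≤ x → x < s.reg rLo → s.arr aDep x < d
  covered : ∀ x, 1 ≤ x → x < s.reg rLo → ∀ v, Covered G q s x v

/-- Running time of `levelStep`. -/
abbrev levelTime (n m q K : ℕ) : ℕ := (K + 1) ^ q * (expandTime n m q K + 3) + 9

theorem runs_levelStep {Q : ℕ → ℕ → ℕ → ℕ} (hO : SolvesFOLearn Q O) {c n m q d : ℕ}
    {G : ColoredGraph c n} {s : State} (hc : QueryCtx G q m s)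
    (hl : LevelInv G q (typeBound c (Q q q 0) q) d s)
    (hB : ∀ a b : Fin q → Fin n, B (pairInstance G m q a b)) (hm : L 0 q q < m)
    (hdq : d < q) (rd : s.reg rDepth = d) :
    Runs O B levelStep s (levelTime n m q (typeBound c (Q q q 0) q))
      (LevelInv G q (typeBound c (Q q q 0) q) (d + 1)) := by
  set K := typeBound c (Q q q 0) q
  obtain ⟨ht, hlo1, hlo2, hbound, hlevel, hdep, hcov⟩ := hl
  have hcnt : s.reg rNodes - s.reg rLo ≤ (K + 1) ^ q :=
    le_trans (b := (K + 1) ^ d) (by omega) (Nat.pow_le_pow_right (by omega) hdq.le)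
  refine Runs.straight_seq (T := 3 + (s.reg rNodes - s.reg rLo) * (expandTime n m q K + 3) + 2) rfl
    (fun F => ?_) (by
      have := Nat.mul_le_mul_right (expandTime n m q K + 3) hcnt
      simp only [Program.cost, move, levelTime]; omega)
  set s₀ := (Program.seq _ _).run s with hs₀
  have hN₀ : s₀.reg rNodes = s.reg rNodes := F.reg 8 rfl
  have hlo₀ : s₀.reg rLo = s.reg rLo := F.reg 22 rfl
  have he₀ : Extends q s s₀ :=
    extends_of_eq hN₀ ⟨F.arr 13 rfl, F.arr 22 rfl, F.arr 17 rfl, F.arr 12 rfl⟩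
  have ht₀ : TreeInv n q s₀ := ht.congr he₀ hN₀ (F.reg 9 rfl)
  have hc₀ : QueryCtx G q m s₀ := hc.mono F rfl
  have e1 : s₀.reg rHi = s.reg rNodes := by simp [hs₀, Program.run, move]
  have e2 : s₀.reg rCnt = s.reg rNodes - s.reg rLo := by simp [hs₀, Program.run, move]
  refine Runs.seq (runs_forLoop (T := expandTime n m q K) (fun i s' => Extends q s₀ s' ∧
    TreeInv n q s' ∧ s'.reg rNodes ≤ s.reg rNodes + i * K ∧
    (∀ y, s.reg rNodes ≤ y → y < s'.reg rNodes → s'.arr aDep y = d + 1) ∧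
    ∀ x, 1 ≤ x → x < s.reg rLo + i → x < s.reg rNodes → ∀ v, Covered G q s' x v)
    rfl hc₀.one e2 ?_ ?_ ?_ fun s' _ h => h) ?_
  · rintro j s' v w ⟨h1, h2, h3, h4, h5⟩
    have hN' : ((s'.setReg rXi v).setReg 2 w).reg rNodes = s'.reg rNodes := by simp
    have he' : Extends q s' ((s'.setReg rXi v).setReg 2 w) :=
      extends_of_eq hN' ⟨rfl, rfl, rfl, rfl⟩
    refine ⟨h1.trans he', h2.congr he' hN' (by simp), by omega, fun y hy1 hy2 => ?_,
      fun x hx1 hx2 hx3 u => (h5 x hx1 hx2 hx3 u).mono he' (by have := h1.nodes; omega) ?_⟩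
    · exact h4 y hy1 (by omega)
    · rw [h1.dep x (by omega), he₀.dep x hx3]
      rcases Nat.lt_or_ge x (s.reg rLo) with h | h
      · exact (hdep x hx1 h).trans hdq
      · rwa [hlevel x h hx3]
  · refine ⟨.refl _ _, ht₀, by omega, fun y h1 h2 => by omega, fun x hx1 hx2 hx3 v =>
      (hcov x hx1 hx2 v).mono he₀ hx3 ((hdep x hx1 hx2).trans hdq)⟩
  · rintro i s' hi F' ri ⟨h1, h2, h3, h4, h5⟩
    have hxN : s.reg rLo + i < s.reg rNodes := by omega
    have hNN := h1.nodes
    have hd' : s'.arr aDep (s.reg rLo + i) = d := by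
      rw [h1.dep _ (by omega), he₀.dep _ hxN, hlevel _ (by omega) hxN]
    refine (runs_expandStep hO (hc₀.mono F' rfl) h2 hB hm (by omega) (by omega) hd' hdq
      (by rw [ri, F'.reg 22 rfl, hlo₀]) (by rw [F'.reg 24 rfl, F.reg 24 rfl, rd])).mono le_rfl
      fun s'' _ h => ?_
    obtain ⟨g1, g2, g3, g4, g5⟩ := h
    refine ⟨h1.trans g1, g2, ?_, fun y hy1 hy2 => ?_, fun x hx1 hx2 hx3 v => ?_⟩
    · rw [add_mul, one_mul]; omega
    · rcases Nat.lt_or_ge y (s'.reg rNodes) with h | h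
      · rw [g1.dep y h, h4 y hy1 h]
      · exact g4 y h hy2
    · rcases Nat.lt_or_ge x (s.reg rLo + i) with h | h
      · refine (h5 x hx1 h hx3 v).mono g1 (by omega) ?_
        rw [h1.dep x (by omega), he₀.dep x hx3]
        rcases Nat.lt_or_ge x (s.reg rLo) with h | h
        · exact (hdep x hx1 h).trans hdq
        · rwa [hlevel x h hx3]
      · obtain rfl : x = s.reg rLo + i := by omega
        exact g5 v
  · rintro s₁ F₁ ⟨h1, h2, h3, h4, h5⟩
    refine (Runs.straight (Φ := fun s' => s'.reg rLo = s.reg rNodes) rfl (by decide) ?_).mono le_rfl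
      fun s₂ F₂ h => ?_
    · simp [move, Program.run, F₁.reg 23 rfl, e1]
    have hN₂ : s₂.reg rNodes = s₁.reg rNodes := F₂.reg 8 rfl
    have he₂ : Extends q s₁ s₂ :=
      extends_of_eq hN₂ ⟨F₂.arr 13 rfl, F₂.arr 22 rfl, F₂.arr 17 rfl, F₂.arr 12 rfl⟩
    have hNN := h1.nodes
    have hdepq : ∀ x, 1 ≤ x → x < s.reg rNodes → s₁.arr aDep x < d + 1 := by
      intro x hx1 hx2
      rw [h1.dep x (by omega), he₀.dep x hx2]
      rcases Nat.lt_or_ge x (s.reg rLo) with h | h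
      · exact (hdep x hx1 h).trans (Nat.lt_succ_self d)
      · rw [hlevel x h hx2]; exact Nat.lt_succ_self d
    refine ⟨h2.congr he₂ hN₂ (F₂.reg 9 rfl), by omega, by omega, ?_, fun x hx1 hx2 => ?_,
      fun x hx1 hx2 => ?_, fun x hx1 hx2 v => ?_⟩
    · rw [hN₂, pow_succ]
      have h6 : (s.reg rNodes - s.reg rLo) * K ≤ (K + 1) ^ d * K :=
        Nat.mul_le_mul_right K (by omega)
      rw [mul_add]
      omega
    · rw [he₂.dep x (by omega)]
      exact h4 x (by omega) (by omega)
    · rw [he₂.dep x (by omega)]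
      exact hdepq x hx1 (by omega)
    · exact (h5 x hx1 (by omega) (by omega) v).mono he₂ (by omega)
        ((hdepq x hx1 (by omega)).trans_le hdq)

/-- Running time of `buildTree`. -/
abbrev treeTime (n m q K : ℕ) : ℕ := q * (levelTime n m q K + 3) + 4

theorem runs_buildTree {Q : ℕ → ℕ → ℕ → ℕ} (hO : SolvesFOLearn Q O) {c n m q : ℕ}
    {G : ColoredGraph c n} {s : State} (hc : QueryCtx G q m s)
    (hB : ∀ a b : Fin q → Fin n, B (pairInstance G m q a b)) (hm : L 0 q q < m) (hn : 0 < n)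
    (hN : s.reg rNodes = 2) (htop : s.reg rTop = 2 * q) (hptr : s.arr aPtr 1 = q)
    (hzero : (∀ i, s.arr aTup i = 0) ∧ (∀ i, s.arr aPar i = 0) ∧ ∀ i, s.arr aDep i = 0) :
    Runs O B buildTree s (treeTime n m q (typeBound c (Q q q 0) q))
      (LevelInv G q (typeBound c (Q q q 0) q) q) := by
  obtain ⟨ztup, zpar, zdep⟩ := hzero
  refine Runs.straight_seq (T := 3 + q * (levelTime n m q (typeBound c (Q q q 0) q) + 3)) rfl
    (fun F => ?_) (by simp only [Program.cost, treeTime]; omega)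
  have hc₀ := hc.mono F rfl
  refine runs_forLoop (LevelInv G q (typeBound c (Q q q 0) q)) rfl hc₀.one hc₀.rank ?_ ?_ ?_
    fun s' _ h => h
  · rintro d s' v w ⟨h1, h2, h3, h4, h5, h6, h7⟩
    have hN' : ((s'.setReg rDepth v).setReg 2 w).reg rNodes = s'.reg rNodes := by simp
    have hlo : ((s'.setReg rDepth v).setReg 2 w).reg rLo = s'.reg rLo := by simp
    have he' : Extends q s' ((s'.setReg rDepth v).setReg 2 w) :=
      extends_of_eq hN' ⟨rfl, rfl, rfl, rfl⟩
    refine ⟨h1.congr he' hN' (by simp), by rwa [hlo], by rwa [hlo, hN'], by rwa [hN'], ?_, ?_, ?_⟩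
    · rw [hlo, hN']; exact h5
    · rw [hlo]; exact h6
    · rw [hlo]
      intro x hx1 hx2 v k hk xs hxs
      rw [hN']
      exact h7 x hx1 hx2 v k hk xs hxs
  · set s₀ := (Program.const rLo 1).run s
    have e8 : s₀.reg rNodes = 2 := (F.reg 8 rfl).trans hN
    have e22 : s₀.reg rLo = 1 := by simp [s₀, Program.run]
    have one : ∀ {x}, 1 ≤ x → x < s₀.reg rNodes → x = 1 := fun h1 h2 => by omega
    refine ⟨⟨by omega, ?_, fun x h1 h2 => ?_, fun x h1 h2 j hj => ?_, zdep 1, zpar 0, zpar 1,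
      fun y h1 h2 => by omega, fun y h1 h2 => by omega, fun y h1 h2 => by omega,
      fun y h1 h2 => by omega, fun y h1 h2 => by omega⟩, e22.ge, by omega, by simp [e8],
      fun x h1 h2 => zdep x, fun x h1 h2 => by omega, fun x h1 h2 => by omega⟩
    · rw [F.reg 9 rfl, htop, e8]
    · obtain rfl := one h1 h2
      rw [F.arr 17 rfl, hptr, one_mul]
    · rw [F.arr 12 rfl, ztup]; exact hn
  · intro d s' hd F' rd hl
    exact runs_levelStep hO (hc₀.mono F' rfl) hl hB hm hd rd

/-- When level `q` is reached, every node of smaller depth has been expanded. The tuple of a node of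
depth `k` consists of the first `k` entries of its `q`-tuple. -/
theorem LevelInv.isTree {c n q K : ℕ} {G : ColoredGraph c n} {s : State}
    (h : LevelInv G q K q s) : IsTree G q (s.reg rNodes) (s.arr aTup) (s.arr aPar) (s.arr aPtr)
      (s.arr aDep) := by
  have ht := h.tree
  refine ⟨ht.root, ht.dep_root, ht.par_zero, ht.par_root, ht.par_pos, ht.dep_child,
    fun y h2 hy j hj => ?_, fun y h2 hy => ?_, fun x hx hxN hd xs hxs v => ?_⟩
  · have hp := (ht.par_lt y h2 hy).trans hy
    rw [ht.ptr y (by omega) hy, ht.ptr _ (ht.par_pos y h2 hy) hp]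
    exact ht.tup_child y h2 hy j (hj.trans (ht.dep_lt y h2 hy)) hj.ne
  · rw [ht.ptr y (by omega) hy]
    exact ht.tup_lt y (by omega) hy _ (ht.dep_lt y h2 hy)
  · have hlo : x < s.reg rLo := by
      by_contra hlo
      rw [h.level x (by omega) hxN] at hd
      exact lt_irrefl _ hd
    obtain ⟨y, hy, hp, u, hu, hr⟩ := h.covered x hx hlo v _ rfl xs fun j => by
      rw [← hxs j, ht.ptr x hx hxN]
    have : 2 ≤ y := by
      by_contra hy2
      have hy' : y = 0 ∨ y = 1 := by omega
      rcases hy' with rfl | rfl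
      · rw [ht.par_zero] at hp; omega
      · rw [ht.par_root] at hp; omega
    exact ⟨y, hy, hp, u, by rw [ht.ptr y (by omega) hy, hu], hr⟩

end

/-! ### Model checking -/

/-- The program that decides `G ⊨ φ`: it parses `φ`, builds the tree of representative tuples
unless the graph is empty, and evaluates `φ` on the tree. -/
def modelChecker : Program :=
  (.const rOne 1 ;; .const rA 0 ;; .load rVert aInput rA ;; .load rCol aInput rOne ;;
    .const rStack 1) ;;
  parseLoop ;;
  (.const rNodes 2 ;; .add rTop rRank rRank ;; .store aPtr rOne rRank) ;;
  .ite rVert (countCopies ;; buildTables ;; buildGraph ;; buildTree) .skip ;;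
  evalLoop ;;
  .load rRes aVec rOne

/-- Running time of everything between parsing and evaluation. -/
def prepTime (n c m q K : ℕ) : ℕ :=
  10 + ((n + c + m) * 8 + 2 * (m * (n * 7 + 6)) + 16) +
    (m * n * (m * n * 17 + 6) + (c + m) * (m * n * 10 + 6) + 20) + treeTime n m q K

/-- The factor in the running time, in terms of the number `m` of copies and a bound `K` on the
number of types. -/
def costFactor (q c m K : ℕ) : ℕ :=
  prepTime 1 c m q K + ((K + 1) ^ q * 40 + 80) + 100 + (q + q + c + m)

/-- The quantities `n ^ 2 + l` and `1` dominate all that occurs in the running time. -/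
theorem prepTime_le {n S : ℕ} (h1 : 1 ≤ S) (hn : n ^ 2 ≤ S) (c m q K : ℕ) :
    prepTime n c m q K ≤ prepTime 1 c m q K * S := by
  have hn1 : n ≤ S := (Nat.le_self_pow two_ne_zero n).trans hn
  have key : ∀ a b, a * n + b ≤ (a * 1 + b) * S := fun a b => by
    rw [mul_one, add_mul]
    exact add_le_add (Nat.mul_le_mul_left a hn1) (Nat.le_mul_of_pos_right b h1)
  have h2 : (n + c + m) * 8 + 2 * (m * (n * 7 + 6)) + 16 ≤
      ((1 + c + m) * 8 + 2 * (m * (1 * 7 + 6)) + 16) * S := by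
    have := key (8 + 2 * m * 7) ((c + m) * 8 + 2 * m * 6 + 16)
    ring_nf at this ⊢
    exact this
  have h3 : m * n * (m * n * 17 + 6) + (c + m) * (m * n * 10 + 6) + 20 ≤
      (m * 1 * (m * 1 * 17 + 6) + (c + m) * (m * 1 * 10 + 6) + 20) * S := by
    have h := key (m * 6 + (c + m) * m * 10) ((c + m) * 6 + 20)
    have h' := Nat.mul_le_mul_left (m * m * 17) hn
    calc _ = m * m * 17 * n ^ 2 + ((m * 6 + (c + m) * m * 10) * n + ((c + m) * 6 + 20)) := by ring
      _ ≤ m * m * 17 * S + ((m * 6 + (c + m) * m * 10) * 1 + ((c + m) * 6 + 20)) * S :=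
        add_le_add h' h
      _ = _ := by ring
  have h4 : treeTime n m q K ≤ treeTime 1 m q K * S := by
    have h := key (q * ((K + 1) ^ q * (tryTime m q K + 3))) (q * ((K + 1) ^ q * 11 + 12) + 4)
    simp only [treeTime, levelTime, expandTime]
    generalize tryTime m q K = x at *
    generalize (K + 1) ^ q = y at *
    calc _ = q * (y * (x + 3)) * n + (q * (y * 11 + 12) + 4) := by ring
      _ ≤ _ := h
      _ = _ := by ring
  have h0 : 10 ≤ 10 * S := by omega
  simp only [prepTime, add_mul] at *
  omega

theorem primrec_pow : Primrec₂ ((· ^ ·) : ℕ → ℕ → ℕ) := Primrec₂.unpaired'.1 Nat.Primrec.pow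

theorem primrec_typeBound : Primrec fun x : ℕ × ℕ × ℕ => typeBound x.1 x.2.1 x.2.2 := by
  have hc : Primrec fun x : ℕ × ℕ × ℕ => x.1 := .fst
  have hr : Primrec fun x : ℕ × ℕ × ℕ => x.2.1 := .comp .fst .snd
  have hk : Primrec fun x : ℕ × ℕ × ℕ => x.2.2 := .comp .snd .snd
  have hkr := Primrec.nat_add.comp hk hr
  refine Primrec.nat_iterate (.comp .succ hr) ?_
    (Primrec.to₂ (primrec_pow.comp (.const 2) .snd) : Primrec₂ fun (_ : ℕ × ℕ × ℕ) y => 2 ^ y)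
  exact Primrec.nat_add.comp (Primrec.nat_add.comp (Primrec.nat_mul.comp hkr hkr)
    (Primrec.nat_mul.comp hkr hkr)) (Primrec.nat_mul.comp hc hkr)

theorem primrec_costFactor :
    Primrec fun x : ℕ × ℕ × ℕ × ℕ => costFactor x.1 x.2.1 x.2.2.1 x.2.2.2 := by
  have hq : Primrec fun x : ℕ × ℕ × ℕ × ℕ => x.1 := .fst
  have hc : Primrec fun x : ℕ × ℕ × ℕ × ℕ => x.2.1 := .comp .fst .snd
  have hm : Primrec fun x : ℕ × ℕ × ℕ × ℕ => x.2.2.1 := .comp .fst (.comp .snd .snd)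
  have hK : Primrec fun x : ℕ × ℕ × ℕ × ℕ => x.2.2.2 := .comp .snd (.comp .snd .snd)
  have add : ∀ {f g : ℕ × ℕ × ℕ × ℕ → ℕ}, Primrec f → Primrec g → Primrec fun x => f x + g x :=
    fun hf hg => Primrec.nat_add.comp hf hg
  have mul : ∀ {f g : ℕ × ℕ × ℕ × ℕ → ℕ}, Primrec f → Primrec g → Primrec fun x => f x * g x :=
    fun hf hg => Primrec.nat_mul.comp hf hg
  have pow : ∀ {f g : ℕ × ℕ × ℕ × ℕ → ℕ}, Primrec f → Primrec g → Primrec fun x => f x ^ g x :=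
    fun hf hg => primrec_pow.comp hf hg
  simp only [costFactor, prepTime, treeTime, levelTime, expandTime, tryTime, exampleTime]
  repeat' with_reducible first
    | exact Primrec.const _
    | exact hq
    | exact hc
    | exact hm
    | exact hK
    | apply add
    | apply mul
    | apply pow

/-- The function that bounds the running time and the parameters of the oracle calls. -/
def timeBound (L Q : ℕ → ℕ → ℕ → ℕ) (q c : ℕ) : ℕ :=
  costFactor q c (L 0 q q + 1) (typeBound c (Q q q 0) q)

theorem computable_timeBound {L Q : ℕ → ℕ → ℕ → ℕ}
    (hL : Computable fun x : ℕ × ℕ × ℕ => L x.1 x.2.1 x.2.2)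
    (hQ : Computable fun x : ℕ × ℕ × ℕ => Q x.1 x.2.1 x.2.2) : Computable₂ (timeBound L Q) := by
  have hq : Computable fun x : ℕ × ℕ => x.1 := .fst
  have hc : Computable fun x : ℕ × ℕ => x.2 := .snd
  have hm : Computable fun x : ℕ × ℕ => L 0 x.1 x.1 + 1 :=
    Computable.succ.comp (hL.comp (.pair (.const 0) (.pair hq hq)))
  have hQ' : Computable fun x : ℕ × ℕ => (x.2, Q x.1 x.1 0, x.1) :=
    .pair hc (.pair (hQ.comp (.pair hq (.pair hq (.const 0)))) hq)
  have hK : Computable fun x : ℕ × ℕ => typeBound x.2 (Q x.1 x.1 0) x.1 :=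
    primrec_typeBound.to_comp.comp hQ'
  have hp : Computable fun x : ℕ × ℕ =>
      (x.1, x.2, L 0 x.1 x.1 + 1, typeBound x.2 (Q x.1 x.1 0) x.1) :=
    .pair hq (.pair hc (.pair hm hK))
  exact (primrec_costFactor.to_comp.comp hp).to₂

section

variable {L : ℕ → ℕ → ℕ → ℕ} {O : LearnOracle L} {B : LearnInput → Prop}

/-- The part of the program between parsing and evaluation produces a tree of representative
tuples. -/
theorem runs_prepare {Q : ℕ → ℕ → ℕ → ℕ} (hO : SolvesFOLearn Q O) {c n q : ℕ}
    {G : ColoredGraph c n} {s : State}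
    (hB₁ : 0 < n → B (emptyInstance q))
    (hB₂ : 0 < n → ∀ a b : Fin q → Fin n, B (pairInstance G (L 0 q q + 1) q a b))
    (h1 : s.reg rOne = 1) (hn : s.reg rVert = n) (hc : s.reg rCol = c) (hq : s.reg rRank = q)
    (hN : s.reg rNodes = 2) (htop : s.reg rTop = 2 * q)
    (hptr : ∀ i, s.arr aPtr i = if i = 1 then q else 0)
    (hG : StoresGraph (s.arr aAdj) (s.arr aCol) G)
    (hzero : ∀ a, (4 ≤ a ∧ a ≤ 8) ∨ (12 ≤ a ∧ a ≤ 14) ∨ a = 22 → ∀ i, s.arr a i = 0) :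
    Runs O B (.ite rVert (countCopies ;; buildTables ;; buildGraph ;; buildTree) .skip) s
      (prepTime n c (L 0 q q + 1) q (typeBound c (Q q q 0) q) + 2) fun s' =>
        s'.reg rNodes ≤ 1 + (typeBound c (Q q q 0) q + 1) ^ q + 1 ∧
        EvalCtx G q (s'.reg rNodes) (s'.arr aTup) (s'.arr aPar) (s'.arr aPtr) (s'.arr aDep) s' := by
  set m := L 0 q q + 1 with hm
  set K := typeBound c (Q q q 0) q with hK
  refine (Runs.ite (T := prepTime n c m q K + 1) (fun hn0 => ?_) fun hn0 => ?_).mono (by omega)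
    fun _ _ h => h
  · have hpos : 0 < n := by omega
    refine (Runs.seq (runs_countCopies hO s (hB₁ hpos) h1 hq fun a h4 h8 i =>
      hzero a (.inl ⟨h4, h8⟩) i) fun s₁ F₁ p₁ => Runs.seq
        (runs_buildTables (c := c) (n := n) (m := m)
        s₁ ((F₁.reg 1 rfl).trans h1) ((F₁.reg 3 rfl).trans hn) ((F₁.reg 4 rfl).trans hc) p₁.1
        (by rw [F₁.arr 14 rfl]; exact hzero 14 (by omega) 0)) fun s₂ F₂ p₂ =>
      Runs.seq (runs_buildGraph (q := q) G s₂ ?_ ?_ ?_ ?_ ?_ p₂ ?_ ?_) fun s₃ F₃ p₃ =>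
      runs_buildTree (Q := Q) hO p₃ (hB₂ hpos) (Nat.lt_succ_self _) hpos ?_ ?_ ?_
        ⟨?_, ?_, ?_⟩ |>.mono le_rfl
        (Ψ := fun s' => LevelInv G q K q s' ∧ ∀ i ≤ n + c + m, s'.arr aMul i = i * n)
        fun s₄ F₄ p₄ => ⟨p₄, by rw [F₄.arr 14 rfl]; exact p₃.mul⟩).mono ?_
      fun s₄ F₄ p₄ => ?_
    · rw [F₂.reg 1 rfl, F₁.reg 1 rfl, h1]
    · rw [F₂.reg 3 rfl, F₁.reg 3 rfl, hn]
    · rw [F₂.reg 4 rfl, F₁.reg 4 rfl, hc]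
    · rw [F₂.reg 5 rfl, F₁.reg 5 rfl, hq]
    · rw [F₂.reg 6 rfl, p₁.1]
    · rw [F₂.arr 1 rfl, F₁.arr 1 rfl, F₂.arr 2 rfl, F₁.arr 2 rfl]; exact hG
    · rw [F₂.arr 4 rfl]; exact p₁.2
    · rw [F₃.reg 8 rfl, F₂.reg 8 rfl, F₁.reg 8 rfl, hN]
    · rw [F₃.reg 9 rfl, F₂.reg 9 rfl, F₁.reg 9 rfl, htop]
    · rw [F₃.arr 17 rfl, F₂.arr 17 rfl, F₁.arr 17 rfl, hptr, if_pos rfl]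
    · rw [F₃.arr 12 rfl, F₂.arr 12 rfl, F₁.arr 12 rfl]; exact hzero 12 (by omega)
    · rw [F₃.arr 13 rfl, F₂.arr 13 rfl, F₁.arr 13 rfl]; exact hzero 13 (by omega)
    · rw [F₃.arr 22 rfl, F₂.arr 22 rfl, F₁.arr 22 rfl]; exact hzero 22 (by omega)
    · simp only [prepTime, ← hK]; omega
    · refine ⟨by have := p₄.1.bound; omega, ⟨?_, rfl, ?_, fun i hi => p₄.2 i (by omega), rfl, rfl,
        rfl, p₄.1.isTree⟩⟩
      · rw [F₄.reg 1 rfl, h1]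
      · rw [F₄.arr 1 rfl, F₄.arr 2 rfl]; exact hG
  · obtain rfl : n = 0 := by omega
    refine .straight rfl (by simp [Program.cost, prepTime]) ⟨by simp [Program.run, hN], ?_⟩
    have hpar : ∀ i, s.arr aPar i = 0 := hzero 13 (by omega)
    have hdep : ∀ i, s.arr aDep i = 0 := hzero 22 (by omega)
    refine ⟨h1, rfl, hG, fun i _ => (hzero 14 (by omega) i).trans (mul_zero i).symm,
      rfl, rfl, rfl, ?_⟩
    simp only [Program.run, hN]
    exact ⟨one_lt_two, hdep 1, hpar 0, hpar 1, fun y h2 h3 => by omega, fun y h2 h3 => by omega,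
      fun y h2 h3 => by omega, fun y h2 h3 => by omega, fun x _ _ _ _ _ v => v.elim0⟩

theorem runs_modelChecker {Q : ℕ → ℕ → ℕ → ℕ} (hO : SolvesFOLearn Q O) {c n : ℕ}
    {G : ColoredGraph c n} (φ : (graphLang c).Sentence) {s : State}
    (hs : s.IsModelCheckingInput G φ)
    (hB₁ : 0 < n → B (emptyInstance (quantRank φ)))
    (hB₂ : 0 < n → ∀ a b : Fin (quantRank φ) → Fin n,
      B (pairInstance G (L 0 (quantRank φ) (quantRank φ) + 1) (quantRank φ) a b)) :
    Runs O B modelChecker s (timeBound L Q (quantRank φ) c * (n ^ 2 + (sentenceCode φ).length))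
      fun s' => s'.reg 0 = 1 ∧ G.Models φ Empty.elim ∨ s'.reg 0 = 0 ∧ ¬ G.Models φ Empty.elim := by
  classical
  set q := quantRank φ with hq
  set m := L 0 q q + 1 with hm
  set K := typeBound c (Q q q 0) q with hK
  obtain ⟨hn, hc, -, hG, hcode, hreg, harr⟩ := hs
  have hlen : (tokens φ 0).length ≤ (sentenceCode φ).length := length_tokens_le φ 0
  have hlen1 : 1 ≤ (sentenceCode φ).length := by
    refine le_trans ?_ hlen
    cases φ <;> simp [tokens]
  refine (Runs.straight_seq (T := 1 + 25 * (tokens φ 0).length + (3 + (prepTime n c m q K + 2 +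
    (1 + (tokens φ 0).length * (((K + 1) ^ q + 2) * 40 + 40) + 1)))) rfl (fun F₀ => ?_)
    (T' := timeBound L Q q c * (n ^ 2 + (sentenceCode φ).length)) ?_)
  swap
  · have h1 : 1 ≤ n ^ 2 + (sentenceCode φ).length := by omega
    have hprep := prepTime_le h1 (Nat.le_add_right (n ^ 2) _) c m q K
    have htok : (tokens φ 0).length ≤ n ^ 2 + (sentenceCode φ).length := by omega
    simp only [timeBound, costFactor, ← hm, ← hK]
    generalize n ^ 2 + (sentenceCode φ).length = S at *
    generalize (tokens φ 0).length = l at *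
    generalize (K + 1) ^ q = P at *
    have h2 : l * ((P + 2) * 40 + 40) ≤ (P * 40 + 120) * S := by
      rw [show (P + 2) * 40 + 40 = P * 40 + 120 by ring, mul_comm l]
      exact Nat.mul_le_mul_left _ htok
    have h3 : 0 ≤ (q + q + c + m) * S := Nat.zero_le _
    simp only [Program.cost, add_mul] at *
    omega
  set s₀ := (Program.seq _ _).run s with hs₀
  have e1 : s₀.reg rOne = 1 := by simp [hs₀, Program.run]
  have en : s₀.reg rVert = n := by simp [hs₀, Program.run, hn]
  have ec : s₀.reg rCol = c := by simp [hs₀, Program.run, hc]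
  have esp : s₀.reg rStack = 1 := by simp [hs₀, Program.run]
  have er : ∀ x, x ≠ 1 → x ≠ 3 → x ≠ 4 → x ≠ 12 → x ≠ 15 → s₀.reg x = 0 := by
    intro x h1 h2 h3 h4 h5
    simp [hs₀, Program.run, hreg, h1, h2, h3, h4, h5]
  have ea : s₀.arr = s.arr := rfl
  refine Runs.seq (Ψ := fun s' => Parsed φ 0 s₀ s') (runs_parseLoop φ s₀ e1
    (er 16 (by decide) (by decide) (by decide) (by decide) (by decide))
    (fun i hi => by rw [ea, zero_add]; exact hcode i hi) (by omega)
    (by rw [ea]; exact harr 19 (by decide) _)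
    (Nat.zero_le _) fun s' P => Runs.loop_done (by have := P.stack; omega) P) fun s₁ F₁ P₁ => ?_
  have hrank : s₁.reg rRank = q := by
    rw [P₁.rank, er 5 (by decide) (by decide) (by decide) (by decide) (by decide)]
    simp [hq]
  refine Runs.straight_seq (T := prepTime n c m q K + 2 +
    (1 + (tokens φ 0).length * (((K + 1) ^ q + 2) * 40 + 40) + 1)) rfl (fun F₂ => ?_)
    (by simp only [Program.cost]; omega)
  set s₂ := (Program.seq _ _).run s₁ with hs₂
  have harr₂ : ∀ a, a ≠ 17 → a ≠ 18 → a ≠ 19 → s₂.arr a = s.arr a := by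
    intro a h1 h2 h3
    rw [F₂.arr a (by simp [Program.writesArr, h1]), F₁.arr a (by simp [parseLoop, parseStep,
      Program.writesArr, h2, h3]), ea]
  have e1₂ : s₂.reg rOne = 1 := by rw [F₂.reg 1 rfl, F₁.reg 1 rfl, e1]
  refine Runs.seq (runs_prepare (n := n) (c := c) (q := q) (G := G) hO hB₁ hB₂ e1₂ ?_ ?_ ?_ ?_ ?_ ?_
    ?_ ?_) fun s₃ F₃ p₃ => ?_
  · rw [F₂.reg 3 rfl, F₁.reg 3 rfl, en]
  · rw [F₂.reg 4 rfl, F₁.reg 4 rfl, ec]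
  · rw [F₂.reg 5 rfl, hrank]
  · simp [hs₂, Program.run]
  · simp [hs₂, Program.run, hrank, two_mul]
  · intro i
    have h17 : s₁.arr aPtr i = 0 := by rw [F₁.arr 17 rfl, ea]; exact harr 17 (by decide) i
    simp [hs₂, Program.run, hrank, F₁.reg 1 rfl, e1, h17]
  · rw [harr₂ 1 (by decide) (by decide) (by decide), harr₂ 2 (by decide) (by decide) (by decide)]
    exact hG
  · intro a ha i
    rw [harr₂ a (by omega) (by omega) (by omega)]
    exact harr a (by omega) i
  obtain ⟨hN, hctx⟩ := p₃
  rw [← hK] at hN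
  have hcode₃ : s₃.arr aCode = s.arr aCode := by
    rw [F₃.arr 3 rfl, harr₂ 3 (by decide) (by decide) (by decide)]
  have hstart₃ : s₃.arr aStart = s₁.arr aStart := by rw [F₃.arr 18 rfl, F₂.arr 18 rfl]
  have htok₀ : s₀.reg rTok = 0 := er 17 (by decide) (by decide) (by decide) (by decide) (by decide)
  refine (Runs.seq (T₂ := 1) (Ψ := fun s' => s'.arr aVec 1 = if G.Models φ Empty.elim then 1 else 0)
    (runs_evalLoop φ s₃ (p := 0) (b := 0) (t := 0) (T := 1) hctx
    (fun i hi => by rw [hcode₃, zero_add]; exact hcode i hi) ?_ ?_ ?_ (by omega) fun s' E => ?_)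
    fun s₄ F₄ p₄ => .straight rfl le_rfl ?_).mono ?_ fun _ _ h => h
  · have h := P₁.start
    rw [htok₀] at h
    rw [hstart₃]
    exact h
  · rw [F₃.reg 17 rfl, F₂.reg 17 rfl, P₁.tok, htok₀]
  · rw [F₃.reg 36 rfl, F₂.reg 36 rfl, F₁.reg 36 rfl]
    exact er 36 (by decide) (by decide) (by decide) (by decide) (by decide)
  · refine Runs.loop_done E.tok ?_
    exact E.vec 1 le_rfl hctx.tree.root hctx.tree.dep_root default fun j => j.elim0
  · have e1₄ : s₄.reg rOne = 1 := by rw [F₄.reg 1 rfl]; exact hctx.one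
    simp only [Program.run, State.reg_setReg, if_true, e1₄, p₄]
    by_cases h : G.Models φ Empty.elim <;> simp [h]
  · have := Nat.mul_le_mul_left (tokens φ 0).length (show s₃.reg rNodes * 40 + 40 ≤
      ((K + 1) ^ q + 2) * 40 + 40 by omega)
    omega

end

end FOLearning

theorem mainTheorem2 (L Q : ℕ → ℕ → ℕ → ℕ)
    (hLc : Computable fun x : ℕ × ℕ × ℕ => L x.1 x.2.1 x.2.2)
    (hQc : Computable fun x : ℕ × ℕ × ℕ => Q x.1 x.2.1 x.2.2)
    (hL : ∀ ℓ k q, ℓ ≤ L ℓ k q) (hQ : ∀ q k ℓ, q ≤ Q q k ℓ) :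
    ∃ (P : FOLearning.Program) (g : ℕ → ℕ → ℕ), Computable₂ g ∧
      ∀ O : FOLearning.LearnOracle L, FOLearning.SolvesFOLearn Q O →
        ∀ (c n : ℕ) (G : FOLearning.ColoredGraph c n)
          (φ : (FOLearning.graphLang c).Sentence) (s : FOLearning.State),
          s.IsModelCheckingInput G φ →
          ∃ (t : ℕ) (s' : FOLearning.State),
            FOLearning.Exec O
              (fun I => I.n ≤ g (FOLearning.quantRank φ) c * n ∧
                I.k + I.ℓ + I.q + I.c ≤ g (FOLearning.quantRank φ) c) P s t s' ∧
            t ≤ g (FOLearning.quantRank φ) c *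
              (n ^ 2 + (FOLearning.sentenceCode φ).length) ∧
            (s'.reg 0 = 1 ∧ G.Models φ Empty.elim ∨
              s'.reg 0 = 0 ∧ ¬ G.Models φ Empty.elim) := by
  refine ⟨FOLearning.modelChecker, FOLearning.timeBound L Q,
    FOLearning.computable_timeBound hLc hQc, fun O hO c n G φ s hs =>
    FOLearning.runs_modelChecker hO φ hs (fun hn => ⟨?_, ?_⟩) fun hn a b => ⟨?_, ?_⟩⟩
  · refine le_trans ?_ (Nat.mul_le_mul_left _ hn)
    simp only [FOLearning.emptyInstance, FOLearning.timeBound, FOLearning.costFactor]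
    omega
  · simp only [FOLearning.emptyInstance, FOLearning.timeBound, FOLearning.costFactor]
    omega
  · refine Nat.mul_le_mul_right n ?_
    simp only [FOLearning.timeBound, FOLearning.costFactor]
    omega
  · simp only [FOLearning.pairInstance, FOLearning.timeBound, FOLearning.costFactor]
    omega
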